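/- Let $X_1,X_2,\dots$ be random vectors in $\mathbb R^d$ on a probability space, $S_n=X_1+\dots+X_n$ and $\mathcal F_n=\sigma(X_1,\dots,X_n)$. Assume $\mathbb E[X_1]=0$, $\sup_{n\ge1}\mathbb E\|X_n\|^p<\infty$ for some $p>2$, and for every $n\ge 1$ $$\mathbb E[X_{n+1}\mid\mathcal F_n]=\tfrac1n AS_n,\qquad \mathbb E[X_{n+1}X_{n+1}^\top\mid\mathcal F_n]=\Sigma+\mathcal E_n ,$$ where $A\in\mathbb R^{d\times d}$ has all its eigenvalues in $\{z\in\mathbb C:0<\operatorname{Re}z<1\}$, $\Sigma$ is a positive definite $d\times d$ matrix, and $\mathcal E_n$ is an $\mathcal F_n$-measurable random matrix with $\mathbb E\|\mathcal E_n\|\to0$. Let $E_s,E_c,E_u\subseteq\mathbb R^d$ be the sums of the real generalized eigenspaces of $A$ (complex conjugate eigenvalues grouped together) for the eigenvalues with real part $<\frac12$, $=\frac12$, $>\frac12$ respectively, so that $\mathbb R^d=E_s\oplus E_c\oplus E_u$. Let $P_s,P_c,P_u$ be the corresponding projections and $A_s,A_c,A_u$ the restrictions of $A$ to the three subspaces;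 write $n^B=\exp((\log n)B)$. Operators on one of the subspaces are extended by zero to the other two. (1) There is a random vector $W_u$ in $\mathbb R^d$ with $n^{-A}P_uS_n\to W_u$ almost surely. (2) There is a unique matrix $\Xi_s$ with $\Xi_s=P_s\Xi_sP_s^\top$ and $(\frac12I-A_s)\Xi_s+\Xi_s(\frac12I-A_s)^\top=P_s\Sigma P_s^\top$, where $I$ is the identity of $E_s$; and a unique matrix $\Xi_u$ with $\Xi_u=P_u\Xi_uP_u^\top$ and $(A_u-\frac12I)\Xi_u+\Xi_u(A_u-\frac12I)^\top=P_u\Sigma P_u^\top$, where $I$ is the identity of $E_u$. (3) Let $A_c=QJ_cQ^{-1}$ be any Jordan decomposition of $A_c$ on the complexification of $E_c$, with $J_c=\bigoplus_{r=1}^R(\lambda_rI_{m_r}+N_{m_r})$, $\operatorname{Re}\lambda_r=\frac12$, $m_r\ge 1$, where $N_m$ has ones on the superdiagonal and zeros elsewhere. Put $$D_n=Q\bigoplus_{r=1}^R\operatorname{diag}\bigl((\log n)^{m_r-\frac12},\dots,(\log n)^{\frac32},(\log n)^{\frac12}\bigr)Q^{-1},$$ $\widetilde\Sigma=Q^{-1}P_c\Sigma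 P_c^\top(Q^{-1})^*$ with $(r,s)$ block $\widetilde\Sigma(r,s)$ of size $m_r\times m_s$, and $\Xi_c=Q\mathcal VQ^*$, where the $(r,s)$ block of $\mathcal V$ has the entries $$\mathcal V_{i,j}(r,s)=\frac{(-1)^{m_r+m_s-i-j}}{(m_r-i)!\,(m_s-j)!\,(m_r+m_s-i-j+1)}\,\widetilde\Sigma_{m_r,m_s}(r,s)\ \text{ if }\lambda_r=\lambda_s,\qquad \mathcal V_{i,j}(r,s)=0\ \text{ if }\lambda_r\neq\lambda_s .$$ Then, as $n\to\infty$, the random vector $$V_n=\Bigl(\frac{P_sS_n}{\sqrt n},\ D_n^{-1}n^{-A_c}P_cS_n,\ \frac{P_uS_n-n^{A_u}W_u}{\sqrt n}\Bigr)$$ converges in distribution to a centred Gaussian vector $Z$ with covariance $\mathbb E[ZZ^*]=\operatorname{diag}(\Xi_s,\Xi_c,\Xi_u)$. (a) If the matrices $D_n$ are real (which can always be achieved by choosing the Jordan chains of complex conjugate eigenvalues complex conjugate to each other and those of the eigenvalue $\frac12$ real), then $\Xi_c$ is real, $\operatorname{diag}(\Xi_s,\Xi_c,\Xi_u)$ is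 positive semidefinite, and the limit is the real Gaussian law $\mathcal N(0,\operatorname{diag}(\Xi_s,\Xi_c,\Xi_u))$. (b) For a general $Q$, the middle component of $V_n$ may be complex; then $Z$ is complex with jointly Gaussian real and imaginary parts, and its law is determined by the covariance above together with $\mathbb E[ZZ^\top]=\operatorname{diag}(\Xi_s,\Xi_c',\Xi_u)$, where $\Xi_c'=Q\mathcal V'Q^\top$ and $\mathcal V'$ is given by the formula for $\mathcal V$ with $\widetilde\Sigma$ replaced by $Q^{-1}P_c\Sigma P_c^\top(Q^{-1})^\top$ and the condition $\lambda_r=\lambda_s$ replaced by $\lambda_r=\overline{\lambda_s}$. -/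

import Mathlib

open MeasureTheory ProbabilityTheory Filter Topology Matrix

noncomputable section

namespace RWSD

/-! ### Linear algebra: spectral projections of a real matrix -/

/-- The complex matrix with the same entries as the real matrix `M`. -/
def toC {m n : Type*} (M : Matrix m n ℝ) : Matrix m n ℂ := M.map Complex.ofReal

/-- The inclusion of `ℝ^d` in `ℂ^d`. -/
def cplx (d : ℕ) : (Fin d → ℝ) →ₗ[ℝ] (Fin d → ℂ) where
  toFun v := fun i => (v i : ℂ)
  map_add' u v := by ext i; simp
  map_smul' c v := by ext i; simp

/-- Entrywise complex conjugation on `ℂ^d`. -/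
def conjVec (d : ℕ) : (Fin d → ℂ) →ₛₗ[starRingEnd ℂ] (Fin d → ℂ) where
  toFun v := fun i => (starRingEnd ℂ) (v i)
  map_add' u v := by ext i; simp
  map_smul' c v := by ext i; simp

/-- The sum of the complex generalized eigenspaces of `A` over the eigenvalues whose real part lies
in `T`. -/
def specC {d : ℕ} (A : Matrix (Fin d) (Fin d) ℝ) (T : Set ℝ) : Submodule ℂ (Fin d → ℂ) :=
  ⨆ (z : ℂ) (_ : z.re ∈ T), Module.End.maxGenEigenspace (Matrix.toLin' (toC A)) z

/-- The sum of the real generalized eigenspaces of `A` (complex conjugate eigenvalues grouped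
together) over the eigenvalues whose real part lies in `T`: the real vectors of `specC A T`. -/
def specR {d : ℕ} (A : Matrix (Fin d) (Fin d) ℝ) (T : Set ℝ) : Submodule ℝ (Fin d → ℝ) :=
  ((specC A T).restrictScalars ℝ).comap (cplx d)

theorem conjVec_toLin {d : ℕ} (A : Matrix (Fin d) (Fin d) ℝ) (v : Fin d → ℂ) :
    conjVec d (Matrix.toLin' (toC A) v) = Matrix.toLin' (toC A) (conjVec d v) := by
  ext i
  simp [conjVec, toC, Matrix.mulVec, dotProduct]

theorem conjVec_pow {d : ℕ} (A : Matrix (Fin d) (Fin d) ℝ) (z : ℂ) (k : ℕ) (v : Fin d → ℂ) :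
    conjVec d (((Matrix.toLin' (toC A) - z • (1 : Module.End ℂ (Fin d → ℂ))) ^ k) v) =
      ((Matrix.toLin' (toC A) - (starRingEnd ℂ z) • (1 : Module.End ℂ (Fin d → ℂ))) ^ k)
        (conjVec d v) := by
  induction k generalizing v with
  | zero => simp
  | succ k ih =>
    rw [pow_succ, pow_succ, Module.End.mul_apply, Module.End.mul_apply, ih]
    congr 1
    rw [LinearMap.sub_apply, LinearMap.sub_apply, map_sub, conjVec_toLin]
    simp [map_smulₛₗ]

theorem conjVec_mem {d : ℕ} (A : Matrix (Fin d) (Fin d) ℝ) (T : Set ℝ) {v : Fin d → ℂ}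
    (hv : v ∈ specC A T) : conjVec d v ∈ specC A T := by
  have h : specC A T ≤ (specC A T).comap (conjVec d) := by
    refine iSup₂_le fun z hz w hw => ?_
    rw [Submodule.mem_comap]
    have hz' : (starRingEnd ℂ z).re ∈ T := by simpa using hz
    refine (le_iSup₂_of_le (f := fun (z : ℂ) (_ : z.re ∈ T) =>
      Module.End.maxGenEigenspace (Matrix.toLin' (toC A)) z) (starRingEnd ℂ z) hz' le_rfl) ?_
    rw [Module.End.mem_maxGenEigenspace] at hw ⊢
    obtain ⟨k, hk⟩ := hw
    exact ⟨k, by rw [← conjVec_pow, hk, map_zero]⟩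
  exact h hv

theorem specC_isCompl {d : ℕ} (A : Matrix (Fin d) (Fin d) ℝ) (T : Set ℝ) :
    IsCompl (specC A T) (specC A Tᶜ) := by
  constructor
  · have h := (Module.End.independent_maxGenEigenspace
      (Matrix.toLin' (toC A))).disjoint_biSup_biSup (s := {z : ℂ | z.re ∈ T}) (t := {z : ℂ | z.re ∈ Tᶜ})
      (Set.disjoint_left.2 fun z h1 h2 => h2 h1)
    exact h
  · rw [codisjoint_iff, eq_top_iff, ← Module.End.iSup_maxGenEigenspace_eq_top
      (Matrix.toLin' (toC A))]
    refine iSup_le fun z => ?_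
    by_cases hz : z.re ∈ T
    · exact le_sup_of_le_left (le_iSup₂_of_le (f := fun (z : ℂ) (_ : z.re ∈ T) =>
        Module.End.maxGenEigenspace (Matrix.toLin' (toC A)) z) z hz le_rfl)
    · exact le_sup_of_le_right (le_iSup₂_of_le (f := fun (z : ℂ) (_ : z.re ∈ Tᶜ) =>
        Module.End.maxGenEigenspace (Matrix.toLin' (toC A)) z) z hz le_rfl)

theorem specR_isCompl {d : ℕ} (A : Matrix (Fin d) (Fin d) ℝ) (T : Set ℝ) :
    IsCompl (specR A T) (specR A Tᶜ) := by
  have hre : ∀ (U : Set ℝ) (x : Fin d → ℂ), x ∈ specC A U →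
      (fun i => (x i).re) ∈ specR A U := by
    intro U x hx
    change cplx d (fun i => (x i).re) ∈ specC A U
    have : cplx d (fun i => (x i).re) = (1 / 2 : ℂ) • (x + conjVec d x) := by
      ext i
      simp [cplx, conjVec, Complex.add_conj]
    rw [this]
    exact Submodule.smul_mem _ _ (Submodule.add_mem _ hx (conjVec_mem A U hx))
  constructor
  · rw [Submodule.disjoint_def]
    intro v h1 h2
    have h := (Submodule.disjoint_def.1 (specC_isCompl A T).disjoint) (cplx d v) h1 h2
    ext i
    have := congrFun h i
    simpa [cplx] using this
  · rw [codisjoint_iff, Submodule.eq_top_iff']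
    intro v
    have h : cplx d v ∈ specC A T ⊔ specC A Tᶜ := by
      rw [(specC_isCompl A T).sup_eq_top]; trivial
    obtain ⟨x, hx, y, hy, hxy⟩ := Submodule.mem_sup.1 h
    refine Submodule.mem_sup.2 ⟨_, hre T x hx, _, hre Tᶜ y hy, ?_⟩
    ext i
    have := congrArg Complex.re (congrFun hxy i)
    simpa [cplx] using this

/-- The matrix of the projection of `ℝ^d` onto `specR A T` along the sum `specR A Tᶜ` of all other
generalized eigenspaces. -/
def specProj {d : ℕ} (A : Matrix (Fin d) (Fin d) ℝ) (T : Set ℝ) : Matrix (Fin d) (Fin d) ℝ :=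
  LinearMap.toMatrix' ((specR A T).projection (specR A Tᶜ) (specR_isCompl A T))

/-- `P_s`: the projection onto the generalized eigenspaces with real part below `1/2`. -/
def projS {d : ℕ} (A : Matrix (Fin d) (Fin d) ℝ) : Matrix (Fin d) (Fin d) ℝ :=
  specProj A (Set.Iio (1 / 2))

/-- `P_c`: the projection onto the generalized eigenspaces with real part equal to `1/2`. -/
def projC {d : ℕ} (A : Matrix (Fin d) (Fin d) ℝ) : Matrix (Fin d) (Fin d) ℝ :=
  specProj A {1 / 2}

/-- `P_u`: the projection onto the generalized eigenspaces with real part above `1/2`. -/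
def projU {d : ℕ} (A : Matrix (Fin d) (Fin d) ℝ) : Matrix (Fin d) (Fin d) ℝ :=
  specProj A (Set.Ioi (1 / 2))

/-- `n ^ B = exp (log n • B)`. -/
def natPow {d : ℕ} (n : ℕ) (B : Matrix (Fin d) (Fin d) ℝ) : Matrix (Fin d) (Fin d) ℝ :=
  NormedSpace.exp (Real.log n • B)

/-- `Ξ` solves the Lyapunov equation `B Ξ + Ξ Bᵀ = P Σ Pᵀ` on the range of the projection `P`.
An operator on the range of `P` is represented by its extension by zero to the kernel of `P`, and
a bilinear tensor on the range of `P` by a matrix `Ξ` with `P Ξ Pᵀ = Ξ`. -/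
def IsLyapunovSolution {d : ℕ} (P B Sig Xi : Matrix (Fin d) (Fin d) ℝ) : Prop :=
  P * Xi * Pᵀ = Xi ∧ B * Xi + Xi * Bᵀ = P * Sig * Pᵀ

/-! ### Jordan form of the critical part -/

/-- The nilpotent `m × m` matrix with ones on the superdiagonal and zeros elsewhere. -/
def shift (m : ℕ) : Matrix (Fin m) (Fin m) ℂ :=
  Matrix.of fun i j => if (j : ℕ) = (i : ℕ) + 1 then 1 else 0

/-- A Jordan decomposition `A_c = Q J_c Q⁻¹` of the restriction `A_c` of `A` to (the
complexification of) the range `E_c` of `P_c`, with blocks `λ_r I + N` of size `m_r ≥ 1`,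
`Re λ_r = 1/2`. The columns of `Q` are the Jordan basis of `E_c`. Operators on `E_c`, and the inverse
`Qinv : E_c → ℂ^(m_1 + ⋯ + m_R)` of `Q`, are extended by zero to the kernel of `P_c`. -/
structure CriticalJordanForm {d : ℕ} (A : Matrix (Fin d) (Fin d) ℝ) where
  /-- number of blocks -/
  R : ℕ
  /-- block sizes -/
  m : Fin R → ℕ
  m_pos : ∀ r, 0 < m r
  /-- eigenvalues of the blocks -/
  lam : Fin R → ℂ
  lam_re : ∀ r, (lam r).re = 1 / 2
  /-- the Jordan basis, as columns -/
  Q : Matrix (Fin d) (Σ r : Fin R, Fin (m r)) ℂ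
  /-- the inverse of `Q` on the complexification of `E_c`, zero on the kernel of `P_c` -/
  Qinv : Matrix (Σ r : Fin R, Fin (m r)) (Fin d) ℂ
  Qinv_mul_Q : Qinv * Q = 1
  Q_mul_Qinv : Q * Qinv = toC (projC A)
  jordan : toC (A * projC A) =
    Q * Matrix.blockDiagonal' (fun r => lam r • (1 : Matrix (Fin (m r)) (Fin (m r)) ℂ) + shift (m r))
      * Qinv

namespace CriticalJordanForm

variable {d : ℕ} {A : Matrix (Fin d) (Fin d) ℝ}

/-- The exponent `m_r - i + 1/2` (with `i = 1, …, m_r`) of `log n` in the normalization. -/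
def expo (K : CriticalJordanForm A) (a : Σ r : Fin K.R, Fin (K.m r)) : ℝ :=
  (K.m a.1 : ℝ) - ((a.2 : ℕ) : ℝ) - 1 / 2

/-- `D_n = Q (⨁_r diag ((log n)^(m_r - 1/2), …, (log n)^(3/2), (log n)^(1/2))) Q⁻¹` on `E_c`. -/
def D (K : CriticalJordanForm A) (n : ℕ) : Matrix (Fin d) (Fin d) ℂ :=
  K.Q * Matrix.diagonal (fun a => ((Real.log n ^ K.expo a : ℝ) : ℂ)) * K.Qinv

/-- `D_n⁻¹`, the inverse of `D_n` on `E_c` (for `n ≥ 2`). -/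
def Dinv (K : CriticalJordanForm A) (n : ℕ) : Matrix (Fin d) (Fin d) ℂ :=
  K.Q * Matrix.diagonal (fun a => (((Real.log n ^ K.expo a)⁻¹ : ℝ) : ℂ)) * K.Qinv

theorem D_mul_Dinv (K : CriticalJordanForm A) {n : ℕ} (hn : 2 ≤ n) :
    K.D n * K.Dinv n = toC (projC A) := by
  have hlog : 0 < Real.log n := Real.log_pos (by exact_mod_cast hn)
  have h1 : Matrix.diagonal (fun a => ((Real.log n ^ K.expo a : ℝ) : ℂ)) *
      Matrix.diagonal (fun a => (((Real.log n ^ K.expo a)⁻¹ : ℝ) : ℂ)) = 1 := by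
    rw [Matrix.diagonal_mul_diagonal, ← Matrix.diagonal_one]
    congr 1
    funext a
    rw [← Complex.ofReal_mul, mul_inv_cancel₀ (Real.rpow_pos_of_pos hlog _).ne',
      Complex.ofReal_one]
  calc K.D n * K.Dinv n
      = K.Q * (Matrix.diagonal (fun a => ((Real.log n ^ K.expo a : ℝ) : ℂ)) *
          (K.Qinv * K.Q) *
          Matrix.diagonal (fun a => (((Real.log n ^ K.expo a)⁻¹ : ℝ) : ℂ))) * K.Qinv := by
        simp only [D, Dinv, Matrix.mul_assoc]
    _ = toC (projC A) := by rw [K.Qinv_mul_Q, Matrix.mul_one, h1, Matrix.mul_one, K.Q_mul_Qinv]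

/-- `m_r - i` for the position `i = 1, …, m_r` inside the block `r`. -/
def codepth (K : CriticalJordanForm A) (a : Σ r : Fin K.R, Fin (K.m r)) : ℕ :=
  K.m a.1 - 1 - (a.2 : ℕ)

/-- The last position `m_r` of the block `r`. -/
def last (K : CriticalJordanForm A) (r : Fin K.R) : Σ r : Fin K.R, Fin (K.m r) :=
  ⟨r, ⟨K.m r - 1, Nat.sub_lt (K.m_pos r) Nat.one_pos⟩⟩

open Classical in
/-- The block matrix whose `(r, s)` block has the entries
`(-1)^(m_r + m_s - i - j) / ((m_r - i)! (m_s - j)! (m_r + m_s - i - j + 1)) * T_{m_r, m_s}(r, s)`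
if `λ_r = κ_s`, and vanishes otherwise. -/
def limitBlocks (K : CriticalJordanForm A) (kap : Fin K.R → ℂ)
    (T : Matrix (Σ r : Fin K.R, Fin (K.m r)) (Σ r : Fin K.R, Fin (K.m r)) ℂ) :
    Matrix (Σ r : Fin K.R, Fin (K.m r)) (Σ r : Fin K.R, Fin (K.m r)) ℂ :=
  Matrix.of fun a b =>
    if K.lam a.1 = kap b.1 then
      (-1 : ℂ) ^ (K.codepth a + K.codepth b) /
        (((K.codepth a).factorial : ℂ) * ((K.codepth b).factorial : ℂ) *
          ((K.codepth a : ℂ) + (K.codepth b : ℂ) + 1)) * T (K.last a.1) (K.last b.1)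
    else 0

/-- `Ξ_c = Q 𝒱 Q*`, with `𝒱` built from `Σ̃ = Q⁻¹ P_c Σ P_cᵀ (Q⁻¹)*`. -/
def XiC (K : CriticalJordanForm A) (Sig : Matrix (Fin d) (Fin d) ℝ) : Matrix (Fin d) (Fin d) ℂ :=
  K.Q * K.limitBlocks K.lam (K.Qinv * toC (projC A * Sig * (projC A)ᵀ) * K.Qinvᴴ) * K.Qᴴ

/-- The companion of `Ξ_c` for the products `z_i z_j` without conjugation: transposes replace
conjugate transposes, and the blocks with `λ_r = conj λ_s` survive. -/
def pseudoXiC (K : CriticalJordanForm A) (Sig : Matrix (Fin d) (Fin d) ℝ) :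
    Matrix (Fin d) (Fin d) ℂ :=
  K.Q * K.limitBlocks (fun s => (starRingEnd ℂ) (K.lam s))
    (K.Qinv * toC (projC A * Sig * (projC A)ᵀ) * K.Qinvᵀ) * K.Qᵀ

end CriticalJordanForm

/-! ### Vectors and Gaussian laws -/

/-- The action of a matrix on Euclidean vectors. -/
def act {𝕜 : Type*} [RCLike 𝕜] {d : ℕ} (M : Matrix (Fin d) (Fin d) 𝕜)
    (v : EuclideanSpace 𝕜 (Fin d)) : EuclideanSpace 𝕜 (Fin d) :=
  WithLp.toLp 2 (M *ᵥ WithLp.ofLp v)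

/-- A real vector seen as a complex vector. -/
def vecC {d : ℕ} (v : EuclideanSpace ℝ (Fin d)) : EuclideanSpace ℂ (Fin d) :=
  WithLp.toLp 2 (fun i => (v i : ℂ))

/-- Three vectors stacked into one. -/
def stack {𝕜 : Type*} [RCLike 𝕜] {d : ℕ} (x y z : EuclideanSpace 𝕜 (Fin d)) :
    EuclideanSpace 𝕜 (Fin d ⊕ Fin d ⊕ Fin d) :=
  WithLp.toLp 2 (Sum.elim (WithLp.ofLp x) (Sum.elim (WithLp.ofLp y) (WithLp.ofLp z)))

/-- The block-diagonal matrix with three given blocks. -/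
def blockDiag {R : Type*} [Zero R] {d : ℕ} (M₁ M₂ M₃ : Matrix (Fin d) (Fin d) R) :
    Matrix (Fin d ⊕ Fin d ⊕ Fin d) (Fin d ⊕ Fin d ⊕ Fin d) R :=
  Matrix.fromBlocks M₁ 0 0 (Matrix.fromBlocks M₂ 0 0 M₃)

/-- `ν` is a centred Gaussian law on `ℂ^ι` (the real and imaginary parts of the entries of the random
vector `z` with law `ν` are jointly Gaussian) with `E[z z*] = Γ` and `E[z zᵀ] = C`. -/
structure IsCentredComplexGaussian {ι : Type*} [Fintype ι] (ν : Measure (EuclideanSpace ℂ ι))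
    (Gam C : Matrix ι ι ℂ) : Prop where
  gaussian : IsGaussian ν
  mean : ∫ z, z ∂ν = 0
  cov : ∀ i j, ∫ z, z i * (starRingEnd ℂ) (z j) ∂ν = Gam i j
  pcov : ∀ i j, ∫ z, z i * z j ∂ν = C i j

/-! ### The walk -/

/-- `S_n = X_1 + ⋯ + X_n`. -/
def walk {Ω : Type*} {d : ℕ} (X : ℕ → Ω → EuclideanSpace ℝ (Fin d)) (n : ℕ) (ω : Ω) :
    EuclideanSpace ℝ (Fin d) :=
  ∑ k ∈ Finset.Icc 1 n, X k ω

/-- `ℱ_n = σ(X_1, …, X_n)`. -/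
abbrev past {Ω : Type*} {d : ℕ} (X : ℕ → Ω → EuclideanSpace ℝ (Fin d)) (n : ℕ) :
    MeasurableSpace Ω :=
  ⨆ k ∈ Finset.Icc 1 n, MeasurableSpace.comap (X k) inferInstance

/-- The assumptions on the increments `X_1, X_2, …` (the value `X 0` plays no role): they are random
vectors with `E[X_1] = 0` and `sup_n E‖X_n‖^p < ∞` for some `p > 2`, and for `n ≥ 1`,
`E[X_{n+1} | ℱ_n] = (1/n) A S_n` and `E[X_{n+1} X_{n+1}ᵀ | ℱ_n] = Σ + ℰ_n` with `ℰ_n`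
measurable for `ℱ_n` and `E‖ℰ_n‖ → 0`. -/
structure IsLinearWalk {Ω : Type*} [MeasurableSpace Ω] (P : Measure Ω) {d : ℕ}
    (X : ℕ → Ω → EuclideanSpace ℝ (Fin d)) (A Sig : Matrix (Fin d) (Fin d) ℝ)
    (Err : ℕ → Ω → Matrix (Fin d) (Fin d) ℝ) : Prop where
  measurable : ∀ n, 1 ≤ n → Measurable (X n)
  mean_one : ∫ ω, X 1 ω ∂P = 0
  moment : ∃ p : ℝ, 2 < p ∧ ∃ C : NNReal, ∀ n, 1 ≤ n → ∫⁻ ω, ‖X n ω‖ₑ ^ p ∂P ≤ C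
  drift : ∀ n, 1 ≤ n → P[X (n + 1) | past X n] =ᵐ[P] fun ω => (1 / (n : ℝ)) • act A (walk X n ω)
  second : ∀ n, 1 ≤ n → ∀ i j,
    P[fun ω => X (n + 1) ω i * X (n + 1) ω j | past X n] =ᵐ[P] fun ω => Sig i j + Err n ω i j
  err_measurable : ∀ n, 1 ≤ n → ∀ i j, Measurable[past X n] fun ω => Err n ω i j
  err_tendsto : Tendsto (fun n => ∫ ω, ∑ i, ∑ j, |Err n ω i j| ∂P) atTop (𝓝 0)

end RWSD

end

/-! Put ε_{k+1} = X_{k+1} - A S_k / k. The walk solves the linear recursion S_{k+1} = (1 + A/k) S_k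
+ ε_{k+1}, driven by martingale differences, and k ↦ k^A solves the homogeneous recursion up to a
relative defect of order k⁻². Variation of constants (`act_flow_walk`) writes n^{-A} S_n exactly as
the sum of k^{-A} ε_k over k ≤ n plus a sum of defect terms. The trivial bound ‖S_k‖ = O(k) in L^p
makes the k-th defect term k^{-A} applied to a vector of size 1/k, so the defects are negligible
after normalization.

The spectrum is finite, so there are rates a < 1/2 on E_s, c > 1/2 on E_u and b < 1 on the whole
space (`HasRates`). Since k^{-A} P_u is square summable, the unstable martingale is bounded in L²
and converges almost surely to W_u. The rate b gives S_n = O(n^b) in L², whence (A S_n / n)(A S_n /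
n)ᵀ tends to 0 in mean and the ε_k also have asymptotic conditional covariance Σ.

Up to remainders that vanish in L¹, the three components of V_n are weighted sums of the same noise
ε_k: with weights n^{-1/2} (n/k)^A P_s for k ≤ n, D_n^{-1} k^{-A} P_c for k ≤ n, and -n^{-1/2}
(n/k)^A P_u for k > n. The last sum is cut at k = n², which keeps every sum finite; Fatou's lemma
handles what lies beyond.

The central limit theorem for such arrays is a replacement argument on characteristic functions
(`charFun_step`, `charFun_partial`): one increment at a time becomes a deterministic Gaussian
factor. It needs only that the weights are uniformly small and that the sums of b Σ bᵀ converge.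
What remains is to compute these limits. For the stable and unstable blocks, the Lyapunov equation
makes the sum telescope up to summable errors (`sum_conj_flow`). For the critical block, a Jordan
basis reduces the entries to sums of k^{-1-iθ} (log k)^q, which reach the order (log n)^{q+1} only
if θ = 0 (`tendsto_sum_log_pow`); hence only the last position of each block and matching
eigenvalues survive. Stable-critical covariances are O((log n)^{-1/2}), and covariances with the
unstable block vanish identically because the ranges of k are disjoint. The complex case is the real
one applied to real and imaginary parts. -/

namespace RWSD

/-! ### Matrix exponentials and growth on spectral subspaces. -/

section Exponentials

open scoped Matrix.Norms.Frobenius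

/-- An intertwining relation passes to exponentials. -/
theorem exp_mul_of_mul_eq {𝕜 m n : Type*} [RCLike 𝕜] [Fintype m] [DecidableEq m] [Fintype n]
    [DecidableEq n] {M : Matrix m m 𝕜} {Q : Matrix m n 𝕜} {J : Matrix n n 𝕜} (h : M * Q = Q * J) :
    NormedSpace.exp M * Q = Q * NormedSpace.exp J := by
  have hpow : ∀ k : ℕ, M ^ k * Q = Q * J ^ k := by
    intro k
    induction k with
    | zero => simp
    | succ k ih => rw [pow_succ, Matrix.mul_assoc, h, ← Matrix.mul_assoc, ih, Matrix.mul_assoc,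
        ← pow_succ]
  have h1 := NormedSpace.exp_series_hasSum_exp' (𝕂 := 𝕜) M
  have h2 := NormedSpace.exp_series_hasSum_exp' (𝕂 := 𝕜) J
  have h3 := h1.map (AddMonoidHom.mk' (fun X : Matrix m m 𝕜 => X * Q)
    (fun a b => Matrix.add_mul a b Q)) (by
      change Continuous fun X : Matrix m m 𝕜 => X * Q
      fun_prop)
  have h4 := h2.map (AddMonoidHom.mk' (fun X : Matrix n n 𝕜 => Q * X)
    (fun a b => Matrix.mul_add Q a b)) (by
      change Continuous fun X : Matrix n n 𝕜 => Q * X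
      fun_prop)
  have h5 : (fun k : ℕ => ((k.factorial : 𝕜))⁻¹ • M ^ k * Q) =
      fun k : ℕ => Q * (((k.factorial : 𝕜))⁻¹ • J ^ k) := by
    funext k
    simp [hpow]
  exact HasSum.unique (f := fun k : ℕ => ((k.factorial : 𝕜))⁻¹ • M ^ k * Q) h3 (h5 ▸ h4)

/-- On a vector killed by a power of `N`, the exponential series stops. -/
theorem exp_mulVec_of_pow {d : ℕ} {N : Matrix (Fin d) (Fin d) ℂ} {v : Fin d → ℂ} {k : ℕ}
    (h : N ^ k *ᵥ v = 0) (t : ℝ) :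
    NormedSpace.exp (t • N) *ᵥ v =
      ∑ j ∈ Finset.range k, (t ^ j / (j.factorial : ℝ)) • (N ^ j *ᵥ v) := by
  have h1 := NormedSpace.exp_series_hasSum_exp' (𝕂 := ℝ) (t • N)
  have h3 := h1.map (AddMonoidHom.mk' (fun X : Matrix (Fin d) (Fin d) ℂ => X *ᵥ v)
    (fun a b => Matrix.add_mulVec a b v)) (by
      change Continuous fun X : Matrix (Fin d) (Fin d) ℂ => X *ᵥ v
      fun_prop)
  have hz : ∀ j, k ≤ j → N ^ j *ᵥ v = 0 := by
    intro j hj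
    obtain ⟨l, rfl⟩ := Nat.exists_eq_add_of_le hj
    rw [add_comm, pow_add, ← Matrix.mulVec_mulVec, h, Matrix.mulVec_zero]
  refine h3.unique ?_
  have h5 : HasSum (fun j => (t ^ j / (j.factorial : ℝ)) • (N ^ j *ᵥ v))
      (∑ j ∈ Finset.range k, (t ^ j / (j.factorial : ℝ)) • (N ^ j *ᵥ v)) :=
    hasSum_sum_of_ne_finset_zero (fun j hj => by
      rw [hz j (by simpa using hj), smul_zero])
  convert h5 using 1
  funext j
  simp only [Function.comp, AddMonoidHom.mk'_apply, smul_pow, smul_smul, Matrix.smul_mulVec]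
  congr 1
  ring

/-- On a generalized eigenspace, `exp (t M) v` is e^{tz} times a polynomial in `t`, and an
arbitrarily small exponential e^{δ|t|} absorbs the polynomial. -/
theorem exists_norm_exp_mulVec_le {d : ℕ} {M : Matrix (Fin d) (Fin d) ℂ} {z : ℂ} {v : Fin d → ℂ}
    (hv : v ∈ Module.End.maxGenEigenspace (Matrix.toLin' M) z) {δ : ℝ} (hδ : 0 < δ) :
    ∃ C : ℝ, 0 ≤ C ∧ ∀ t : ℝ,
      ‖NormedSpace.exp (t • M) *ᵥ v‖ ≤ C * Real.exp (t * z.re + δ * |t|) := by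
  rw [Module.End.mem_maxGenEigenspace] at hv
  obtain ⟨k, hk⟩ := hv
  set N : Matrix (Fin d) (Fin d) ℂ := M - z • 1 with hN
  have hNk : N ^ k *ᵥ v = 0 := by
    have : (Matrix.toLin' M - z • (1 : Module.End ℂ (Fin d → ℂ))) ^ k = Matrix.toLin' (N ^ k) := by
      rw [Matrix.toLin'_pow, hN, map_sub, map_smul, Matrix.toLin'_one]; rfl
    rwa [this, Matrix.toLin'_apply] at hk
  have hsplit : ∀ t : ℝ, NormedSpace.exp (t • M) *ᵥ v =
      Complex.exp (t * z) • (NormedSpace.exp (t • N) *ᵥ v) := by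
    intro t
    have e1 : t • M = (t * z : ℂ) • (1 : Matrix (Fin d) (Fin d) ℂ) + t • N := by
      rw [hN, smul_sub, ← smul_assoc]
      simp
    have hc : Commute ((t * z : ℂ) • (1 : Matrix (Fin d) (Fin d) ℂ)) (t • N) :=
      ((Commute.one_left _).smul_left _)
    rw [e1, Matrix.exp_add_of_commute _ _ hc]
    have e2 : NormedSpace.exp ((t * z : ℂ) • (1 : Matrix (Fin d) (Fin d) ℂ)) =
        Complex.exp (t * z) • 1 := by
      rw [smul_one_eq_diagonal, Matrix.exp_diagonal, smul_one_eq_diagonal]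
      congr 1
      funext i
      rw [Pi.coe_exp, Complex.exp_eq_exp_ℂ]
    rw [e2, smul_mul_assoc, one_mul, Matrix.smul_mulVec]
  -- The constant comes from (δ|t|)^j / j! ≤ e^{δ|t|}, applied to each monomial of the polynomial.
  refine ⟨∑ j ∈ Finset.range k, (δ ^ j)⁻¹ * ‖N ^ j *ᵥ v‖,
    Finset.sum_nonneg fun j _ => by positivity, fun t => ?_⟩
  rw [hsplit, norm_smul, Complex.norm_exp, exp_mulVec_of_pow hNk]
  have hre : ((t : ℂ) * z).re = t * z.re := by simp
  rw [hre, Real.exp_add, mul_left_comm]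
  refine mul_le_mul_of_nonneg_left ?_ (Real.exp_pos _).le
  refine (norm_sum_le _ _).trans ?_
  rw [Finset.sum_mul]
  refine Finset.sum_le_sum fun j _ => ?_
  rw [norm_smul]
  have hb : ‖t ^ j / (j.factorial : ℝ)‖ ≤ (δ ^ j)⁻¹ * Real.exp (δ * |t|) := by
    have := Real.pow_div_factorial_le_exp (δ * |t|) (by positivity) j
    rw [norm_div, norm_pow, Real.norm_eq_abs, Real.norm_natCast, inv_mul_eq_div,
      le_div_iff₀ (by positivity)]
    rw [mul_pow] at this
    calc |t| ^ j / (j.factorial : ℝ) * δ ^ j = δ ^ j * |t| ^ j / (j.factorial : ℝ) := by ring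
      _ ≤ _ := this
  calc _ ≤ (δ ^ j)⁻¹ * Real.exp (δ * |t|) * ‖N ^ j *ᵥ v‖ := by gcongr
    _ = _ := by ring

/-- The vectors on which `exp (t σ M)` grows at most like `exp (a t)` for `t ≥ 0`. -/
def growthSubmodule {d : ℕ} (M : Matrix (Fin d) (Fin d) ℂ) (σ a : ℝ) :
    Submodule ℂ (Fin d → ℂ) where
  carrier := {v | ∃ C : ℝ, 0 ≤ C ∧ ∀ t : ℝ, 0 ≤ t →
    ‖NormedSpace.exp ((t * σ) • M) *ᵥ v‖ ≤ C * Real.exp (a * t)}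
  add_mem' := by
    rintro u v ⟨C, hC, h⟩ ⟨C', hC', h'⟩
    refine ⟨C + C', by positivity, fun t ht => ?_⟩
    rw [Matrix.mulVec_add, add_mul]
    exact (norm_add_le _ _).trans (add_le_add (h t ht) (h' t ht))
  zero_mem' := ⟨0, le_rfl, fun t _ => by simp⟩
  smul_mem' := by
    rintro c v ⟨C, hC, h⟩
    refine ⟨‖c‖ * C, by positivity, fun t ht => ?_⟩
    rw [Matrix.mulVec_smul, norm_smul, mul_assoc]
    exact mul_le_mul_of_nonneg_left (h t ht) (norm_nonneg _)

/-- Vectors of a given growth form a subspace, so a sum of generalized eigenspaces may be checked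
summand by summand. The sign of `σ` is the direction of time. -/
theorem specC_le_growthSubmodule {d : ℕ} (A : Matrix (Fin d) (Fin d) ℝ) {T : Set ℝ} {σ a : ℝ}
    (hT : ∀ z ∈ spectrum ℂ (toC A), z.re ∈ T → σ * z.re < a) :
    specC A T ≤ growthSubmodule (toC A) σ a := by
  refine iSup₂_le fun z hz v hv => ?_
  by_cases hzs : z ∈ spectrum ℂ (toC A)
  · have hlt := hT z hzs hz
    -- This `δ` satisfies σ Re z + δ|σ| ≤ a; the 1 added to |σ| avoids a division by zero when σ =
    -- 0.
    obtain ⟨C, hC, h⟩ := exists_norm_exp_mulVec_le hv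
      (δ := (a - σ * z.re) / (|σ| + 1)) (by
        have : 0 < |σ| + 1 := by positivity
        exact div_pos (by linarith) this)
    refine ⟨C, hC, fun t ht => (h (t * σ)).trans ?_⟩
    refine mul_le_mul_of_nonneg_left (Real.exp_le_exp.2 ?_) hC
    rw [abs_mul, abs_of_nonneg ht]
    have h1 : (a - σ * z.re) / (|σ| + 1) * |σ| ≤ a - σ * z.re := by
      rw [div_mul_eq_mul_div, div_le_iff₀ (by positivity)]
      have : 0 < a - σ * z.re := by linarith
      nlinarith [abs_nonneg σ]
    nlinarith
  -- The index `z` runs over all complex numbers; off the spectrum the generalized eigenspace is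
  -- trivial.
  · have hbot : Module.End.maxGenEigenspace (Matrix.toLin' (toC A)) z = ⊥ := by
      by_contra hne
      apply hzs
      rw [← Matrix.spectrum_toLin', ← Module.End.hasEigenvalue_iff_mem_spectrum]
      have : Module.End.HasUnifEigenvalue (Matrix.toLin' (toC A)) z ⊤ := hne
      exact (Module.End.hasUnifEigenvalue_iff_hasUnifEigenvalue_one
        (bot_lt_iff_ne_bot.2 ENat.top_ne_zero)).1 this
    rw [hbot, Submodule.mem_bot] at hv
    rw [hv]
    exact Submodule.zero_mem _

theorem toC_mul {l m n : Type*} [Fintype m] (M : Matrix l m ℝ) (N : Matrix m n ℝ) :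
    toC (M * N) = toC M * toC N := by
  ext i j
  simp [toC, Matrix.mul_apply]

theorem toC_smul {m n : Type*} (t : ℝ) (M : Matrix m n ℝ) : toC (t • M) = t • toC M := by
  ext i j; simp [toC]

theorem toC_exp {d : ℕ} (M : Matrix (Fin d) (Fin d) ℝ) :
    toC (NormedSpace.exp M) = NormedSpace.exp (toC M) :=
  NormedSpace.map_exp (Complex.ofRealHom.mapMatrix (m := Fin d))
    (by
      change Continuous fun M : Matrix (Fin d) (Fin d) ℝ => M.map Complex.ofReal
      exact continuous_id.matrix_map Complex.continuous_ofReal) M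

theorem norm_toC {m n : Type*} [Fintype m] [Fintype n] (M : Matrix m n ℝ) : ‖toC M‖ = ‖M‖ :=
  Matrix.frobenius_norm_map_eq _ _ fun a => by simp

theorem norm_le_sum_norm_entries {𝕜 m n : Type*} [RCLike 𝕜] [Fintype m] [Fintype n]
    (M : Matrix m n 𝕜) : ‖M‖ ≤ ∑ i, ∑ j, ‖M i j‖ := by
  rw [Matrix.frobenius_norm_def, ← Real.sqrt_eq_rpow]
  refine Real.sqrt_le_iff.2 ⟨Finset.sum_nonneg fun i _ => Finset.sum_nonneg fun j _ => norm_nonneg _, ?_⟩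
  rw [← Finset.sum_product', ← Finset.sum_product']
  simp only [Real.rpow_two]
  exact Finset.sum_sq_le_sq_sum_of_nonneg fun i _ => norm_nonneg _

/-- A vector is a one-column matrix whose Frobenius norm is its Euclidean norm, so this is
submultiplicativity. -/
theorem norm_act_le {𝕜 : Type*} [RCLike 𝕜] {d : ℕ} (M : Matrix (Fin d) (Fin d) 𝕜)
    (v : EuclideanSpace 𝕜 (Fin d)) : ‖act M v‖ ≤ ‖M‖ * ‖v‖ := by
  have h := Matrix.frobenius_norm_mul M (Matrix.replicateCol Unit (WithLp.ofLp v))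
  rw [← Matrix.replicateCol_mulVec, Matrix.frobenius_norm_replicateCol,
    Matrix.frobenius_norm_replicateCol] at h
  exact h

/-! ### Spectral projections -/

theorem specProj_mulVec {d : ℕ} (A : Matrix (Fin d) (Fin d) ℝ) (T : Set ℝ) (v : Fin d → ℝ) :
    specProj A T *ᵥ v = (specR A T).projection (specR A Tᶜ) (specR_isCompl A T) v := by
  rw [specProj, ← Matrix.toLin'_apply, Matrix.toLin'_toMatrix']

theorem specProj_mulVec_mem {d : ℕ} (A : Matrix (Fin d) (Fin d) ℝ) (T : Set ℝ) (v : Fin d → ℝ) :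
    specProj A T *ᵥ v ∈ specR A T := by
  rw [specProj_mulVec]
  exact Submodule.projection_apply_mem _ _

theorem specProj_mul_self {d : ℕ} (A : Matrix (Fin d) (Fin d) ℝ) (T : Set ℝ) :
    specProj A T * specProj A T = specProj A T := by
  rw [specProj, ← LinearMap.toMatrix'_mul,
    (Submodule.isIdempotentElem_projection (specR_isCompl A T)).eq]

theorem mulVec_mem_specR {d : ℕ} (A : Matrix (Fin d) (Fin d) ℝ) (T : Set ℝ) {v : Fin d → ℝ}
    (hv : v ∈ specR A T) : A *ᵥ v ∈ specR A T := by
  have hC : specC A T ≤ (specC A T).comap (Matrix.toLin' (toC A)) := by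
    refine iSup₂_le fun z hz w hw => ?_
    refine (le_iSup₂_of_le (f := fun (z : ℂ) (_ : z.re ∈ T) =>
      Module.End.maxGenEigenspace (Matrix.toLin' (toC A)) z) z hz le_rfl) ?_
    exact Module.End.mapsTo_maxGenEigenspace_of_comm (Commute.refl _) z hw
  have h := hC hv
  change cplx d (A *ᵥ v) ∈ specC A T
  rw [Submodule.mem_comap] at h
  convert h using 1
  ext i
  simp [cplx, toC, Matrix.mulVec, dotProduct]

/-- `A` maps both the range and the kernel of the projection into themselves. -/
theorem mul_specProj {d : ℕ} (A : Matrix (Fin d) (Fin d) ℝ) (T : Set ℝ) :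
    A * specProj A T = specProj A T * A := by
  apply Matrix.toLin'.injective
  ext1 i
  ext1
  set v : Fin d → ℝ := (LinearMap.single ℝ (fun _ => ℝ) i) 1
  simp only [LinearMap.comp_apply, Matrix.toLin'_apply, ← Matrix.mulVec_mulVec]
  have h1 := specProj_mulVec_mem A T v
  have h2 : v - specProj A T *ᵥ v ∈ specR A Tᶜ := by
    rw [specProj_mulVec]
    exact Submodule.sub_projection_mem _ _
  have h3 := mulVec_mem_specR A T h1
  have h4 := mulVec_mem_specR A Tᶜ h2
  have h5 : A *ᵥ v = A *ᵥ (specProj A T *ᵥ v) + A *ᵥ (v - specProj A T *ᵥ v) := by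
    rw [← Matrix.mulVec_add]; simp
  conv_rhs => rw [h5, Matrix.mulVec_add, specProj_mulVec A T (A *ᵥ (v - _)),
    (Submodule.projection_apply_eq_zero_iff _).2 h4, specProj_mulVec A T (A *ᵥ (_ *ᵥ _)),
    Submodule.projection_apply_of_mem_left _ h3, add_zero]

theorem specProj_univ {d : ℕ} (A : Matrix (Fin d) (Fin d) ℝ) : specProj A Set.univ = 1 := by
  have htop : specC A Set.univ = ⊤ := by
    rw [eq_top_iff, ← Module.End.iSup_maxGenEigenspace_eq_top (Matrix.toLin' (toC A))]
    exact iSup_le fun z => le_iSup₂_of_le (f := fun (z : ℂ) (_ : z.re ∈ Set.univ) =>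
      Module.End.maxGenEigenspace (Matrix.toLin' (toC A)) z) z (Set.mem_univ _) le_rfl
  apply Matrix.toLin'.injective
  ext1 i
  ext1
  simp only [LinearMap.comp_apply, Matrix.toLin'_apply, specProj_mulVec, Matrix.one_mulVec]
  refine Submodule.projection_apply_of_mem_left _ ?_
  change cplx d _ ∈ specC A Set.univ
  rw [htop]; trivial

/-- Spectral growth bound: `exp (t σ A)` restricted to a spectral subspace. -/
theorem exists_norm_exp_mul_specProj_le {d : ℕ} (A : Matrix (Fin d) (Fin d) ℝ) {T : Set ℝ}
    {σ a : ℝ} (hT : ∀ z ∈ spectrum ℂ (toC A), z.re ∈ T → σ * z.re < a) :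
    ∃ C : ℝ, 0 < C ∧ ∀ t : ℝ, 0 ≤ t →
      ‖NormedSpace.exp ((t * σ) • A) * specProj A T‖ ≤ C * Real.exp (a * t) := by
  have hcol : ∀ j : Fin d, ∃ C : ℝ, 0 ≤ C ∧ ∀ t : ℝ, 0 ≤ t → ∀ i,
      ‖(NormedSpace.exp ((t * σ) • A) * specProj A T) i j‖ ≤ C * Real.exp (a * t) := by
    intro j
    have hmem : cplx d (specProj A T *ᵥ Pi.single j 1) ∈ specC A T :=
      specProj_mulVec_mem A T (Pi.single j 1)
    obtain ⟨C, hC, h⟩ := specC_le_growthSubmodule A hT hmem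
    refine ⟨C, hC, fun t ht i => ?_⟩
    have h1 : cplx d (specProj A T *ᵥ Pi.single j 1) = fun i => ((specProj A T i j : ℝ) : ℂ) := by
      ext i; simp [cplx]
    have h2 := (norm_le_pi_norm (NormedSpace.exp ((t * σ) • toC A) *ᵥ
      (cplx d (specProj A T *ᵥ Pi.single j 1))) i).trans (h t ht)
    rw [← toC_smul, ← toC_exp, h1] at h2
    refine le_of_eq_of_le ?_ h2
    simp only [Matrix.mulVec, dotProduct, toC, Matrix.map_apply, Matrix.mul_apply]
    rw [← Complex.norm_real]
    congr 1
    push_cast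
    rfl
  choose C hC h using hcol
  have hC' : 0 ≤ ∑ _i : Fin d, ∑ j, C j :=
    Finset.sum_nonneg fun _ _ => Finset.sum_nonneg fun j _ => hC j
  refine ⟨(∑ _i : Fin d, ∑ j, C j) + 1, by positivity, fun t ht => ?_⟩
  refine (norm_le_sum_norm_entries _).trans ?_
  rw [add_mul, Finset.sum_mul]
  refine le_add_of_le_of_nonneg (Finset.sum_le_sum fun i _ => ?_) (by positivity)
  rw [Finset.sum_mul]
  exact Finset.sum_le_sum fun j _ => h j t ht i

/-- Used on the real parts of the spectrum: it leaves room between them and the thresholds 1/2 and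
1, and this room absorbs the polynomial factors of Jordan blocks. -/
theorem exists_between_of_finite {s : Set ℝ} (hs : s.Finite) {b x : ℝ} (hbx : b < x) :
    ∃ a, b < a ∧ a < x ∧ ∀ y ∈ s, y < x → y < a := by
  have h : ∀ᶠ a in 𝓝[<] x, ∀ y ∈ s, y < x → y < a := by
    rw [Filter.eventually_all_finite hs]
    intro y _
    by_cases hy : y < x
    · filter_upwards [Ioo_mem_nhdsLT hy] with a ha _ using ha.1
    · exact Filter.Eventually.of_forall fun a h => absurd h hy
  obtain ⟨a, ha, ha'⟩ := (h.and (Ioo_mem_nhdsLT hbx)).exists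
  exact ⟨a, ha'.1, ha'.2, ha⟩

theorem exists_between_of_finite' {s : Set ℝ} (hs : s.Finite) {b x : ℝ} (hxb : x < b) :
    ∃ a, x < a ∧ a < b ∧ ∀ y ∈ s, x < y → a < y := by
  obtain ⟨a, h1, h2, h3⟩ := exists_between_of_finite (hs.image (fun y => -y)) (neg_lt_neg hxb)
  refine ⟨-a, by linarith, by linarith, fun y hy hxy => ?_⟩
  have := h3 (-y) ⟨y, hy, rfl⟩ (by linarith)
  linarith

end Exponentials

/-! ### The flow n^A, its defect in the recursion, its rates. -/

section Flow

open scoped Matrix.Norms.Frobenius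

variable {d : ℕ}

/-- The one-parameter group `exp (t A)`. -/
noncomputable def flow (A : Matrix (Fin d) (Fin d) ℝ) (t : ℝ) : Matrix (Fin d) (Fin d) ℝ :=
  NormedSpace.exp (t • A)

theorem flow_zero (A : Matrix (Fin d) (Fin d) ℝ) : flow A 0 = 1 := by
  simp [flow, NormedSpace.exp_zero]

theorem flow_add (A : Matrix (Fin d) (Fin d) ℝ) (s t : ℝ) :
    flow A (s + t) = flow A s * flow A t := by
  rw [flow, add_smul, Matrix.exp_add_of_commute]
  · rfl
  · exact ((Commute.refl A).smul_left s).smul_right t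

theorem flow_mul_comm {A P : Matrix (Fin d) (Fin d) ℝ} (h : A * P = P * A) (t : ℝ) :
    flow A t * P = P * flow A t :=
  exp_mul_of_mul_eq (by rw [smul_mul_assoc, h, mul_smul_comm])

theorem flow_transpose (A : Matrix (Fin d) (Fin d) ℝ) (t : ℝ) : (flow A t)ᵀ = flow Aᵀ t := by
  rw [flow, ← Matrix.exp_transpose, Matrix.transpose_smul]; rfl

theorem continuous_flow (A : Matrix (Fin d) (Fin d) ℝ) : Continuous (flow A) :=
  NormedSpace.exp_continuous.comp (continuous_id.smul continuous_const)

theorem natPow_neg (A : Matrix (Fin d) (Fin d) ℝ) (n : ℕ) :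
    natPow n (-A) = flow A (-Real.log n) := by
  rw [natPow, flow, smul_neg, neg_smul]

/-- The exponential of the extension by zero `A * P` is the identity on the kernel of `P`. It agrees
with the flow of `A` only after multiplication by `P`, which is how both occur below. -/
theorem exp_smul_mul_proj {A P : Matrix (Fin d) (Fin d) ℝ} (hP : P * P = P) (h : A * P = P * A)
    (t : ℝ) : NormedSpace.exp (t • (A * P)) * P = flow A t * P := by
  rw [exp_mul_of_mul_eq (Q := P) (J := t • A), ← flow, flow_mul_comm h]
  rw [smul_mul_assoc, Matrix.mul_assoc, hP, mul_smul_comm, h]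

theorem natPow_mul_proj {A P : Matrix (Fin d) (Fin d) ℝ} (hP : P * P = P) (h : A * P = P * A)
    (n : ℕ) : natPow n (A * P) * P = flow A (Real.log n) * P :=
  exp_smul_mul_proj hP h _

theorem natPow_neg_mul_proj {A P : Matrix (Fin d) (Fin d) ℝ} (hP : P * P = P) (h : A * P = P * A)
    (n : ℕ) : natPow n (-(A * P)) * P = flow A (-Real.log n) * P := by
  rw [natPow, smul_neg, ← neg_smul]
  exact exp_smul_mul_proj hP h _

theorem exists_norm_exp_sub_le (B : Matrix (Fin d) (Fin d) ℝ) :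
    ∃ K : ℝ, 0 ≤ K ∧ ∀ y : ℝ, |y| ≤ 1 →
      ‖NormedSpace.exp (y • B) - 1 - y • B‖ ≤ K * y ^ 2 := by
  have hs := (hasSum_nat_add_iff' 2).2 (NormedSpace.exp_series_hasSum_exp' (𝕂 := ℝ) ‖B‖)
  -- The constant is the exponential series of ‖B‖ without its first two terms; it dominates the
  -- matrix tail once y² is pulled out, as |y| ≤ 1.
  refine ⟨_, hs.nonneg fun i => by positivity, fun y hy => ?_⟩
  have h := (hasSum_nat_add_iff' 2).2 (NormedSpace.exp_series_hasSum_exp' (𝕂 := ℝ) (y • B))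
  have h2 := hs.mul_right (y ^ 2)
  refine le_of_eq_of_le ?_ (h.norm_le_of_bounded h2 fun i => ?_)
  · simp only [Finset.sum_range_succ, Finset.range_zero, Finset.sum_empty, Nat.factorial, pow_zero,
      pow_one, Nat.cast_one, inv_one, one_smul, zero_add, mul_one, sub_sub]
    rfl
  · rw [norm_smul, smul_pow, norm_smul, norm_inv, Real.norm_natCast, norm_pow, Real.norm_eq_abs,
      smul_eq_mul]
    have h1 : ‖B ^ (i + 2)‖ ≤ ‖B‖ ^ (i + 2) := norm_pow_le' B (by omega)
    have h3 : |y| ^ (i + 2) ≤ y ^ 2 := by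
      rw [pow_add, sq_abs]
      exact mul_le_of_le_one_left (sq_nonneg _) (pow_le_one₀ (abs_nonneg _) hy)
    calc _ ≤ (((i + 2).factorial : ℝ))⁻¹ * (y ^ 2 * ‖B‖ ^ (i + 2)) := by gcongr
      _ = _ := by ring

theorem log_succ_sub {k : ℕ} (hk : 1 ≤ k) :
    0 ≤ Real.log (k + 1) - Real.log k ∧ Real.log (k + 1) - Real.log k ≤ 1 / k ∧
      1 / (k : ℝ) - (Real.log (k + 1) - Real.log k) ≤ (1 / (k : ℝ)) ^ 2 := by
  have hk0 : (0 : ℝ) < k := by exact_mod_cast hk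
  have e : Real.log (k + 1) - Real.log k = Real.log (1 + 1 / k) := by
    rw [← Real.log_div (by positivity) (by positivity)]
    congr 1; field_simp
  rw [e]
  have hx : 0 < 1 / (k : ℝ) := by positivity
  set x := 1 / (k : ℝ)
  refine ⟨Real.log_nonneg (by linarith), ?_, ?_⟩
  · have := Real.log_le_sub_one_of_pos (show 0 < 1 + x by linarith)
    linarith
  · have := Real.one_sub_inv_le_log_of_pos (show 0 < 1 + x by linarith)
    have h2 : 1 - (1 + x)⁻¹ = x - x ^ 2 * (1 + x)⁻¹ := by field_simp; ring
    have h3 : x ^ 2 * (1 + x)⁻¹ ≤ x ^ 2 := by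
      refine mul_le_of_le_one_right (by positivity) (inv_le_one_of_one_le₀ (by linarith))
    linarith

/-- Replacing log((k+1)/k) by 1/k costs O(k⁻²), the same order as the Taylor remainder. -/
theorem exists_norm_exp_log_sub_le (B : Matrix (Fin d) (Fin d) ℝ) :
    ∃ K : ℝ, 0 ≤ K ∧ ∀ k : ℕ, 1 ≤ k →
      ‖NormedSpace.exp ((Real.log (k + 1) - Real.log k) • B) - 1 - (1 / (k : ℝ)) • B‖
        ≤ K * (1 / (k : ℝ)) ^ 2 := by
  obtain ⟨K, hK, h⟩ := exists_norm_exp_sub_le B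
  refine ⟨K + ‖B‖, by positivity, fun k hk => ?_⟩
  obtain ⟨h1, h2, h3⟩ := log_succ_sub hk
  set y := Real.log (k + 1) - Real.log k
  set x := 1 / (k : ℝ)
  have hx1 : x ≤ 1 := by
    have : (1 : ℝ) ≤ k := by exact_mod_cast hk
    exact (div_le_one (by linarith)).2 this
  have hy := h y (by rw [abs_of_nonneg h1]; linarith)
  have e : NormedSpace.exp (y • B) - 1 - x • B =
      (NormedSpace.exp (y • B) - 1 - y • B) - (x - y) • B := by
    clear_value x y
    rw [sub_smul]; abel
  rw [e]
  refine (norm_sub_le _ _).trans ?_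
  rw [norm_smul, Real.norm_eq_abs, abs_of_nonneg (by linarith : 0 ≤ x - y)]
  have h5 : K * y ^ 2 ≤ K * x ^ 2 := by gcongr
  have h6 : (x - y) * ‖B‖ ≤ x ^ 2 * ‖B‖ := by gcongr
  linarith

/-- The defect of `n ^ A` as an exact solution of the recursion `x_{k+1} = (1 + A / k) x_k`. -/
noncomputable def defect (A : Matrix (Fin d) (Fin d) ℝ) (k : ℕ) : Matrix (Fin d) (Fin d) ℝ :=
  flow A (Real.log k - Real.log (k + 1)) * (1 + (1 / (k : ℝ)) • A) - 1

/-- With `r + 1 - x a` in the role of exp(-x a), the first-order terms cancel and only `r` and x²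
remain. -/
theorem add_one_sub_mul_one_add_sub {R : Type*} [Ring R] [Algebra ℝ R] (r a : R) (x : ℝ) :
    (r + 1 - x • a) * (1 + x • a) - 1 = r * (1 + x • a) - x ^ 2 • (a * a) := by
  simp only [add_mul, sub_mul, mul_add, mul_one, one_mul, smul_mul_assoc, mul_smul_comm, smul_add, smul_sub,
    smul_smul, pow_two]
  abel

/-- To first order the factors are 1 - A/k and 1 + A/k, whose product is 1 - A²/k². The order k⁻²
matters: against ‖S_k‖ = O(k) it leaves 1/k, which any extra negative power of k makes summable. -/
theorem exists_norm_defect_le (A : Matrix (Fin d) (Fin d) ℝ) :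
    ∃ K : ℝ, 0 ≤ K ∧ ∀ k : ℕ, 1 ≤ k → ‖defect A k‖ ≤ K * (1 / (k : ℝ)) ^ 2 := by
  obtain ⟨K, hK, h⟩ := exists_norm_exp_log_sub_le (-A)
  refine ⟨K * (‖(1 : Matrix (Fin d) (Fin d) ℝ)‖ + ‖A‖) + ‖A‖ * ‖A‖, by positivity,
    fun k hk => ?_⟩
  have h1 := h k hk
  have hx0 : 0 ≤ 1 / (k : ℝ) := by positivity
  have hx1 : 1 / (k : ℝ) ≤ 1 := by
    have : (1 : ℝ) ≤ k := by exact_mod_cast hk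
    exact (div_le_one (by linarith)).2 this
  set x := 1 / (k : ℝ)
  rw [smul_neg, ← neg_smul, neg_sub, ← flow] at h1
  set r := flow A (Real.log k - Real.log (k + 1)) - 1 - x • -A with hr
  have e : defect A k = r * (1 + x • A) - x ^ 2 • (A * A) := by
    have : flow A (Real.log k - Real.log (k + 1)) = r + 1 - x • A := by rw [hr, smul_neg]; abel
    rw [defect, this]
    exact add_one_sub_mul_one_add_sub r A x
  rw [e]
  refine (norm_sub_le _ _).trans ?_
  have h2 : ‖(1 : Matrix (Fin d) (Fin d) ℝ) + x • A‖ ≤ ‖(1 : Matrix (Fin d) (Fin d) ℝ)‖ + ‖A‖ := by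
    refine (norm_add_le _ _).trans (add_le_add le_rfl ?_)
    rw [norm_smul, Real.norm_of_nonneg hx0]
    exact mul_le_of_le_one_left (norm_nonneg _) hx1
  have h3 : ‖r * (1 + x • A)‖ ≤ (K * x ^ 2) * (‖(1 : Matrix (Fin d) (Fin d) ℝ)‖ + ‖A‖) :=
    (norm_mul_le _ _).trans (by gcongr)
  have h4 : ‖x ^ 2 • (A * A)‖ ≤ x ^ 2 * (‖A‖ * ‖A‖) := by
    rw [norm_smul, Real.norm_of_nonneg (by positivity)]
    gcongr
    exact norm_mul_le _ _
  calc _ ≤ _ := add_le_add h3 h4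
    _ = _ := by ring

/-- Growth rates of the flow on the three spectral subspaces. -/
structure HasRates (A : Matrix (Fin d) (Fin d) ℝ) (a b c C : ℝ) : Prop where
  a_pos : 0 < a
  a_lt : a < 1 / 2
  b_gt : 1 / 2 < b
  b_lt : b < 1
  c_gt : 1 / 2 < c
  C_pos : 0 < C
  stable : ∀ n k : ℕ, 1 ≤ k → k ≤ n →
    ‖flow A (Real.log n - Real.log k) * projS A‖ ≤ C * ((n : ℝ) ^ a * (k : ℝ) ^ (-a))
  critical : ∀ k : ℕ, 1 ≤ k → ‖flow A (-Real.log k) * projC A‖ ≤ C * (k : ℝ) ^ (-(1 / 4) : ℝ)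
  unstable : ∀ n k : ℕ, 1 ≤ n → n ≤ k →
    ‖flow A (Real.log n - Real.log k) * projU A‖ ≤ C * ((n : ℝ) ^ c * (k : ℝ) ^ (-c))
  total : ∀ n k : ℕ, 1 ≤ k → k ≤ n →
    ‖flow A (Real.log n - Real.log k)‖ ≤ C * ((n : ℝ) ^ b * (k : ℝ) ^ (-b))
  defect : ∀ k : ℕ, 1 ≤ k → ‖defect A k‖ ≤ C * (1 / (k : ℝ)) ^ 2

theorem exp_mul_log_sub_log {n k : ℕ} (hn : 1 ≤ n) (hk : 1 ≤ k) (a : ℝ) :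
    Real.exp (a * (Real.log n - Real.log k)) = (n : ℝ) ^ a * (k : ℝ) ^ (-a) := by
  have hn0 : (0 : ℝ) < n := by exact_mod_cast hn
  have hk0 : (0 : ℝ) < k := by exact_mod_cast hk
  rw [Real.rpow_def_of_pos hn0, Real.rpow_def_of_pos hk0, ← Real.exp_add]
  congr 1; ring

/-- Each rate sits strictly between the real parts of the relevant eigenvalues and the threshold 1/2
or 1, with log n - log k as the time. -/
theorem exists_hasRates (A : Matrix (Fin d) (Fin d) ℝ)
    (hA : ∀ z ∈ spectrum ℂ (toC A), 0 < z.re ∧ z.re < 1) : ∃ a b c C, HasRates A a b c C := by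
  have hfin : (Complex.re '' spectrum ℂ (toC A)).Finite := by
    refine Set.Finite.image _ ?_
    rw [← Matrix.spectrum_toLin']
    exact Module.End.finite_spectrum _
  obtain ⟨a, ha0, ha1, ha⟩ := exists_between_of_finite hfin (show (0 : ℝ) < 1 / 2 by norm_num)
  obtain ⟨b, hb0, hb1, hb⟩ := exists_between_of_finite hfin (show (1 / 2 : ℝ) < 1 by norm_num)
  obtain ⟨c, hc0, -, hc⟩ := exists_between_of_finite' hfin (show (1 / 2 : ℝ) < 1 by norm_num)
  obtain ⟨C1, hC1, h1⟩ := exists_norm_exp_mul_specProj_le A (T := Set.Iio (1 / 2)) (σ := 1) (a := a)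
    (fun z hz hzT => by rw [one_mul]; exact ha _ ⟨z, hz, rfl⟩ hzT)
  -- The true decay on E_c is k^{-1/2} up to logarithms. The exponent 1/4 hides the logarithms and
  -- still makes the critical defects, of size k^{-1-1/4}, summable.
  obtain ⟨C2, hC2, h2⟩ := exists_norm_exp_mul_specProj_le A (T := {1 / 2}) (σ := -1)
    (a := -(1 / 4)) (fun z hz hzT => by
      rw [Set.mem_singleton_iff] at hzT
      rw [hzT]; norm_num)
  obtain ⟨C3, hC3, h3⟩ := exists_norm_exp_mul_specProj_le A (T := Set.Ioi (1 / 2)) (σ := -1)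
    (a := -c) (fun z hz hzT => by
      have := hc _ ⟨z, hz, rfl⟩ hzT
      linarith)
  -- With all of ℝ as the set of real parts the projection is the identity. The bound b < 1 comes
  -- from Re z < 1.
  obtain ⟨C4, hC4, h4⟩ := exists_norm_exp_mul_specProj_le A (T := Set.univ) (σ := 1) (a := b)
    (fun z hz _ => by rw [one_mul]; exact hb _ ⟨z, hz, rfl⟩ (hA z hz).2)
  obtain ⟨C5, hC5, h5⟩ := exists_norm_defect_le A
  set C := C1 + C2 + C3 + C4 + C5
  have hlog : ∀ {n k : ℕ}, 1 ≤ k → k ≤ n → 0 ≤ Real.log n - Real.log k := by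
    intro n k hk hkn
    have hk0 : (0 : ℝ) < k := by exact_mod_cast hk
    have := Real.log_le_log hk0 (by exact_mod_cast hkn : (k : ℝ) ≤ n)
    linarith
  refine ⟨a, b, c, C, ha0, ha1, hb0, hb1, hc0, by positivity, ?_, ?_, ?_, ?_, ?_⟩
  · intro n k hk hkn
    have := h1 _ (hlog hk hkn)
    rw [mul_one, exp_mul_log_sub_log (hk.trans hkn) hk] at this
    refine this.trans ?_
    gcongr
    simp only [C]; linarith
  · intro k hk
    have := h2 _ (hlog le_rfl hk)
    rw [exp_mul_log_sub_log hk le_rfl] at this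
    rw [Nat.cast_one, Real.log_one, sub_zero, mul_neg_one, Real.one_rpow, mul_one] at this
    refine this.trans ?_
    gcongr
    simp only [C]; linarith
  · intro n k hn hnk
    have := h3 _ (hlog hn hnk)
    rw [mul_neg_one, neg_sub, exp_mul_log_sub_log (hn.trans hnk) hn, neg_neg, mul_comm (_ ^ _)] at this
    refine this.trans ?_
    gcongr
    simp only [C]; linarith
  · intro n k hk hkn
    have := h4 _ (hlog hk hkn)
    rw [mul_one, exp_mul_log_sub_log (hk.trans hkn) hk, specProj_univ, mul_one] at this
    refine this.trans ?_
    gcongr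
    simp only [C]; linarith
  · intro k hk
    refine (h5 k hk).trans ?_
    gcongr
    simp only [C]; linarith

/-! ### Lyapunov equations -/

/-- The Lyapunov operator acts on the finite-dimensional space of matrices with P Ξ Pᵀ = Ξ; being
injective there, it is bijective. -/
theorem exists_lyapunov_of_injective {P B : Matrix (Fin d) (Fin d) ℝ} (hP : P * P = P)
    (hPB : P * B = B) (hBP : B * P = B) (Sig : Matrix (Fin d) (Fin d) ℝ)
    (hinj : ∀ Xi, P * Xi * Pᵀ = Xi → B * Xi + Xi * Bᵀ = 0 → Xi = 0) :
    ∃ Xi0, ∀ Xi, IsLyapunovSolution P B Sig Xi ↔ Xi = Xi0 := by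
  let V : Submodule ℝ (Matrix (Fin d) (Fin d) ℝ) :=
    { carrier := {Xi | P * Xi * Pᵀ = Xi}
      add_mem' := by
        intro x y hx hy
        simp only [Set.mem_ofPred_eq] at *
        rw [mul_add, add_mul, hx, hy]
      zero_mem' := by simp
      smul_mem' := by
        intro c x hx
        simp only [Set.mem_ofPred_eq] at *
        rw [mul_smul_comm, smul_mul_assoc, hx] }
  have hPt : Bᵀ * Pᵀ = Bᵀ := by rw [← Matrix.transpose_mul, hPB]
  have hPt' : Pᵀ * Bᵀ = Bᵀ := by rw [← Matrix.transpose_mul, hBP]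
  have hPP : Pᵀ * Pᵀ = Pᵀ := by rw [← Matrix.transpose_mul, hP]
  let L0 : Matrix (Fin d) (Fin d) ℝ →ₗ[ℝ] Matrix (Fin d) (Fin d) ℝ :=
    LinearMap.mulLeft ℝ B + LinearMap.mulRight ℝ Bᵀ
  have hL0 : ∀ X, L0 X = B * X + X * Bᵀ := fun X => rfl
  have hmaps : ∀ X ∈ V, L0 X ∈ V := by
    intro X hX
    have hX' : P * X * Pᵀ = X := hX
    have e1 : P * X = X := by rw [← hX', ← mul_assoc, ← mul_assoc, hP]
    have e2 : X * Pᵀ = X := by rw [← hX', mul_assoc, hPP]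
    change P * L0 X * Pᵀ = L0 X
    rw [hL0, mul_add, add_mul, ← mul_assoc, hPB, mul_assoc B, e2, ← mul_assoc P, e1, mul_assoc X,
      hPt]
  let L : V →ₗ[ℝ] V := L0.restrict hmaps
  have hLinj : Function.Injective L := by
    rw [injective_iff_map_eq_zero]
    rintro ⟨X, hX⟩ h
    have h' : L0 X = 0 := congrArg Subtype.val h
    exact Subtype.ext (hinj X hX h')
  have hLsurj := LinearMap.injective_iff_surjective.1 hLinj
  have hM : P * Sig * Pᵀ ∈ V := by
    change P * (P * Sig * Pᵀ) * Pᵀ = P * Sig * Pᵀ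
    rw [← mul_assoc, ← mul_assoc, hP, mul_assoc, hPP]
  obtain ⟨X0, hX0⟩ := hLsurj ⟨_, hM⟩
  have hX0' : L0 X0 = P * Sig * Pᵀ := congrArg Subtype.val hX0
  refine ⟨X0, fun Xi => ⟨fun h => ?_, ?_⟩⟩
  · have : L ⟨Xi, h.1⟩ = L X0 := by
      rw [hX0]; exact Subtype.ext h.2
    exact congrArg Subtype.val (hLinj this)
  · rintro rfl
    exact ⟨X0.2, hX0'⟩

/-- The homogeneous equation reads A Ξ = Ξ (1 - Aᵀ), an intertwining relation, so it exponentiates.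
A nonzero solution would have to scale as e^t under the flow, which the growth rates will exclude.
-/
theorem conj_flow_of_homogeneous {A Xi : Matrix (Fin d) (Fin d) ℝ}
    (h : ((1 / 2 : ℝ) • 1 - A) * Xi + Xi * ((1 / 2 : ℝ) • 1 - A)ᵀ = 0) (t : ℝ) :
    flow A t * Xi * (flow A t)ᵀ = Real.exp t • Xi := by
  have h1 : A * Xi = Xi * (1 - Aᵀ) := by
    simp only [Matrix.transpose_sub, Matrix.transpose_smul, Matrix.transpose_one, sub_mul,
      mul_sub, smul_mul_assoc, mul_smul_comm, one_mul, mul_one] at h ⊢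
    have h2 : (1 / 2 : ℝ) • Xi + (1 / 2 : ℝ) • Xi = Xi := by rw [← add_smul]; norm_num
    have h3 : Xi - A * Xi - Xi * Aᵀ = 0 := by
      rw [← h]; nth_rewrite 1 [← h2]; abel
    rw [sub_eq_zero] at h3
    rw [← h3]; abel
  have h2 : flow A t * Xi = Xi * NormedSpace.exp (t • (1 - Aᵀ)) :=
    exp_mul_of_mul_eq (by rw [smul_mul_assoc, h1, mul_smul_comm])
  have h3 : NormedSpace.exp (t • ((1 : Matrix (Fin d) (Fin d) ℝ) - Aᵀ)) =
      Real.exp t • flow Aᵀ (-t) := by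
    have e1 : t • ((1 : Matrix (Fin d) (Fin d) ℝ) - Aᵀ) = t • 1 + (-t) • Aᵀ := by
      rw [smul_sub, neg_smul, sub_eq_add_neg]
    rw [e1, Matrix.exp_add_of_commute _ _ ((Commute.one_left _).smul_left _), smul_one_eq_diagonal,
      Matrix.exp_diagonal, flow]
    have e2 : NormedSpace.exp (fun _ : Fin d => t) = fun _ => Real.exp t := by
      funext i
      rw [Pi.coe_exp, Real.exp_eq_exp_ℝ]
    rw [e2, ← smul_one_eq_diagonal, smul_mul_assoc, one_mul]
  rw [h2, h3, flow_transpose, mul_assoc, smul_mul_assoc, ← flow_add, neg_add_cancel, flow_zero,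
    mul_smul_comm, mul_one]

/-- On tensors supported in the range of `P`, the restricted operator may be replaced by 1/2 - A on
the whole space, where the flow is available. -/
theorem half_sub_mul_proj {A P Xi : Matrix (Fin d) (Fin d) ℝ} (hP : P * P = P)
    (hXi : P * Xi * Pᵀ = Xi) :
    ((1 / 2 : ℝ) • P - A * P) * Xi + Xi * ((1 / 2 : ℝ) • P - A * P)ᵀ =
      ((1 / 2 : ℝ) • 1 - A) * Xi + Xi * ((1 / 2 : ℝ) • 1 - A)ᵀ := by
  have hPP : Pᵀ * Pᵀ = Pᵀ := by rw [← Matrix.transpose_mul, hP]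
  have e1 : P * Xi = Xi := by rw [← hXi, ← mul_assoc, ← mul_assoc, hP]
  have e2 : Xi * Pᵀ = Xi := by rw [← hXi, mul_assoc, hPP]
  simp only [Matrix.transpose_sub, Matrix.transpose_smul, Matrix.transpose_one, sub_mul,
    mul_sub, smul_mul_assoc, mul_smul_comm, one_mul, mul_one, Matrix.transpose_mul, mul_assoc, e1]
  rw [← mul_assoc Xi, e2]

variable {a b c C : ℝ} {A : Matrix (Fin d) (Fin d) ℝ}

theorem conj_proj {A P Xi : Matrix (Fin d) (Fin d) ℝ} (hXi : P * Xi * Pᵀ = Xi) (t : ℝ) :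
    flow A t * Xi * (flow A t)ᵀ = flow A t * P * Xi * (flow A t * P)ᵀ := by
  conv_lhs => rw [← hXi]
  simp only [Matrix.transpose_mul, mul_assoc]

theorem norm_conj_le (U X : Matrix (Fin d) (Fin d) ℝ) : ‖U * X * Uᵀ‖ ≤ ‖U‖ ^ 2 * ‖X‖ := by
  refine (norm_mul_le _ _).trans ?_
  rw [Matrix.frobenius_norm_transpose]
  calc ‖U * X‖ * ‖U‖ ≤ ‖U‖ * ‖X‖ * ‖U‖ := by gcongr; exact norm_mul_le _ _
    _ = _ := by ring

theorem projS_mul_self (A : Matrix (Fin d) (Fin d) ℝ) : projS A * projS A = projS A :=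
  specProj_mul_self _ _
theorem projC_mul_self (A : Matrix (Fin d) (Fin d) ℝ) : projC A * projC A = projC A :=
  specProj_mul_self _ _
theorem projU_mul_self (A : Matrix (Fin d) (Fin d) ℝ) : projU A * projU A = projU A :=
  specProj_mul_self _ _
theorem mul_projS (A : Matrix (Fin d) (Fin d) ℝ) : A * projS A = projS A * A := mul_specProj _ _
theorem mul_projC (A : Matrix (Fin d) (Fin d) ℝ) : A * projC A = projC A * A := mul_specProj _ _
theorem mul_projU (A : Matrix (Fin d) (Fin d) ℝ) : A * projU A = projU A * A := mul_specProj _ _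

theorem tendsto_natCast_rpow_neg {s : ℝ} (hs : s < 0) :
    Tendsto (fun n : ℕ => (n : ℝ) ^ s) atTop (𝓝 0) := by
  have := (tendsto_rpow_neg_atTop (y := -s) (by linarith)).comp tendsto_natCast_atTop_atTop
  simpa [Function.comp_def] using this

theorem eq_zero_of_norm_le_mul {E : Type*} [NormedAddCommGroup E] {x : E} {u : ℕ → ℝ}
    (hu : Tendsto u atTop (𝓝 0)) (h : ∀ᶠ n in atTop, ‖x‖ ≤ u n * ‖x‖) : x = 0 := by
  have h1 := ge_of_tendsto (hu.mul_const ‖x‖) h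
  rw [zero_mul] at h1
  exact norm_le_zero_iff.1 h1

/-- A homogeneous solution satisfies n Ξ = n^A Ξ (n^A)ᵀ, of norm at most C² n^{2a} ‖Ξ‖. Since 2a <
1, it is zero. -/
theorem exists_lyapunov_stable (hr : HasRates A a b c C) (Sig : Matrix (Fin d) (Fin d) ℝ) :
    ∃ Xi0, ∀ Xi, IsLyapunovSolution (projS A) ((1 / 2 : ℝ) • projS A - A * projS A) Sig Xi
      ↔ Xi = Xi0 := by
  have hP := projS_mul_self A
  have hAP := mul_projS A
  refine exists_lyapunov_of_injective hP ?_ ?_ Sig fun Xi hXi h => ?_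
  · rw [mul_sub, mul_smul_comm, hP, ← mul_assoc, ← hAP, mul_assoc, hP]
  · rw [sub_mul, smul_mul_assoc, hP, mul_assoc, hP]
  rw [half_sub_mul_proj hP hXi] at h
  refine eq_zero_of_norm_le_mul (u := fun n : ℕ => C ^ 2 * (n : ℝ) ^ (2 * a - 1)) ?_ ?_
  · have := (tendsto_natCast_rpow_neg (s := 2 * a - 1) (by linarith [hr.a_lt])).const_mul (C ^ 2)
    simpa using this
  · filter_upwards [eventually_ge_atTop 1] with n hn
    have hn0 : (0 : ℝ) < n := by exact_mod_cast hn
    have h1 := conj_flow_of_homogeneous h (Real.log n)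
    rw [Real.exp_log hn0, conj_proj hXi] at h1
    have h2 := norm_conj_le (flow A (Real.log n) * projS A) Xi
    rw [h1, norm_smul, Real.norm_of_nonneg hn0.le] at h2
    have h3 := hr.stable n 1 le_rfl hn
    rw [Nat.cast_one, Real.log_one, sub_zero, Real.one_rpow, mul_one] at h3
    have h4 : ‖flow A (Real.log n) * projS A‖ ^ 2 ≤ (C * (n : ℝ) ^ a) ^ 2 := by gcongr
    have h5 : (n : ℝ) * ‖Xi‖ ≤ (C * (n : ℝ) ^ a) ^ 2 * ‖Xi‖ := h2.trans (by gcongr)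
    have h6 : (n : ℝ) ^ (2 * a - 1) = ((n : ℝ) ^ a) ^ 2 / n := by
      rw [Real.rpow_sub hn0, Real.rpow_one, mul_comm, Real.rpow_mul hn0.le, Real.rpow_two]
    rw [h6]
    calc ‖Xi‖ = (n * ‖Xi‖) / n := by field_simp
      _ ≤ ((C * (n : ℝ) ^ a) ^ 2 * ‖Xi‖) / n := by gcongr
      _ = _ := by ring

/-- The stable argument in backward time: n⁻¹ Ξ = n^{-A} Ξ (n^{-A})ᵀ is of order n^{-2c} with 2c >
1. -/
theorem exists_lyapunov_unstable (hr : HasRates A a b c C) (Sig : Matrix (Fin d) (Fin d) ℝ) :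
    ∃ Xi0, ∀ Xi, IsLyapunovSolution (projU A) (A * projU A - (1 / 2 : ℝ) • projU A) Sig Xi
      ↔ Xi = Xi0 := by
  have hP := projU_mul_self A
  have hAP := mul_projU A
  refine exists_lyapunov_of_injective hP ?_ ?_ Sig fun Xi hXi h => ?_
  · rw [mul_sub, mul_smul_comm, hP, ← mul_assoc, ← hAP, mul_assoc, hP]
  · rw [sub_mul, smul_mul_assoc, hP, mul_assoc, hP]
  rw [← neg_sub ((1 / 2 : ℝ) • projU A), Matrix.transpose_neg, neg_mul, mul_neg, ← neg_add,
    neg_eq_zero, half_sub_mul_proj hP hXi] at h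
  refine eq_zero_of_norm_le_mul (u := fun n : ℕ => C ^ 2 * (n : ℝ) ^ (1 - 2 * c)) ?_ ?_
  · have := (tendsto_natCast_rpow_neg (s := 1 - 2 * c) (by linarith [hr.c_gt])).const_mul (C ^ 2)
    simpa using this
  · filter_upwards [eventually_ge_atTop 1] with n hn
    have hn0 : (0 : ℝ) < n := by exact_mod_cast hn
    have h1 := conj_flow_of_homogeneous h (-Real.log n)
    rw [Real.exp_neg, Real.exp_log hn0, conj_proj hXi] at h1
    have h2 := norm_conj_le (flow A (-Real.log n) * projU A) Xi
    rw [h1, norm_smul, Real.norm_of_nonneg (by positivity)] at h2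
    have h3 := hr.unstable 1 n le_rfl hn
    rw [Nat.cast_one, Real.log_one, zero_sub, Real.one_rpow, one_mul] at h3
    have h4 : ‖flow A (-Real.log n) * projU A‖ ^ 2 ≤ (C * (n : ℝ) ^ (-c)) ^ 2 := by gcongr
    have h5 : (n : ℝ)⁻¹ * ‖Xi‖ ≤ (C * (n : ℝ) ^ (-c)) ^ 2 * ‖Xi‖ := h2.trans (by gcongr)
    have h6 : (n : ℝ) ^ (1 - 2 * c) = ((n : ℝ) ^ (-c)) ^ 2 * n := by
      rw [← Real.rpow_two, ← Real.rpow_mul hn0.le, ← Real.rpow_add_one hn0.ne']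
      congr 1; ring
    rw [h6]
    calc ‖Xi‖ = ((n : ℝ)⁻¹ * ‖Xi‖) * n := by field_simp
      _ ≤ ((C * (n : ℝ) ^ (-c)) ^ 2 * ‖Xi‖) * n := by gcongr
      _ = _ := by ring

end Flow

/-! ### Covariance sums of the stable and unstable components. -/

section LyapunovSums

open scoped Matrix.Norms.Frobenius

variable {d : ℕ} {a b c C : ℝ} {A : Matrix (Fin d) (Fin d) ℝ}

/-- The error of one step of the discretized Lyapunov flow. -/
noncomputable def stepError (A Xi M : Matrix (Fin d) (Fin d) ℝ) (k : ℕ) :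
    Matrix (Fin d) (Fin d) ℝ :=
  ((k : ℝ) + 1) • (flow A (Real.log k - Real.log (k + 1)) * Xi *
    (flow A (Real.log k - Real.log (k + 1)))ᵀ) - (k : ℝ) • Xi - M

/-- The error stays in the range of the projection, so the spectral rates apply to its conjugates by
the flow. -/
theorem stepError_proj {A P Xi M : Matrix (Fin d) (Fin d) ℝ} (hAP : A * P = P * A)
    (hXi : P * Xi * Pᵀ = Xi) (hM : P * M * Pᵀ = M) (k : ℕ) :
    P * stepError A Xi M k * Pᵀ = stepError A Xi M k := by
  simp only [stepError, mul_sub, sub_mul, hM, mul_smul_comm, smul_mul_assoc, hXi]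
  congr 3
  set U := flow A (Real.log k - Real.log (k + 1))
  have hU : P * U = U * P := (flow_mul_comm hAP _).symm
  have hUt : Uᵀ * Pᵀ = Pᵀ * Uᵀ := by rw [← Matrix.transpose_mul, hU, Matrix.transpose_mul]
  rw [← mul_assoc, ← mul_assoc, hU, mul_assoc, hUt, ← mul_assoc, mul_assoc U, mul_assoc U, hXi]

/-- Expansion of (1 + x b) z (1 + x b') to second order, with separate remainders for the left and
the right exponential. -/
theorem add_mul_mul_sub_eq {R : Type*} [Ring R] [Algebra ℝ R] (z b b' r' w : R) (x : ℝ) :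
    w + (1 + x • b) * z * (r' + 1 + x • b') - z - x • (b * z + z * b') =
      w + (1 + x • b) * z * r' + x ^ 2 • (b * z * b') := by
  simp only [add_mul, mul_add, mul_one, one_mul, smul_mul_assoc, mul_smul_comm, smul_add,
    smul_smul, pow_two, mul_assoc]
  abel

/-- With B = 1/2 - A and y = log((k+1)/k), the error is k (e^{yB} Ξ e^{yBᵀ} - Ξ - M/k). The
first-order term of the expansion is (B Ξ + Ξ Bᵀ)/k = M/k by the Lyapunov equation; k times the
O(k⁻²) rest is O(1/k). -/
theorem exists_norm_stepError_le {Xi M : Matrix (Fin d) (Fin d) ℝ}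
    (h : ((1 / 2 : ℝ) • 1 - A) * Xi + Xi * ((1 / 2 : ℝ) • 1 - A)ᵀ = M) :
    ∃ K : ℝ, 0 ≤ K ∧ ∀ k : ℕ, 1 ≤ k → ‖stepError A Xi M k‖ ≤ K * (1 / (k : ℝ)) := by
  set B := (1 / 2 : ℝ) • (1 : Matrix (Fin d) (Fin d) ℝ) - A with hB
  obtain ⟨K, hK, h1⟩ := exists_norm_exp_log_sub_le B
  set I1 := ‖(1 : Matrix (Fin d) (Fin d) ℝ)‖
  refine ⟨K * ‖Xi‖ * (I1 + ‖B‖ + K) + (I1 + ‖B‖) * ‖Xi‖ * K + ‖B‖ * ‖Xi‖ * ‖B‖,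
    by positivity, fun k hk => ?_⟩
  have hk0 : (0 : ℝ) < k := by exact_mod_cast hk
  have h2 := h1 k hk
  have hx0 : 0 ≤ 1 / (k : ℝ) := by positivity
  have hx1 : 1 / (k : ℝ) ≤ 1 := by
    have : (1 : ℝ) ≤ k := by exact_mod_cast hk
    exact (div_le_one hk0).2 this
  set y := Real.log (k + 1) - Real.log k with hy
  -- The summand 1/2 of `B` yields √((k+1)/k) on each side, which accounts for the prefactors k+1
  -- and k in the definition of the step error.
  have hU : NormedSpace.exp (y • B) = Real.exp (y / 2) • flow A (-y) := by
    have e1 : y • B = (y / 2) • (1 : Matrix (Fin d) (Fin d) ℝ) + (-y) • A := by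
      rw [hB, smul_sub, smul_smul, neg_smul, sub_eq_add_neg]; congr 2; ring
    rw [e1, Matrix.exp_add_of_commute _ _ ((Commute.one_left _).smul_left _), smul_one_eq_diagonal,
      Matrix.exp_diagonal, flow]
    have e2 : NormedSpace.exp (fun _ : Fin d => y / 2) = fun _ => Real.exp (y / 2) := by
      funext i
      rw [Pi.coe_exp, Real.exp_eq_exp_ℝ]
    rw [e2, ← smul_one_eq_diagonal, smul_mul_assoc, one_mul]
  have hyy : Real.exp (y / 2) * Real.exp (y / 2) = (k + 1) / k := by
    rw [← Real.exp_add, add_halves, hy, Real.exp_sub, Real.exp_log (by positivity),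
      Real.exp_log hk0]
  set U := NormedSpace.exp (y • B) with hUdef
  have hE : stepError A Xi M k = (k : ℝ) • (U * Xi * Uᵀ - Xi - (1 / (k : ℝ)) • M) := by
    rw [hU, Matrix.transpose_smul, smul_mul_assoc, smul_mul_assoc, mul_smul_comm, smul_smul, hyy,
      smul_sub, smul_sub, smul_smul, smul_smul, mul_div_cancel₀ _ hk0.ne', mul_one_div_cancel hk0.ne',
      one_smul, stepError, hy, neg_sub]
  set x := 1 / (k : ℝ) with hx
  set r := U - 1 - x • B with hr
  have hUr : U = r + 1 + x • B := by rw [hr]; abel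
  have hrn : ‖r‖ ≤ K * x ^ 2 := h2
  have hrt : ‖rᵀ‖ ≤ K * x ^ 2 := by rw [Matrix.frobenius_norm_transpose]; exact h2
  have hUt : Uᵀ = rᵀ + 1 + x • Bᵀ := by
    rw [hUr, Matrix.transpose_add, Matrix.transpose_add, Matrix.transpose_one,
      Matrix.transpose_smul]
  have hx2 : x ^ 2 ≤ 1 := pow_le_one₀ hx0 hx1
  have hUn : ‖Uᵀ‖ ≤ I1 + ‖B‖ + K := by
    rw [hUt]
    refine (norm_add_le _ _).trans ?_
    have e1 : ‖rᵀ + 1‖ ≤ K + I1 :=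
      (norm_add_le _ _).trans (add_le_add (hrt.trans (mul_le_of_le_one_right hK hx2)) le_rfl)
    have e2 : ‖x • Bᵀ‖ ≤ ‖B‖ := by
      rw [norm_smul, Real.norm_of_nonneg hx0, Matrix.frobenius_norm_transpose]
      exact mul_le_of_le_one_left (norm_nonneg _) hx1
    linarith
  have h1B : ‖1 + x • B‖ ≤ I1 + ‖B‖ := by
    refine (norm_add_le _ _).trans (add_le_add le_rfl ?_)
    rw [norm_smul, Real.norm_of_nonneg hx0]
    exact mul_le_of_le_one_left (norm_nonneg _) hx1
  have key : U * Xi * Uᵀ - Xi - x • M =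
      r * Xi * Uᵀ + (1 + x • B) * Xi * rᵀ + x ^ 2 • (B * Xi * Bᵀ) := by
    have e1 : U * Xi * Uᵀ = r * Xi * Uᵀ + (1 + x • B) * Xi * Uᵀ := by
      have e0 : U = r + (1 + x • B) := hUr.trans (add_assoc _ _ _)
      calc U * Xi * Uᵀ = (r + (1 + x • B)) * Xi * Uᵀ := by rw [← e0]
        _ = _ := by rw [add_mul, add_mul]
    rw [e1, hUt, ← h]
    exact add_mul_mul_sub_eq _ _ _ _ _ _
  rw [hE, norm_smul, Real.norm_of_nonneg hk0.le, key]
  have n1 : ‖r * Xi * Uᵀ‖ ≤ (K * x ^ 2) * ‖Xi‖ * (I1 + ‖B‖ + K) := by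
    refine (norm_mul_le _ _).trans ?_
    gcongr
    exact (norm_mul_le _ _).trans (by gcongr)
  have n2 : ‖(1 + x • B) * Xi * rᵀ‖ ≤ (I1 + ‖B‖) * ‖Xi‖ * (K * x ^ 2) := by
    refine (norm_mul_le _ _).trans ?_
    gcongr
    exact (norm_mul_le _ _).trans (by gcongr)
  have n3 : ‖x ^ 2 • (B * Xi * Bᵀ)‖ ≤ x ^ 2 * (‖B‖ * ‖Xi‖ * ‖B‖) := by
    rw [norm_smul, Real.norm_of_nonneg (by positivity)]
    gcongr
    refine (norm_mul_le _ _).trans ?_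
    rw [Matrix.frobenius_norm_transpose]
    gcongr
    exact norm_mul_le _ _
  have hkx : (k : ℝ) * x ^ 2 = x := by rw [hx]; field_simp
  calc (k : ℝ) * _ ≤ (k : ℝ) * ((K * x ^ 2) * ‖Xi‖ * (I1 + ‖B‖ + K) +
        (I1 + ‖B‖) * ‖Xi‖ * (K * x ^ 2) + x ^ 2 * (‖B‖ * ‖Xi‖ * ‖B‖)) := by
        gcongr
        exact (norm_add₃_le).trans (add_le_add (add_le_add n1 n2) n3)
    _ = (K * ‖Xi‖ * (I1 + ‖B‖ + K) + (I1 + ‖B‖) * ‖Xi‖ * K + ‖B‖ * ‖Xi‖ * ‖B‖) * (k * x ^ 2) := by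
        ring
    _ = _ := by rw [hkx]

theorem flow_mul_conj (A X : Matrix (Fin d) (Fin d) ℝ) (s t : ℝ) :
    flow A s * (flow A t * X * (flow A t)ᵀ) * (flow A s)ᵀ =
      flow A (s + t) * X * (flow A (s + t))ᵀ := by
  rw [flow_add, Matrix.transpose_mul]; simp only [mul_assoc]

/-- The weighted conjugates telescope up to the step errors. -/
theorem sum_conj_flow (A Xi M : Matrix (Fin d) (Fin d) ℝ) (t : ℝ) {n N : ℕ} (hnN : n ≤ N) :
    ∑ k ∈ Finset.Ioc n N, flow A (t - Real.log k) * (M + stepError A Xi M k) *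
        (flow A (t - Real.log k))ᵀ =
      ((N : ℝ) + 1) • (flow A (t - Real.log (N + 1)) * Xi * (flow A (t - Real.log (N + 1)))ᵀ) -
      ((n : ℝ) + 1) • (flow A (t - Real.log (n + 1)) * Xi * (flow A (t - Real.log (n + 1)))ᵀ) := by
  induction N, hnN using Nat.le_induction with
  | base => simp
  | succ N hN ih =>
    rw [← Finset.insert_Ioc_right_eq_Ioc_add_one hN, Finset.sum_insert (by simp), ih]
    -- The k-th summand is f(k) - f(k-1) for f(k) = (k+1) (e^t/(k+1))^A Ξ ((e^t/(k+1))^A)ᵀ.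
    have e : flow A (t - Real.log ((N + 1 : ℕ) : ℝ)) * (M + stepError A Xi M (N + 1)) *
        (flow A (t - Real.log ((N + 1 : ℕ) : ℝ)))ᵀ =
        (((N + 1 : ℕ) : ℝ) + 1) • (flow A (t - Real.log (((N + 1 : ℕ) : ℝ) + 1)) * Xi *
          (flow A (t - Real.log (((N + 1 : ℕ) : ℝ) + 1)))ᵀ) -
        ((N + 1 : ℕ) : ℝ) • (flow A (t - Real.log ((N + 1 : ℕ) : ℝ)) * Xi *
          (flow A (t - Real.log ((N + 1 : ℕ) : ℝ)))ᵀ) := by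
      rw [stepError]
      have e1 : ∀ Y Z : Matrix (Fin d) (Fin d) ℝ, M + (Y - Z - M) = Y - Z := by
        intro Y Z; abel
      rw [e1]
      simp only [mul_sub, sub_mul, mul_smul_comm, smul_mul_assoc]
      rw [flow_mul_conj]
      congr 5 <;> ring_nf
    rw [e]
    push_cast
    abel

theorem proj_conj_proj {P : Matrix (Fin d) (Fin d) ℝ} (hP : P * P = P)
    (Sig : Matrix (Fin d) (Fin d) ℝ) :
    P * (P * Sig * Pᵀ) * Pᵀ = P * Sig * Pᵀ := by
  have hPP : Pᵀ * Pᵀ = Pᵀ := by rw [← Matrix.transpose_mul, hP]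
  rw [← mul_assoc, ← mul_assoc, hP, mul_assoc, hPP]

/-- The boundary term at `n` of the telescoped sum: the one that produces the limit covariance. -/
theorem tendsto_scaled_conj (A Xi : Matrix (Fin d) (Fin d) ℝ) :
    Tendsto (fun n : ℕ => (n : ℝ)⁻¹ • (((n : ℝ) + 1) • (flow A (Real.log n - Real.log (n + 1)) * Xi *
      (flow A (Real.log n - Real.log (n + 1)))ᵀ))) atTop (𝓝 Xi) := by
  have h1 : Tendsto (fun n : ℕ => (n : ℝ)⁻¹ * ((n : ℝ) + 1)) atTop (𝓝 1) := by
    have := (tendsto_inv_atTop_zero.comp tendsto_natCast_atTop_atTop).const_add (1 : ℝ)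
    rw [add_zero] at this
    refine this.congr' ?_
    filter_upwards [eventually_ge_atTop 1] with n hn
    have hn0 : (0 : ℝ) < n := by exact_mod_cast hn
    simp only [Function.comp]
    field_simp
  have h2 : Tendsto (fun n : ℕ => Real.log n - Real.log (n + 1)) atTop (𝓝 0) := by
    refine squeeze_zero_norm' (a := fun n : ℕ => (n : ℝ)⁻¹) ?_
      (tendsto_inv_atTop_zero.comp tendsto_natCast_atTop_atTop)
    filter_upwards [eventually_ge_atTop 1] with n hn
    obtain ⟨h1, h2, -⟩ := log_succ_sub hn
    rw [Real.norm_eq_abs, abs_sub_comm, abs_of_nonneg h1, ← one_div]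
    exact h2
  have h3 : Tendsto (fun n : ℕ => flow A (Real.log n - Real.log (n + 1))) atTop (𝓝 1) := by
    have := ((continuous_flow A).tendsto 0).comp h2
    rwa [flow_zero] at this
  have h4 : Tendsto (fun n : ℕ => (flow A (Real.log n - Real.log (n + 1)))ᵀ) atTop (𝓝 1) := by
    have := ((continuous_id.matrix_transpose (X := Matrix (Fin d) (Fin d) ℝ)).tendsto 1).comp h3
    simpa using! this
  have h5 := h1.smul ((h3.mul_const Xi).mul h4)
  rw [one_mul, mul_one, one_smul] at h5
  refine h5.congr fun n => ?_
  rw [smul_smul]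

theorem summable_natCast_rpow {s : ℝ} (hs : 1 < s) : Summable fun k : ℕ => (k : ℝ) ^ (-s) := by
  simpa [Real.rpow_neg] using Real.summable_nat_rpow_inv.2 hs

theorem sum_rpow_le_tsum {s : ℝ} (hs : 1 < s) (t : Finset ℕ) :
    ∑ k ∈ t, (k : ℝ) ^ (-s) ≤ ∑' k : ℕ, (k : ℝ) ^ (-s) :=
  (summable_natCast_rpow hs).sum_le_tsum t fun k _ => by positivity

theorem rpow_sq {x : ℝ} (hx : 0 ≤ x) (a : ℝ) : (x ^ a) ^ 2 = x ^ (2 * a) := by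
  rw [← Real.rpow_two, ← Real.rpow_mul hx, mul_comm]

/-- Telescoping from 0 to `n` at time log n leaves Ξ from the upper boundary. The lower boundary and
the accumulated step errors are O(n^{2a-1}). -/
theorem tendsto_stable_sum (hr : HasRates A a b c C) {Sig Xi : Matrix (Fin d) (Fin d) ℝ}
    (h : IsLyapunovSolution (projS A) ((1 / 2 : ℝ) • projS A - A * projS A) Sig Xi) :
    Tendsto (fun n : ℕ => ∑ k ∈ Finset.Ioc 0 n,
      (n : ℝ)⁻¹ • ((flow A (Real.log n - Real.log k) * projS A) * Sig *
        (flow A (Real.log n - Real.log k) * projS A)ᵀ)) atTop (𝓝 Xi) := by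
  set P := projS A with hPdef
  have hP : P * P = P := projS_mul_self A
  have hAP : A * P = P * A := mul_projS A
  have hM := proj_conj_proj hP Sig
  obtain ⟨hXi, hL⟩ := h
  rw [half_sub_mul_proj hP hXi] at hL
  set M := P * Sig * Pᵀ with hMdef
  obtain ⟨K, hK, hE⟩ := exists_norm_stepError_le hL
  have hEP := stepError_proj hAP hXi hM
  have hid : ∀ n : ℕ, ∑ k ∈ Finset.Ioc 0 n,
      (n : ℝ)⁻¹ • ((flow A (Real.log n - Real.log k) * P) * Sig *
        (flow A (Real.log n - Real.log k) * P)ᵀ) =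
      (n : ℝ)⁻¹ • (((n : ℝ) + 1) • (flow A (Real.log n - Real.log (n + 1)) * Xi *
        (flow A (Real.log n - Real.log (n + 1)))ᵀ)) -
      ((n : ℝ)⁻¹ • (flow A (Real.log n) * Xi * (flow A (Real.log n))ᵀ) +
      ∑ k ∈ Finset.Ioc 0 n, (n : ℝ)⁻¹ • (flow A (Real.log n - Real.log k) * stepError A Xi M k *
        (flow A (Real.log n - Real.log k))ᵀ)) := by
    intro n
    have h1 := congrArg (fun X => (n : ℝ)⁻¹ • X) (sum_conj_flow A Xi M (Real.log n) (Nat.zero_le n))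
    simp only [mul_add, add_mul, Finset.sum_add_distrib, smul_add, smul_sub, Nat.cast_zero, zero_add,
      Real.log_one, sub_zero, one_smul] at h1
    rw [← Finset.smul_sum, ← Finset.smul_sum, sub_add_eq_sub_sub, ← h1, add_sub_cancel_right]
    congr 1
    refine Finset.sum_congr rfl fun k _ => ?_
    rw [hMdef, Matrix.transpose_mul]
    simp only [mul_assoc]
  simp only [hid]
  have hlim := tendsto_scaled_conj A Xi
  suffices hz : Tendsto (fun n : ℕ => (n : ℝ)⁻¹ • (flow A (Real.log n) * Xi * (flow A (Real.log n))ᵀ) +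
      ∑ k ∈ Finset.Ioc 0 n, (n : ℝ)⁻¹ • (flow A (Real.log n - Real.log k) * stepError A Xi M k *
        (flow A (Real.log n - Real.log k))ᵀ)) atTop (𝓝 0) by
    simpa using hlim.sub hz
  have ha := hr.a_pos
  -- The exponent combines k^{-2a} from the squared rate with 1/k from the step error.
  set T := ∑' k : ℕ, (k : ℝ) ^ (-(1 + 2 * a))
  have ht : Tendsto (fun n : ℕ => (C ^ 2 * ‖Xi‖ + C ^ 2 * K * T) * (n : ℝ) ^ (2 * a - 1)) atTop
      (𝓝 0) := by
    have := (tendsto_natCast_rpow_neg (s := 2 * a - 1) (by linarith [hr.a_lt])).const_mul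
      (C ^ 2 * ‖Xi‖ + C ^ 2 * K * T)
    simpa using this
  refine squeeze_zero_norm' ?_ ht
  filter_upwards [eventually_ge_atTop 1] with n hn
  have hn0 : (0 : ℝ) < n := by exact_mod_cast hn
  have hn1 : (n : ℝ) ^ (2 * a - 1) = (n : ℝ)⁻¹ * (n : ℝ) ^ (2 * a) := by
    rw [Real.rpow_sub_one hn0.ne']; ring
  have b1 : ‖(n : ℝ)⁻¹ • (flow A (Real.log n) * Xi * (flow A (Real.log n))ᵀ)‖ ≤
      C ^ 2 * ‖Xi‖ * (n : ℝ) ^ (2 * a - 1) := by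
    rw [norm_smul, Real.norm_of_nonneg (by positivity), conj_proj hXi, hn1]
    have h3 := hr.stable n 1 le_rfl hn
    rw [Nat.cast_one, Real.log_one, sub_zero, Real.one_rpow, mul_one] at h3
    calc _ ≤ (n : ℝ)⁻¹ * (‖flow A (Real.log n) * P‖ ^ 2 * ‖Xi‖) := by
          gcongr; exact norm_conj_le _ _
      _ ≤ (n : ℝ)⁻¹ * ((C * (n : ℝ) ^ a) ^ 2 * ‖Xi‖) := by gcongr
      _ = _ := by rw [mul_pow, rpow_sq hn0.le]; ring
  have b2 : ‖∑ k ∈ Finset.Ioc 0 n, (n : ℝ)⁻¹ • (flow A (Real.log n - Real.log k) *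
      stepError A Xi M k * (flow A (Real.log n - Real.log k))ᵀ)‖ ≤
      C ^ 2 * K * T * (n : ℝ) ^ (2 * a - 1) := by
    refine (norm_sum_le _ _).trans ?_
    calc _ ≤ ∑ k ∈ Finset.Ioc 0 n, (C ^ 2 * K * (n : ℝ) ^ (2 * a - 1)) *
          (k : ℝ) ^ (-(1 + 2 * a)) := by
          refine Finset.sum_le_sum fun k hk => ?_
          rw [Finset.mem_Ioc] at hk
          have hk0 : (0 : ℝ) < k := by exact_mod_cast hk.1
          rw [norm_smul, Real.norm_of_nonneg (by positivity), conj_proj (hEP k), hn1]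
          calc _ ≤ (n : ℝ)⁻¹ * (‖flow A (Real.log n - Real.log k) * P‖ ^ 2 * ‖stepError A Xi M k‖) := by
                gcongr; exact norm_conj_le _ _
            _ ≤ (n : ℝ)⁻¹ * ((C * ((n : ℝ) ^ a * (k : ℝ) ^ (-a))) ^ 2 * (K * (1 / (k : ℝ)))) := by
                gcongr
                · exact hr.stable n k hk.1 hk.2
                · exact hE k hk.1
            _ = _ := by
                rw [mul_pow, mul_pow, rpow_sq hn0.le, rpow_sq hk0.le, neg_add, Real.rpow_add hk0,
                  Real.rpow_neg_one, mul_neg]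
                ring
      _ = (C ^ 2 * K * (n : ℝ) ^ (2 * a - 1)) * ∑ k ∈ Finset.Ioc 0 n, (k : ℝ) ^ (-(1 + 2 * a)) := by
          rw [Finset.mul_sum]
      _ ≤ (C ^ 2 * K * (n : ℝ) ^ (2 * a - 1)) * T := by
          gcongr
          exact sum_rpow_le_tsum (by linarith) _
      _ = _ := by ring
  calc _ ≤ _ := (norm_add_le _ _).trans (add_le_add b1 b2)
    _ = _ := by ring

/-- As n/k ≤ 1, its powers decrease in the exponent; a decay rate may thus be weakened at will. -/
theorem rpow_mul_rpow_neg_le {n k : ℕ} (hn : 1 ≤ n) (hnk : n ≤ k) {s t : ℝ} (hst : s ≤ t) :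
    (n : ℝ) ^ t * (k : ℝ) ^ (-t) ≤ (n : ℝ) ^ s * (k : ℝ) ^ (-s) := by
  have hn0 : (0 : ℝ) < n := by exact_mod_cast hn
  have hnk' : (n : ℝ) ≤ k := by exact_mod_cast hnk
  rw [Real.rpow_neg (by positivity), Real.rpow_neg (by positivity), ← div_eq_mul_inv,
    ← div_eq_mul_inv, ← Real.div_rpow hn0.le (by positivity), ← Real.div_rpow hn0.le (by positivity)]
  exact Real.rpow_le_rpow_of_exponent_ge (div_pos hn0 (by linarith))
    ((div_le_one (by linarith)).2 hnk') hst

/-- Here the lower boundary, at `n`, gives the limit. The upper boundary, at n², is O(n^{1-2c}): a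
horizon well beyond `n` is needed for it to vanish. -/
theorem tendsto_unstable_sum (hr : HasRates A a b c C) {Sig Xi : Matrix (Fin d) (Fin d) ℝ}
    (h : IsLyapunovSolution (projU A) (A * projU A - (1 / 2 : ℝ) • projU A) Sig Xi) :
    Tendsto (fun n : ℕ => ∑ k ∈ Finset.Ioc n (n ^ 2),
      (n : ℝ)⁻¹ • ((flow A (Real.log n - Real.log k) * projU A) * Sig *
        (flow A (Real.log n - Real.log k) * projU A)ᵀ)) atTop (𝓝 Xi) := by
  set P := projU A with hPdef
  have hP : P * P = P := projU_mul_self A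
  have hAP : A * P = P * A := mul_projU A
  have hM := proj_conj_proj hP Sig
  obtain ⟨hXi', hL⟩ := h
  -- The matrix -Ξ solves the equation with 1/2 - A, so the same telescoping applies; the sign is
  -- recovered from the subtracted lower boundary.
  set Y := -Xi with hY
  have hXi : P * Y * Pᵀ = Y := by rw [hY, mul_neg, neg_mul, hXi']
  have hL : ((1 / 2 : ℝ) • P - A * P) * Y + Y * ((1 / 2 : ℝ) • P - A * P)ᵀ = P * Sig * Pᵀ := by
    rw [← hL, hY, ← neg_sub (A * P), Matrix.transpose_neg]
    simp only [neg_mul_neg]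
  rw [half_sub_mul_proj hP hXi] at hL
  set M := P * Sig * Pᵀ with hMdef
  obtain ⟨K, hK, hE⟩ := exists_norm_stepError_le hL
  have hEP := stepError_proj hAP hXi hM
  have hid : ∀ n : ℕ, 1 ≤ n → ∑ k ∈ Finset.Ioc n (n ^ 2),
      (n : ℝ)⁻¹ • ((flow A (Real.log n - Real.log k) * P) * Sig *
        (flow A (Real.log n - Real.log k) * P)ᵀ) =
      (n : ℝ)⁻¹ • ((((n ^ 2 : ℕ) : ℝ) + 1) • (flow A (Real.log n - Real.log (((n ^ 2 : ℕ) : ℝ) + 1)) *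
        Y * (flow A (Real.log n - Real.log (((n ^ 2 : ℕ) : ℝ) + 1)))ᵀ)) -
      ∑ k ∈ Finset.Ioc n (n ^ 2), (n : ℝ)⁻¹ • (flow A (Real.log n - Real.log k) * stepError A Y M k *
        (flow A (Real.log n - Real.log k))ᵀ) -
      (n : ℝ)⁻¹ • (((n : ℝ) + 1) • (flow A (Real.log n - Real.log (n + 1)) * Y *
        (flow A (Real.log n - Real.log (n + 1)))ᵀ)) := by
    intro n hn
    have h1 := congrArg (fun X => (n : ℝ)⁻¹ • X) (sum_conj_flow A Y M (Real.log n)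
      (show n ≤ n ^ 2 by nlinarith))
    simp only [mul_add, add_mul, Finset.sum_add_distrib, smul_add, smul_sub] at h1
    rw [← Finset.smul_sum, ← Finset.smul_sum, sub_right_comm, ← h1, add_sub_cancel_right]
    congr 1
    refine Finset.sum_congr rfl fun k _ => ?_
    rw [hMdef, Matrix.transpose_mul]
    simp only [mul_assoc]
  have hlim := (tendsto_scaled_conj A Y).neg
  rw [hY, neg_neg, ← hY] at hlim
  suffices hz : Tendsto (fun n : ℕ => (n : ℝ)⁻¹ • ((((n ^ 2 : ℕ) : ℝ) + 1) •
      (flow A (Real.log n - Real.log (((n ^ 2 : ℕ) : ℝ) + 1)) *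
        Y * (flow A (Real.log n - Real.log (((n ^ 2 : ℕ) : ℝ) + 1)))ᵀ)) -
      ∑ k ∈ Finset.Ioc n (n ^ 2), (n : ℝ)⁻¹ • (flow A (Real.log n - Real.log k) * stepError A Y M k *
        (flow A (Real.log n - Real.log k))ᵀ)) atTop (𝓝 0) by
    have h9 := hz.add hlim
    rw [zero_add] at h9
    refine h9.congr' ?_
    filter_upwards [eventually_ge_atTop 1] with n hn
    rw [hid n hn, ← sub_eq_add_neg]
  have hc := hr.c_gt
  set T := ∑' k : ℕ, (k : ℝ) ^ (-(3 / 2) : ℝ)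
  have ht : Tendsto (fun n : ℕ => C ^ 2 * ‖Y‖ * (n : ℝ) ^ (1 - 2 * c) +
      C ^ 2 * K * T * (n : ℝ) ^ (-(1 / 2) : ℝ)) atTop (𝓝 0) := by
    have h1 := (tendsto_natCast_rpow_neg (s := 1 - 2 * c) (by linarith)).const_mul (C ^ 2 * ‖Y‖)
    have h2 := (tendsto_natCast_rpow_neg (s := -(1 / 2)) (by norm_num)).const_mul (C ^ 2 * K * T)
    simpa using h1.add h2
  refine squeeze_zero_norm' ?_ ht
  filter_upwards [eventually_ge_atTop 1] with n hn
  have hn0 : (0 : ℝ) < n := by exact_mod_cast hn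
  have b1 : ‖(n : ℝ)⁻¹ • ((((n ^ 2 : ℕ) : ℝ) + 1) •
      (flow A (Real.log n - Real.log (((n ^ 2 : ℕ) : ℝ) + 1)) *
        Y * (flow A (Real.log n - Real.log (((n ^ 2 : ℕ) : ℝ) + 1)))ᵀ))‖ ≤
      C ^ 2 * ‖Y‖ * (n : ℝ) ^ (1 - 2 * c) := by
    have h3 := hr.unstable n (n ^ 2 + 1) hn (by nlinarith)
    rw [conj_proj hXi]
    rw [Nat.cast_add_one] at h3
    set m : ℝ := ((n ^ 2 : ℕ) : ℝ) + 1 with hm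
    have hm0 : 0 < m := by positivity
    rw [norm_smul, Real.norm_of_nonneg (by positivity), norm_smul, Real.norm_of_nonneg hm0.le]
    have hmn : (n : ℝ) ^ 2 ≤ m := by rw [hm]; push_cast; linarith
    calc _ ≤ (n : ℝ)⁻¹ * (m * (‖flow A (Real.log n - Real.log m) * P‖ ^ 2 * ‖Y‖)) := by
          gcongr; exact norm_conj_le _ _
      _ ≤ (n : ℝ)⁻¹ * (m * ((C * ((n : ℝ) ^ c * m ^ (-c))) ^ 2 * ‖Y‖)) := by gcongr
      _ = C ^ 2 * ‖Y‖ * ((n : ℝ)⁻¹ * (n : ℝ) ^ (2 * c) * m ^ (1 - 2 * c)) := by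
          rw [mul_pow, mul_pow, rpow_sq hn0.le, rpow_sq hm0.le, sub_eq_add_neg, Real.rpow_add hm0,
            Real.rpow_one, mul_neg]
          ring
      -- The endpoint m = n² + 1 exceeds n² and the exponent 1 - 2c is negative.
      _ ≤ C ^ 2 * ‖Y‖ * ((n : ℝ)⁻¹ * (n : ℝ) ^ (2 * c) * ((n : ℝ) ^ 2) ^ (1 - 2 * c)) := by
          gcongr C ^ 2 * ‖Y‖ * (_ * ?_)
          exact Real.rpow_le_rpow_of_nonpos (by positivity) hmn (by linarith)
      _ = _ := by
          congr 1
          rw [← Real.rpow_two, ← Real.rpow_mul hn0.le, ← Real.rpow_neg_one, ← Real.rpow_add hn0,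
            ← Real.rpow_add hn0]
          congr 1; ring
  have b2 : ‖∑ k ∈ Finset.Ioc n (n ^ 2), (n : ℝ)⁻¹ • (flow A (Real.log n - Real.log k) *
      stepError A Y M k * (flow A (Real.log n - Real.log k))ᵀ)‖ ≤
      C ^ 2 * K * T * (n : ℝ) ^ (-(1 / 2) : ℝ) := by
    refine (norm_sum_le _ _).trans ?_
    calc _ ≤ ∑ k ∈ Finset.Ioc n (n ^ 2), (C ^ 2 * K * (n : ℝ) ^ (-(1 / 2) : ℝ)) *
          (k : ℝ) ^ (-(3 / 2) : ℝ) := by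
          refine Finset.sum_le_sum fun k hk => ?_
          rw [Finset.mem_Ioc] at hk
          have hk0 : (0 : ℝ) < k := by exact_mod_cast (by omega : 0 < k)
          rw [norm_smul, Real.norm_of_nonneg (by positivity), conj_proj (hEP k)]
          -- Lowering the rate `c` to 1/4 makes the summand n^{-1/2} k^{-3/2}, with exponents
          -- independent of `c`.
          have hu := (hr.unstable n k hn hk.1.le).trans
            (mul_le_mul_of_nonneg_left (rpow_mul_rpow_neg_le hn hk.1.le
              (show (1 / 4 : ℝ) ≤ c by linarith)) hr.C_pos.le)
          calc _ ≤ (n : ℝ)⁻¹ * (‖flow A (Real.log n - Real.log k) * P‖ ^ 2 * ‖stepError A Y M k‖) := by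
                gcongr; exact norm_conj_le _ _
            _ ≤ (n : ℝ)⁻¹ * ((C * ((n : ℝ) ^ (1 / 4 : ℝ) * (k : ℝ) ^ (-(1 / 4) : ℝ))) ^ 2 *
                (K * (1 / (k : ℝ)))) := by
                gcongr
                exact hE k (by omega)
            _ = C ^ 2 * K * ((n : ℝ) ^ (-1 : ℝ) * (n : ℝ) ^ (2 * (1 / 4) : ℝ)) *
                ((k : ℝ) ^ (2 * -(1 / 4) : ℝ) * (k : ℝ) ^ (-1 : ℝ)) := by
                rw [mul_pow, mul_pow, rpow_sq hn0.le, rpow_sq hk0.le, Real.rpow_neg_one,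
                  Real.rpow_neg_one]
                ring
            _ = _ := by
                rw [← Real.rpow_add hn0, ← Real.rpow_add hk0]
                norm_num
      _ = (C ^ 2 * K * (n : ℝ) ^ (-(1 / 2) : ℝ)) *
          ∑ k ∈ Finset.Ioc n (n ^ 2), (k : ℝ) ^ (-(3 / 2) : ℝ) := by
          rw [Finset.mul_sum]
      _ ≤ (C ^ 2 * K * (n : ℝ) ^ (-(1 / 2) : ℝ)) * T := by
          gcongr
          exact sum_rpow_le_tsum (by norm_num) _
      _ = _ := by ring
  exact (norm_sub_le _ _).trans (add_le_add b1 b2)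

end LyapunovSums

/-! ### Asymptotics of logarithmic and oscillating sums. -/

section LogSums

open Asymptotics

theorem tendsto_log_natCast : Tendsto (fun n : ℕ => Real.log n) atTop atTop :=
  Real.tendsto_log_atTop.comp tendsto_natCast_atTop_atTop

theorem log_succ_sub_isEquivalent :
    (fun k : ℕ => Real.log ((k + 1 : ℕ) : ℝ) - Real.log k) ~[atTop] fun k : ℕ => 1 / (k : ℝ) := by
  have h : (fun k : ℕ => (Real.log ((k + 1 : ℕ) : ℝ) - Real.log k) - 1 / (k : ℝ)) =O[atTop]
      fun k : ℕ => (1 / (k : ℝ)) ^ 2 := by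
    refine IsBigO.of_bound 1 ?_
    filter_upwards [eventually_ge_atTop 1] with k hk
    obtain ⟨h1, h2, h3⟩ := log_succ_sub hk
    push_cast
    rw [one_mul, Real.norm_eq_abs, abs_sub_comm, abs_of_nonneg (by linarith),
      Real.norm_of_nonneg (by positivity)]
    exact h3
  refine h.trans_isLittleO ?_
  have h0 : Tendsto (fun k : ℕ => 1 / (k : ℝ)) atTop (𝓝 0) := tendsto_one_div_atTop_nhds_zero_nat
  have := (isLittleO_one_iff ℝ).2 h0 |>.mul_isBigO (isBigO_refl (fun k : ℕ => 1 / (k : ℝ)) atTop)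
  simpa [pow_two] using this

theorem tendsto_log_increment :
    Tendsto (fun k : ℕ => Real.log ((k + 1 : ℕ) : ℝ) - Real.log k) atTop (𝓝 0) :=
  log_succ_sub_isEquivalent.symm.tendsto_nhds tendsto_one_div_atTop_nhds_zero_nat

/-- Discrete form of the derivative of (log x)^{q+1}: differentiate (1 + u)^{q+1} at 0, with u the
logarithmic increment divided by log k. -/
theorem log_pow_increment (q : ℕ) :
    (fun k : ℕ => Real.log ((k + 1 : ℕ) : ℝ) ^ (q + 1) - Real.log k ^ (q + 1) -
      (q + 1) * (Real.log k ^ q / k)) =o[atTop] fun k : ℕ => Real.log k ^ q / k := by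
  set y : ℕ → ℝ := fun k => Real.log ((k + 1 : ℕ) : ℝ) - Real.log k with hy
  have hu : Tendsto (fun k : ℕ => y k / Real.log k) atTop (𝓝 0) :=
    tendsto_log_increment.div_atTop tendsto_log_natCast
  have hd : HasDerivAt (fun u : ℝ => (1 + u) ^ (q + 1)) ((q : ℝ) + 1) 0 := by
    have := ((hasDerivAt_id (0 : ℝ)).const_add 1).fun_pow (q + 1)
    simpa using this
  have h1 := (hasDerivAt_iff_isLittleO_nhds_zero.1 hd).comp_tendsto hu
  have h2 : (fun k : ℕ => Real.log k ^ (q + 1) * ((1 + y k / Real.log k) ^ (q + 1) - 1 -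
      y k / Real.log k * (q + 1))) =o[atTop] fun k : ℕ => Real.log k ^ (q + 1) * (y k / Real.log k) := by
    refine (isBigO_refl (fun k : ℕ => Real.log k ^ (q + 1)) atTop).mul_isLittleO ?_
    simpa [Function.comp_def] using h1
  have hlog : ∀ᶠ k : ℕ in atTop, 0 < Real.log k := tendsto_log_natCast.eventually_gt_atTop 0
  have h3 : (fun k : ℕ => Real.log k ^ (q + 1) * (y k / Real.log k)) =O[atTop]
      fun k : ℕ => Real.log k ^ q / k := by
    have h4 := (isBigO_refl (fun k : ℕ => Real.log k ^ q) atTop).mul log_succ_sub_isEquivalent.isBigO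
    refine h4.congr' ?_ ?_
    · filter_upwards [hlog] with k hk
      simp only [hy]
      field_simp
      ring
    · exact Eventually.of_forall fun k => by ring
  have h5 : (fun k : ℕ => ((q : ℝ) + 1) * (Real.log k ^ q * (y k - 1 / k))) =o[atTop]
      fun k : ℕ => Real.log k ^ q / k := by
    have h6 := ((isBigO_refl (fun k : ℕ => Real.log k ^ q) atTop).mul_isLittleO
      log_succ_sub_isEquivalent.isLittleO).const_mul_left ((q : ℝ) + 1)
    refine h6.congr' (Eventually.of_forall fun k => rfl) (Eventually.of_forall fun k => ?_)
    ring
  refine ((h2.trans_isBigO h3).add h5).congr' ?_ EventuallyEq.rfl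
  filter_upwards [hlog] with k hk
  have e : Real.log ((k + 1 : ℕ) : ℝ) = Real.log k + y k := by simp only [hy]; ring
  have e2 : Real.log k ^ (q + 1) * (1 + y k / Real.log k) ^ (q + 1) =
      (Real.log k + y k) ^ (q + 1) := by
    rw [← mul_pow]; congr 1; field_simp
  have e3 : Real.log k ^ (q + 1) * (y k / Real.log k * (q + 1)) =
      (q + 1) * (Real.log k ^ q * y k) := by
    rw [pow_succ]; field_simp
  rw [mul_sub, mul_sub, e2, e3, e]
  ring

theorem tendsto_log_succ_div :
    Tendsto (fun n : ℕ => Real.log ((n + 1 : ℕ) : ℝ) / Real.log n) atTop (𝓝 1) := by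
  have h := (tendsto_log_increment.div_atTop tendsto_log_natCast).const_add 1
  rw [add_zero] at h
  refine h.congr' ?_
  filter_upwards [tendsto_log_natCast.eventually_gt_atTop 0] with n hn
  field_simp
  ring

/-- The sum may start at k = 0, since `Real.log 0 = 0` and the exponent is positive. -/
theorem sum_range_log_increment (q n : ℕ) :
    ∑ k ∈ Finset.range (n + 1), (Real.log ((k + 1 : ℕ) : ℝ) ^ (q + 1) - Real.log k ^ (q + 1)) =
      Real.log ((n + 1 : ℕ) : ℝ) ^ (q + 1) := by
  rw [Finset.sum_range_sub (fun k : ℕ => Real.log (k : ℝ) ^ (q + 1))]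
  simp

theorem log_increment_nonneg (q k : ℕ) :
    0 ≤ Real.log ((k + 1 : ℕ) : ℝ) ^ (q + 1) - Real.log k ^ (q + 1) := by
  rcases Nat.eq_zero_or_pos k with rfl | hk
  · simp
  · have h0 : (0 : ℝ) ≤ Real.log k := Real.log_natCast_nonneg k
    have h1 : Real.log k ≤ Real.log ((k + 1 : ℕ) : ℝ) :=
      Real.log_le_log (by exact_mod_cast hk) (by push_cast; linarith)
    have := pow_le_pow_left₀ h0 h1 (q + 1)
    linarith

theorem tendsto_sum_log_increment (q : ℕ) :
    Tendsto (fun n => ∑ k ∈ Finset.range n,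
      (Real.log ((k + 1 : ℕ) : ℝ) ^ (q + 1) - Real.log k ^ (q + 1))) atTop atTop := by
  rw [← tendsto_add_atTop_iff_nat 1]
  simp only [sum_range_log_increment]
  exact (tendsto_pow_atTop (by omega)).comp (tendsto_log_natCast.comp (tendsto_add_atTop_nat 1))

theorem log_pow_div_isBigO (q : ℕ) : (fun k : ℕ => Real.log k ^ q / k) =O[atTop]
    fun k : ℕ => Real.log ((k + 1 : ℕ) : ℝ) ^ (q + 1) - Real.log k ^ (q + 1) := by
  have h : (fun k : ℕ => Real.log ((k + 1 : ℕ) : ℝ) ^ (q + 1) - Real.log k ^ (q + 1)) ~[atTop]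
      fun k : ℕ => ((q : ℝ) + 1) * (Real.log k ^ q / k) := by
    refine (log_pow_increment q).trans_isBigO ?_
    exact (isBigO_self_const_mul (by positivity : (q : ℝ) + 1 ≠ 0) _ _)
  exact (isBigO_self_const_mul (by positivity : (q : ℝ) + 1 ≠ 0) _ _).trans h.symm.isBigO

/-- A sum of terms negligible against `log k ^ q / k` is negligible against `log n ^ (q + 1)`. -/
theorem sum_isLittleO_log_pow {E : Type*} [NormedAddCommGroup E] {f : ℕ → E} {q : ℕ}
    (hf : f =o[atTop] fun k : ℕ => Real.log k ^ q / k) :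
    (fun n => ∑ k ∈ Finset.range (n + 1), f k) =o[atTop] fun n : ℕ => Real.log n ^ (q + 1) := by
  -- A summed little-o bound needs a nonnegative comparison series that diverges; the increments of
  -- (log k)^{q+1} provide one with explicit partial sums.
  have h := ((hf.trans_isBigO (log_pow_div_isBigO q)).sum_range
    (fun k => log_increment_nonneg q k) (tendsto_sum_log_increment q)).comp_tendsto
    (tendsto_add_atTop_nat 1)
  simp only [Function.comp_def, sum_range_log_increment] at h
  refine h.trans_isBigO ?_
  have h2 := tendsto_log_succ_div.pow (q + 1)
  refine isBigO_of_div_tendsto_nhds ?_ (1 ^ (q + 1)) ?_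
  · filter_upwards [tendsto_log_natCast.eventually_gt_atTop 0] with n hn h0
    exact absurd h0 (pow_pos hn _).ne'
  · refine h2.congr fun n => ?_
    simp [div_pow]

/-- The increment of k^{-iθ} (log k)^q comes, to leading order, from the oscillating factor alone:
differencing the logarithm loses a power of log k. -/
theorem osc_increment (θ : ℝ) (q : ℕ) :
    (fun k : ℕ => Complex.exp (-(Complex.I * θ) * Real.log ((k + 1 : ℕ) : ℝ)) *
        (Real.log ((k + 1 : ℕ) : ℝ) : ℂ) ^ q -
      Complex.exp (-(Complex.I * θ) * Real.log k) * (Real.log k : ℂ) ^ q -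
      -(Complex.I * θ) * (Complex.exp (-(Complex.I * θ) * Real.log k) *
        ((Real.log k ^ q / k : ℝ) : ℂ))) =o[atTop] fun k : ℕ => Real.log k ^ q / k := by
  set w : ℂ := -(Complex.I * θ) with hw
  have hE : ∀ x : ℝ, ‖Complex.exp (w * x)‖ = 1 := by
    intro x
    rw [Complex.norm_exp]
    simp [hw]
  set y : ℕ → ℝ := fun k => Real.log ((k + 1 : ℕ) : ℝ) - Real.log k with hy
  have hlog : ∀ᶠ k : ℕ in atTop, 0 < Real.log k := tendsto_log_natCast.eventually_gt_atTop 0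
  have h1 : (fun k : ℕ => Real.log ((k + 1 : ℕ) : ℝ) ^ q - Real.log k ^ q) =o[atTop]
      fun k : ℕ => Real.log k ^ q / k := by
    rcases q with _ | q
    · simp
    have h2 := log_pow_increment q
    have h3 : (fun k : ℕ => Real.log k ^ q / k) =o[atTop] fun k : ℕ => Real.log k ^ (q + 1) / k := by
      have h4 : (fun _ : ℕ => (1 : ℝ)) =o[atTop] fun k : ℕ => Real.log k := by
        refine (isLittleO_const_left).2 (Or.inr ?_)
        exact tendsto_norm_atTop_atTop.comp tendsto_log_natCast
      have h5 := (isBigO_refl (fun k : ℕ => Real.log k ^ q / k) atTop).mul_isLittleO h4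
      refine h5.congr (fun k => by ring) (fun k => by ring)
    refine ((h2.trans h3).add (h3.const_mul_left ((q : ℝ) + 1))).congr_left fun k => ?_
    ring
  have h1' : (fun k : ℕ => Complex.exp (w * Real.log ((k + 1 : ℕ) : ℝ)) *
      ((Real.log ((k + 1 : ℕ) : ℝ) ^ q - Real.log k ^ q : ℝ) : ℂ)) =o[atTop]
      fun k : ℕ => Real.log k ^ q / k := by
    refine (IsBigO.of_bound 1 (Eventually.of_forall fun k => ?_)).trans_isLittleO h1
    rw [norm_mul, hE, Complex.norm_real]
  have hd : HasDerivAt (fun u : ℝ => Complex.exp (w * u)) w 0 := by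
    have := ((Complex.ofRealCLM.hasDerivAt (x := (0 : ℝ))).const_mul w).cexp
    simpa using this
  have h2 := (hasDerivAt_iff_isLittleO_nhds_zero.1 hd).comp_tendsto
    (show Tendsto y atTop (𝓝 0) from tendsto_log_increment)
  have h3 : (fun k : ℕ => Complex.exp (w * y k) - 1 - w * y k) =o[atTop] y := by
    refine h2.congr_left fun k => ?_
    simp [mul_comm]
  have h4 : (fun k : ℕ => w * ((y k - 1 / (k : ℝ) : ℝ) : ℂ)) =o[atTop] fun k : ℕ => 1 / (k : ℝ) := by
    refine IsLittleO.const_mul_left ?_ _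
    refine (IsBigO.of_bound 1 (Eventually.of_forall fun k => ?_)).trans_isLittleO
      log_succ_sub_isEquivalent.isLittleO
    rw [Complex.norm_real, one_mul]; rfl
  have h5 := (h3.trans_isBigO log_succ_sub_isEquivalent.isBigO).add h4
  have h6 : (fun k : ℕ => Complex.exp (w * Real.log k) * ((Real.log k ^ q : ℝ) : ℂ)) =O[atTop]
      fun k : ℕ => Real.log k ^ q := by
    refine IsBigO.of_bound 1 (Eventually.of_forall fun k => ?_)
    rw [norm_mul, hE, Complex.norm_real]
  have h7 := h6.mul_isLittleO h5
  have h8 : (fun k : ℕ => Real.log k ^ q * (1 / (k : ℝ))) = fun k : ℕ => Real.log k ^ q / k := by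
    funext k; ring
  rw [h8] at h7
  refine (h1'.add h7).congr_left fun k => ?_
  have e : Complex.exp (w * Real.log ((k + 1 : ℕ) : ℝ)) =
      Complex.exp (w * Real.log k) * Complex.exp (w * y k) := by
    rw [← Complex.exp_add]
    congr 1
    simp only [hy]; push_cast; ring
  rw [e]
  push_cast
  ring

/-- For θ = 0 the summand is the increment of (log k)^{q+1}/(q+1). For θ ≠ 0 it is, up to a factor
-iθ, the increment of k^{-iθ} (log k)^q, which has one power of the logarithm less and so vanishes
after normalization. -/
theorem tendsto_sum_log_pow (θ : ℝ) (q : ℕ) :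
    Tendsto (fun n : ℕ => (∑ k ∈ Finset.Ioc 0 n, Complex.exp (-(Complex.I * θ) * Real.log k) *
        ((Real.log k ^ q / k : ℝ) : ℂ)) / ((Real.log n ^ (q + 1) : ℝ) : ℂ)) atTop
      (𝓝 (if θ = 0 then 1 / ((q : ℂ) + 1) else 0)) := by
  -- The added term k = 0 is zero because division by zero gives zero.
  have hrange : ∀ n : ℕ, ∑ k ∈ Finset.Ioc 0 n, Complex.exp (-(Complex.I * θ) * Real.log k) *
        ((Real.log k ^ q / k : ℝ) : ℂ) = ∑ k ∈ Finset.range (n + 1),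
        Complex.exp (-(Complex.I * θ) * Real.log k) * ((Real.log k ^ q / k : ℝ) : ℂ) := by
    intro n
    rw [Finset.range_eq_Ico, Finset.sum_eq_sum_Ico_succ_bot (by omega)]
    simp only [Nat.cast_zero, div_zero, Complex.ofReal_zero, mul_zero, zero_add]
    rfl
  simp only [hrange]
  have hlog : ∀ᶠ k : ℕ in atTop, 0 < Real.log k := tendsto_log_natCast.eventually_gt_atTop 0
  have hsucc : Tendsto (fun n : ℕ => ((Real.log ((n + 1 : ℕ) : ℝ) ^ (q + 1) : ℝ) : ℂ) /
      ((Real.log n ^ (q + 1) : ℝ) : ℂ)) atTop (𝓝 1) := by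
    have h2 := tendsto_log_succ_div.pow (q + 1)
    rw [one_pow] at h2
    have h3 := (Complex.continuous_ofReal.tendsto 1).comp h2
    refine (Complex.ofReal_one ▸ h3).congr fun n => ?_
    simp [div_pow]
  have hdiv : ∀ {f : ℕ → ℂ}, (fun n => f n) =o[atTop] (fun n : ℕ => Real.log n ^ (q + 1)) →
      Tendsto (fun n => f n / ((Real.log n ^ (q + 1) : ℝ) : ℂ)) atTop (𝓝 0) := by
    intro f hf
    have : f =o[atTop] fun n : ℕ => ((Real.log n ^ (q + 1) : ℝ) : ℂ) := by
      refine hf.trans_isBigO (IsBigO.of_bound 1 (Eventually.of_forall fun n => ?_))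
      rw [one_mul, Complex.norm_real]
    exact this.tendsto_div_nhds_zero
  by_cases hθ : θ = 0
  · subst hθ
    have h := hdiv (f := fun n => ∑ k ∈ Finset.range (n + 1), ((Real.log ((k + 1 : ℕ) : ℝ) ^ (q + 1) -
      Real.log k ^ (q + 1) - (q + 1) * (Real.log k ^ q / k) : ℝ) : ℂ)) (by
        refine sum_isLittleO_log_pow ?_
        refine (IsBigO.of_bound 1 (Eventually.of_forall fun n => ?_)).trans_isLittleO
          (log_pow_increment q)
        rw [one_mul, Complex.norm_real])
    have h2 := (hsucc.sub h).div_const ((q : ℂ) + 1)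
    rw [sub_zero] at h2
    simp only [if_true]
    refine h2.congr fun n => ?_
    have hq : (q : ℂ) + 1 ≠ 0 := by exact_mod_cast (by omega : q + 1 ≠ 0)
    rw [← Complex.ofReal_sum, Finset.sum_sub_distrib, sum_range_log_increment, ← Finset.mul_sum]
    simp only [Complex.ofReal_zero, mul_zero, neg_zero, zero_mul, Complex.exp_zero, one_mul]
    rw [← Complex.ofReal_sum, ← sub_div]
    push_cast
    rw [div_div, mul_comm _ ((q : ℂ) + 1), sub_sub_cancel, mul_div_mul_left _ _ hq]
  · rw [if_neg hθ]
    set w : ℂ := -(Complex.I * θ) with hw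
    have hw0 : w ≠ 0 := by simp [hw, hθ]
    have hE : ∀ x : ℝ, ‖Complex.exp (w * x)‖ = 1 := by
      intro x
      rw [Complex.norm_exp]
      simp [hw]
    have h := hdiv (sum_isLittleO_log_pow (osc_increment θ q))
    have h1 : Tendsto (fun n : ℕ => (Complex.exp (w * Real.log ((n + 1 : ℕ) : ℝ)) *
        (Real.log ((n + 1 : ℕ) : ℝ) : ℂ) ^ q) / ((Real.log n ^ (q + 1) : ℝ) : ℂ)) atTop (𝓝 0) := by
      have h2 : Tendsto (fun n : ℕ => (Real.log ((n + 1 : ℕ) : ℝ) / Real.log n) ^ q *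
          (Real.log n)⁻¹) atTop (𝓝 0) := by
        have := (tendsto_log_succ_div.pow q).mul (tendsto_inv_atTop_zero.comp tendsto_log_natCast)
        simpa using this
      refine squeeze_zero_norm' ?_ h2
      filter_upwards [hlog] with n hn
      have hn' : 0 ≤ Real.log ((n + 1 : ℕ) : ℝ) := Real.log_natCast_nonneg _
      rw [norm_div, norm_mul, hE, one_mul, norm_pow, Complex.norm_real, Complex.norm_real,
        Real.norm_of_nonneg hn', Real.norm_of_nonneg (by positivity), div_pow, pow_succ,
        div_mul_eq_div_div, div_eq_mul_inv]
    have h0 : Tendsto (fun n : ℕ => (Complex.exp (w * Real.log ((0 : ℕ) : ℝ)) *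
        (Real.log ((0 : ℕ) : ℝ) : ℂ) ^ q) / ((Real.log n ^ (q + 1) : ℝ) : ℂ)) atTop (𝓝 0) := by
      refine squeeze_zero_norm' (a := fun n : ℕ => ‖(Real.log ((0 : ℕ) : ℝ) : ℂ) ^ q‖ *
        (Real.log n ^ (q + 1))⁻¹) ?_ ?_
      · filter_upwards [hlog] with n hn
        rw [norm_div, norm_mul, hE, one_mul, Complex.norm_real,
          Real.norm_of_nonneg (by positivity), div_eq_mul_inv]
      · have := (tendsto_inv_atTop_zero.comp ((tendsto_pow_atTop (α := ℝ)
          (by omega : q + 1 ≠ 0)).comp tendsto_log_natCast)).const_mul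
          ‖(Real.log ((0 : ℕ) : ℝ) : ℂ) ^ q‖
        simpa using this
    have h3 := ((h1.sub h0).sub h).div_const w
    rw [sub_zero, sub_zero, zero_div] at h3
    refine h3.congr fun n => ?_
    rw [Finset.sum_sub_distrib, Finset.sum_range_sub (fun k : ℕ => Complex.exp (w * Real.log (k : ℝ)) *
      (Real.log (k : ℝ) : ℂ) ^ q), ← Finset.mul_sum, ← sub_div, ← sub_div, sub_sub_cancel, div_div,
      mul_comm _ w, mul_div_mul_left _ _ hw0]

end LogSums

/-! ### Covariance sums of the critical component in a Jordan basis. -/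

section JordanFlow

open scoped Matrix.Norms.Frobenius

theorem shift_pow_apply {m : ℕ} (l : ℕ) (i j : Fin m) :
    (shift m ^ l) i j = if (j : ℕ) = i + l then 1 else 0 := by
  induction l generalizing j with
  | zero =>
    simp only [pow_zero, Matrix.one_apply, add_zero, Fin.ext_iff]
    exact if_congr eq_comm rfl rfl
  | succ l ih =>
    rw [pow_succ, Matrix.mul_apply]
    have hs : ∀ x, shift m x j = if (j : ℕ) = (x : ℕ) + 1 then 1 else 0 := fun _ => rfl
    simp only [ih, hs, mul_ite, mul_one, mul_zero]
    by_cases hj : (j : ℕ) = i + (l + 1)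
    · rw [if_pos hj, Finset.sum_eq_single (⟨i + l, by omega⟩ : Fin m)]
      · simp [hj]; omega
      · intro x _ hx
        have : (x : ℕ) ≠ i + l := fun h => hx (Fin.ext h)
        simp [this]
      · simp
    · rw [if_neg hj]
      refine Finset.sum_eq_zero fun x _ => ?_
      split_ifs <;> first | rfl | omega

theorem exp_smul_shift_apply {m : ℕ} (t : ℝ) (i j : Fin m) :
    (NormedSpace.exp (t • shift m)) i j =
      if (i : ℕ) ≤ j then (t : ℂ) ^ ((j : ℕ) - i) / (((j : ℕ) - i).factorial : ℂ) else 0 := by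
  have h := (NormedSpace.exp_series_hasSum_exp' (𝕂 := ℝ) (t • shift m)).map
    (Matrix.entryAddMonoidHom ℂ i j) (by
      change Continuous fun M : Matrix (Fin m) (Fin m) ℂ => M i j
      fun_prop)
  have h2 : ∀ l, (Matrix.entryAddMonoidHom ℂ i j ∘ fun n : ℕ => ((n.factorial : ℝ))⁻¹ •
      (t • shift m) ^ n) l = if (j : ℕ) = i + l then (t : ℂ) ^ l / (l.factorial : ℂ) else 0 := by
    intro l
    simp only [Function.comp, Matrix.entryAddMonoidHom_apply, smul_pow, Matrix.smul_apply,
      shift_pow_apply]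
    split_ifs
    · simp only [Complex.real_smul]; push_cast; ring
    · simp
  refine h.unique ?_
  by_cases hij : (i : ℕ) ≤ j
  · rw [if_pos hij]
    convert hasSum_single ((j : ℕ) - i) ?_ using 1
    · rw [h2, if_pos (by omega)]
    · intro l hl
      rw [h2, if_neg (by omega)]
  · rw [if_neg hij]
    convert hasSum_zero using 1
    funext l
    rw [h2, if_neg (by omega)]

theorem exp_smul_jordanBlock {m : ℕ} (lam : ℂ) (t : ℝ) :
    NormedSpace.exp (t • (lam • (1 : Matrix (Fin m) (Fin m) ℂ) + shift m)) =
      Complex.exp (t * lam) • NormedSpace.exp (t • shift m) := by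
  have e1 : t • (lam • (1 : Matrix (Fin m) (Fin m) ℂ) + shift m) =
      (t * lam : ℂ) • (1 : Matrix (Fin m) (Fin m) ℂ) + t • shift m := by
    rw [smul_add, ← smul_assoc, Complex.real_smul]
  rw [e1, Matrix.exp_add_of_commute _ _ ((Commute.one_left _).smul_left _), smul_one_eq_diagonal,
    Matrix.exp_diagonal]
  have e2 : NormedSpace.exp (fun _ : Fin m => (t * lam : ℂ)) = fun _ => Complex.exp (t * lam) := by
    funext i
    rw [Pi.coe_exp, Complex.exp_eq_exp_ℂ]
  rw [e2, ← smul_one_eq_diagonal, smul_mul_assoc, one_mul]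

namespace CriticalJordanForm

variable {d : ℕ} {A : Matrix (Fin d) (Fin d) ℝ} (K : CriticalJordanForm A)

/-- The exponential `exp (t J)` of the Jordan matrix with the eigenvalues `lam`. -/
noncomputable def jordanFlow (lam : Fin K.R → ℂ) (t : ℝ) :
    Matrix (Σ r : Fin K.R, Fin (K.m r)) (Σ r : Fin K.R, Fin (K.m r)) ℂ :=
  Matrix.of fun a b => if a.1 = b.1 ∧ (a.2 : ℕ) ≤ b.2 then
    Complex.exp (t * lam a.1) * ((t : ℂ) ^ ((b.2 : ℕ) - a.2) / (((b.2 : ℕ) - a.2).factorial : ℂ))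
    else 0

theorem exp_smul_blockDiagonal (t : ℝ) :
    NormedSpace.exp (t • Matrix.blockDiagonal' (fun r =>
      K.lam r • (1 : Matrix (Fin (K.m r)) (Fin (K.m r)) ℂ) + shift (K.m r))) =
      K.jordanFlow K.lam t := by
  rw [← Matrix.blockDiagonal'_smul, Matrix.exp_blockDiagonal']
  ext ⟨r, i⟩ ⟨s, j⟩
  by_cases h : r = s
  · subst h
    rw [Matrix.blockDiagonal'_apply_eq]
    have hpi : NormedSpace.exp (t • fun r =>
        K.lam r • (1 : Matrix (Fin (K.m r)) (Fin (K.m r)) ℂ) + shift (K.m r)) r =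
        NormedSpace.exp (t • (K.lam r • (1 : Matrix (Fin (K.m r)) (Fin (K.m r)) ℂ) +
          shift (K.m r))) := Pi.coe_exp _ r
    refine (congrFun (congrFun hpi i) j).trans ?_
    rw [exp_smul_jordanBlock, Matrix.smul_apply, exp_smul_shift_apply, jordanFlow, Matrix.of_apply]
    by_cases hij : (i : ℕ) ≤ j
    · simp [hij]
    · simp [hij]
  · rw [Matrix.blockDiagonal'_apply_ne _ _ _ h, jordanFlow, Matrix.of_apply]
    simp [h]

theorem toC_mul_Q : toC A * K.Q =
    K.Q * Matrix.blockDiagonal' (fun r =>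
      K.lam r • (1 : Matrix (Fin (K.m r)) (Fin (K.m r)) ℂ) + shift (K.m r)) := by
  have h := congrArg (fun X => X * K.Q) K.jordan
  simp only [Matrix.mul_assoc, K.Qinv_mul_Q, Matrix.mul_one] at h
  rw [toC_mul, ← K.Q_mul_Qinv, Matrix.mul_assoc, Matrix.mul_assoc, K.Qinv_mul_Q,
    Matrix.mul_one] at h
  exact h

/-- `Q` intertwines the complexification of `A` with its Jordan matrix, hence also their
exponentials; multiplying by Q Q⁻¹ = P_c restricts to E_c. -/
theorem toC_flow_mul_projC (t : ℝ) :
    toC (flow A t * projC A) = K.Q * K.jordanFlow K.lam t * K.Qinv := by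
  rw [toC_mul, flow, toC_exp, toC_smul, ← K.Q_mul_Qinv, ← Matrix.mul_assoc,
    exp_mul_of_mul_eq (J := t • Matrix.blockDiagonal' (fun r =>
      K.lam r • (1 : Matrix (Fin (K.m r)) (Fin (K.m r)) ℂ) + shift (K.m r)))
    (by rw [Matrix.smul_mul, Matrix.mul_smul, K.toC_mul_Q]), exp_smul_blockDiagonal]

theorem Qinv_mul_toC_projC : K.Qinv * toC (projC A) = K.Qinv := by
  rw [← K.Q_mul_Qinv, ← Matrix.mul_assoc, K.Qinv_mul_Q, Matrix.one_mul]

/-- The normalized Jordan flow at time `- log k`. -/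
noncomputable def weight (lam : Fin K.R → ℂ) (n k : ℕ) :
    Matrix (Σ r : Fin K.R, Fin (K.m r)) (Σ r : Fin K.R, Fin (K.m r)) ℂ :=
  Matrix.diagonal (fun a => (((Real.log n ^ K.expo a)⁻¹ : ℝ) : ℂ)) *
    K.jordanFlow lam (-Real.log k)

/-- The normalization and the flow are written in the same Jordan basis, so the inner factor Q⁻¹ Q
disappears. -/
theorem Dinv_mul_flow (n k : ℕ) :
    K.Dinv n * toC (flow A (-Real.log k) * projC A) = K.Q * K.weight K.lam n k * K.Qinv := by
  rw [K.toC_flow_mul_projC, Dinv, weight]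
  calc _ = K.Q * Matrix.diagonal (fun a => (((Real.log n ^ K.expo a)⁻¹ : ℝ) : ℂ)) *
        (K.Qinv * K.Q) * K.jordanFlow K.lam (-Real.log k) * K.Qinv := by
        simp only [Matrix.mul_assoc]
    _ = _ := by rw [K.Qinv_mul_Q, Matrix.mul_one]; simp only [Matrix.mul_assoc]

theorem codepth_add (a : Σ r : Fin K.R, Fin (K.m r)) : K.codepth a + (a.2 : ℕ) + 1 = K.m a.1 := by
  have := a.2.2
  simp only [codepth]; omega

theorem expo_eq (a : Σ r : Fin K.R, Fin (K.m r)) : K.expo a = K.codepth a + 1 / 2 := by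
  have := K.codepth_add a
  have h2 : ((K.codepth a : ℝ)) + ((a.2 : ℕ) : ℝ) + 1 = K.m a.1 := by exact_mod_cast this
  rw [expo, ← h2]; ring

theorem weight_apply (lam : Fin K.R → ℂ) (n k : ℕ) (a b : Σ r : Fin K.R, Fin (K.m r)) :
    K.weight lam n k a b = if a.1 = b.1 ∧ (a.2 : ℕ) ≤ b.2 then
      (((Real.log n ^ K.expo a)⁻¹ : ℝ) : ℂ) * (Complex.exp (-Real.log k * lam a.1) *
        ((-(Real.log k : ℂ)) ^ ((b.2 : ℕ) - a.2) / (((b.2 : ℕ) - a.2).factorial : ℂ))) else 0 := by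
  rw [weight, Matrix.diagonal_mul, jordanFlow, Matrix.of_apply]
  push_cast
  split_ifs <;> simp

theorem norm_cexp_neg_log_mul {z : ℂ} (hz : z.re = 1 / 2) {k : ℕ} (hk : 1 ≤ k) :
    ‖Complex.exp (-Real.log k * z)‖ = (k : ℝ) ^ (-(1 / 2) : ℝ) := by
  have hk0 : (0 : ℝ) < k := by exact_mod_cast hk
  rw [Complex.norm_exp, Real.rpow_def_of_pos hk0]
  congr 1
  rw [← Complex.ofReal_neg, Complex.re_ofReal_mul, hz]
  ring

theorem norm_weight_entry_le {n k : ℕ} (hk : 1 ≤ k) (hkn : k ≤ n) (hn : 1 ≤ Real.log n)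
    (a b : Σ r : Fin K.R, Fin (K.m r)) :
    ‖K.weight K.lam n k a b‖ ≤ (k : ℝ) ^ (-(1 / 2) : ℝ) * Real.log n ^ (-(1 / 2) : ℝ) := by
  have hL : 0 < Real.log n := by linarith
  have hk0 : (0 : ℝ) < k := by exact_mod_cast hk
  have hlk : 0 ≤ Real.log k := Real.log_natCast_nonneg k
  have hlkn : Real.log k ≤ Real.log n := Real.log_le_log hk0 (by exact_mod_cast hkn)
  rw [weight_apply]
  split_ifs with h
  · rw [norm_mul, norm_mul, norm_cexp_neg_log_mul (K.lam_re _) hk, Complex.norm_real, norm_div,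
      norm_pow, norm_neg, Complex.norm_real, Real.norm_of_nonneg hlk,
      Real.norm_of_nonneg (by positivity), Complex.norm_natCast]
    set p := (b.2 : ℕ) - a.2
    -- The distance p to the right inside a block is at most m_r - i, while the normalization
    -- carries the exponent m_r - i + 1/2; half a power of log n is left over.
    have h1 : Real.log k ^ p / (p.factorial : ℝ) ≤ Real.log n ^ (K.codepth a) := by
      calc Real.log k ^ p / (p.factorial : ℝ) ≤ Real.log k ^ p := by
            refine div_le_self (by positivity) ?_
            exact_mod_cast Nat.one_le_iff_ne_zero.2 (Nat.factorial_ne_zero p)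
        _ ≤ Real.log n ^ p := by gcongr
        _ ≤ Real.log n ^ (K.codepth a) := by
            refine pow_le_pow_right₀ hn ?_
            have h2 := K.codepth_add a
            have h3 := b.2.2
            have h4 : K.m a.1 = K.m b.1 := by rw [h.1]
            omega
    have h4 : (Real.log n ^ K.expo a)⁻¹ * Real.log n ^ (K.codepth a) =
        Real.log n ^ (-(1 / 2) : ℝ) := by
      rw [expo_eq, ← Real.rpow_natCast, ← Real.rpow_neg hL.le, ← Real.rpow_add hL]
      congr 1; ring
    calc _ ≤ (Real.log n ^ K.expo a)⁻¹ * ((k : ℝ) ^ (-(1 / 2) : ℝ) * Real.log n ^ (K.codepth a)) := by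
          gcongr
      _ = (k : ℝ) ^ (-(1 / 2) : ℝ) * ((Real.log n ^ K.expo a)⁻¹ * Real.log n ^ (K.codepth a)) := by
          ring
      _ = _ := by rw [h4]
  · rw [norm_zero]; positivity

theorem exists_norm_Dinv_mul_flow_le : ∃ C : ℝ, 0 < C ∧ ∀ n k : ℕ, 1 ≤ k → k ≤ n → 1 ≤ Real.log n →
    ‖K.Dinv n * toC (flow A (-Real.log k) * projC A)‖ ≤
      C * ((k : ℝ) ^ (-(1 / 2) : ℝ) * Real.log n ^ (-(1 / 2) : ℝ)) := by
  set N : ℝ := ∑ _a : Σ r : Fin K.R, Fin (K.m r), ∑ _b : Σ r : Fin K.R, Fin (K.m r), (1 : ℝ)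
  have hN : 0 ≤ N := Finset.sum_nonneg fun _ _ => Finset.sum_nonneg fun _ _ => zero_le_one
  refine ⟨‖K.Q‖ * N * ‖K.Qinv‖ + 1, by positivity, fun n k hk hkn hn => ?_⟩
  have hL : 0 < Real.log n := by linarith
  rw [Dinv_mul_flow]
  have h1 : ‖K.weight K.lam n k‖ ≤ N * ((k : ℝ) ^ (-(1 / 2) : ℝ) * Real.log n ^ (-(1 / 2) : ℝ)) := by
    refine (norm_le_sum_norm_entries _).trans ?_
    rw [Finset.sum_mul]
    refine Finset.sum_le_sum fun a _ => ?_
    rw [Finset.sum_mul]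
    refine Finset.sum_le_sum fun b _ => ?_
    rw [one_mul]
    exact K.norm_weight_entry_le hk hkn hn a b
  calc _ ≤ ‖K.Q‖ * ‖K.weight K.lam n k‖ * ‖K.Qinv‖ := by
        refine (Matrix.frobenius_norm_mul _ _).trans ?_
        gcongr
        exact Matrix.frobenius_norm_mul _ _
    _ ≤ ‖K.Q‖ * (N * ((k : ℝ) ^ (-(1 / 2) : ℝ) * Real.log n ^ (-(1 / 2) : ℝ))) * ‖K.Qinv‖ := by
        gcongr
    _ = (‖K.Q‖ * N * ‖K.Qinv‖) * ((k : ℝ) ^ (-(1 / 2) : ℝ) * Real.log n ^ (-(1 / 2) : ℝ)) := by ring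
    _ ≤ _ := by gcongr; linarith

theorem tendsto_log_rpow_neg {s : ℝ} (hs : s < 0) :
    Tendsto (fun n : ℕ => Real.log n ^ s) atTop (𝓝 0) := by
  have := (tendsto_rpow_neg_atTop (y := -s) (by linarith)).comp tendsto_log_natCast
  simpa [Function.comp_def] using this

/-- Every exponent of log n in the normalization is at least 1/2. This makes a critical remainder
bounded in L¹ negligible. -/
theorem tendsto_Dinv : Tendsto (fun n => K.Dinv n) atTop (𝓝 0) := by
  have h : Tendsto (fun n : ℕ => Matrix.diagonal (fun a : Σ r : Fin K.R, Fin (K.m r) =>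
      (((Real.log n ^ K.expo a)⁻¹ : ℝ) : ℂ))) atTop (𝓝 0) := by
    rw [← Matrix.diagonal_zero]
    refine ((continuous_id.matrix_diagonal).tendsto _).comp (tendsto_pi_nhds.2 fun a => ?_)
    have h1 := tendsto_log_rpow_neg (s := -K.expo a) (by rw [K.expo_eq]; linarith [
      (Nat.cast_nonneg (K.codepth a) : (0 : ℝ) ≤ _)])
    have h2 := (Complex.continuous_ofReal.tendsto 0).comp h1
    refine (Complex.ofReal_zero ▸ h2).congr fun n => ?_
    simp only [Function.comp]
    rw [Real.rpow_neg (Real.log_natCast_nonneg n)]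
    rfl
  have h2 : Continuous fun X : Matrix (Σ r : Fin K.R, Fin (K.m r)) (Σ r : Fin K.R, Fin (K.m r)) ℂ =>
      K.Q * X * K.Qinv := by fun_prop
  have h3 := (h2.tendsto 0).comp h
  simpa [Function.comp_def, Dinv] using h3

/-- The coefficient of the limit covariance. -/
noncomputable def limitCoef (a b : Σ r : Fin K.R, Fin (K.m r)) : ℂ :=
  (-1 : ℂ) ^ (K.codepth a + K.codepth b) /
        (((K.codepth a).factorial : ℂ) * ((K.codepth b).factorial : ℂ) *
          ((K.codepth a : ℂ) + (K.codepth b : ℂ) + 1))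

open Classical in
theorem tendsto_sum_weight_entries {kap : Fin K.R → ℂ} (hkap : ∀ r, (kap r).re = 1 / 2)
    (a a' b b' : Σ r : Fin K.R, Fin (K.m r)) :
    Tendsto (fun n : ℕ => ∑ k ∈ Finset.Ioc 0 n, K.weight K.lam n k a a' * K.weight kap n k b b')
      atTop (𝓝 (if a' = K.last a.1 ∧ b' = K.last b.1 ∧ K.lam a.1 = (starRingEnd ℂ) (kap b.1)
        then K.limitCoef a b else 0)) := by
  by_cases hab : (a.1 = a'.1 ∧ (a.2 : ℕ) ≤ a'.2) ∧ (b.1 = b'.1 ∧ (b.2 : ℕ) ≤ b'.2)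
  swap
  · have hz : ∀ n k, K.weight K.lam n k a a' * K.weight kap n k b b' = 0 := by
      intro n k
      rw [weight_apply, weight_apply]
      rcases not_and_or.1 hab with h | h <;> simp only [if_neg h, zero_mul, mul_zero]
    simp only [hz, Finset.sum_const_zero]
    rw [if_neg]
    · exact tendsto_const_nhds
    · rintro ⟨rfl, rfl, -⟩
      apply hab
      have h1 := a.2.2
      have h2 := b.2.2
      refine ⟨⟨rfl, ?_⟩, ⟨rfl, ?_⟩⟩ <;> simp only [last] <;> omega
  obtain ⟨⟨ha1, ha2⟩, ⟨hb1, hb2⟩⟩ := hab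
  set p := (a'.2 : ℕ) - a.2 with hp
  set p' := (b'.2 : ℕ) - b.2 with hp'
  -- The real parts of the two eigenvalues add up to 1, so the product of the exponentials is k⁻¹
  -- k^{-iθ}.
  set θ : ℝ := (K.lam a.1).im + (kap b.1).im with hθ
  have hpa : p ≤ K.codepth a := by
    have h2 := K.codepth_add a
    have h3 := a'.2.2
    have h4 : K.m a.1 = K.m a'.1 := by rw [ha1]
    omega
  have hpb : p' ≤ K.codepth b := by
    have h2 := K.codepth_add b
    have h3 := b'.2.2
    have h4 : K.m b.1 = K.m b'.1 := by rw [hb1]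
    omega
  have hlast : ∀ (x y : Σ r : Fin K.R, Fin (K.m r)), x.1 = y.1 → (x.2 : ℕ) ≤ y.2 →
      (y = K.last x.1 ↔ (y.2 : ℕ) - x.2 = K.codepth x) := by
    rintro ⟨r, i⟩ ⟨s, j⟩ h hij
    simp only at h hij ⊢
    subst h
    simp only [last, codepth, Sigma.mk.injEq, heq_eq_eq, true_and, Fin.ext_iff]
    have := j.2
    have := i.2
    omega
  -- Each factor reaches the full power of log k exactly when its column is the last of its block;
  -- equality of the eigenvalues up to conjugation amounts to θ = 0.
  have hcond : (a' = K.last a.1 ∧ b' = K.last b.1 ∧ K.lam a.1 = (starRingEnd ℂ) (kap b.1)) ↔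
      (p = K.codepth a ∧ p' = K.codepth b ∧ θ = 0) := by
    rw [hlast a a' ha1 ha2, hlast b b' hb1 hb2]
    refine and_congr Iff.rfl (and_congr Iff.rfl ?_)
    rw [Complex.ext_iff, Complex.conj_re, Complex.conj_im, K.lam_re, hkap, hθ,
      ← eq_neg_iff_add_eq_zero]
    simp
  rw [if_congr hcond rfl rfl]
  have hexp : ∀ k : ℕ, 1 ≤ k → Complex.exp (-Real.log k * K.lam a.1) *
      Complex.exp (-Real.log k * kap b.1) =
      ((1 / k : ℝ) : ℂ) * Complex.exp (-(Complex.I * θ) * Real.log k) := by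
    intro k hk
    have hk0 : (0 : ℝ) < k := by exact_mod_cast hk
    have e1 : ((1 / k : ℝ) : ℂ) = Complex.exp (-Real.log k) := by
      rw [← Complex.ofReal_neg, ← Complex.ofReal_exp, Real.exp_neg, Real.exp_log hk0, one_div]
    rw [e1, ← Complex.exp_add, ← Complex.exp_add]
    congr 1
    have e2 : K.lam a.1 = 1 / 2 + (K.lam a.1).im * Complex.I := by
      conv_lhs => rw [← Complex.re_add_im (K.lam a.1), K.lam_re]
      push_cast; rfl
    have e3 : kap b.1 = 1 / 2 + (kap b.1).im * Complex.I := by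
      conv_lhs => rw [← Complex.re_add_im (kap b.1), hkap]
      push_cast; rfl
    rw [e2, e3, hθ]
    push_cast
    ring
  have hsum : ∀ n : ℕ, ∑ k ∈ Finset.Ioc 0 n, K.weight K.lam n k a a' * K.weight kap n k b b' =
      ((-1 : ℂ) ^ (p + p') / ((p.factorial : ℂ) * (p'.factorial : ℂ))) *
      (((Real.log n ^ K.expo a)⁻¹ * (Real.log n ^ K.expo b)⁻¹ : ℝ) : ℂ) *
      ∑ k ∈ Finset.Ioc 0 n, Complex.exp (-(Complex.I * θ) * Real.log k) *
        ((Real.log k ^ (p + p') / k : ℝ) : ℂ) := by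
    intro n
    rw [Finset.mul_sum]
    refine Finset.sum_congr rfl fun k hk => ?_
    have hk1 := (Finset.mem_Ioc.1 hk).1
    rw [weight_apply, weight_apply, if_pos ⟨ha1, ha2⟩, if_pos ⟨hb1, hb2⟩]
    have h1 := hexp k hk1
    calc _ = (((Real.log n ^ K.expo a)⁻¹ : ℝ) : ℂ) * (((Real.log n ^ K.expo b)⁻¹ : ℝ) : ℂ) *
          (Complex.exp (-Real.log k * K.lam a.1) * Complex.exp (-Real.log k * kap b.1)) *
          (((-(Real.log k : ℂ)) ^ p / (p.factorial : ℂ)) *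
            ((-(Real.log k : ℂ)) ^ p' / (p'.factorial : ℂ))) := by ring
      _ = _ := by
        rw [h1, neg_pow, neg_pow (Real.log k : ℂ) p']
        push_cast
        ring
  have hS := tendsto_sum_log_pow θ (p + p')
  have hlog : ∀ᶠ k : ℕ in atTop, 0 < Real.log k := tendsto_log_natCast.eventually_gt_atTop 0
  -- Split off the power (log n)^{p+p'+1} that normalizes the sum. The remaining exponent is never
  -- positive, and is zero only if both p and p' are maximal.
  have hscale : ∀ᶠ n : ℕ in atTop, ∑ k ∈ Finset.Ioc 0 n,
      K.weight K.lam n k a a' * K.weight kap n k b b' =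
      ((-1 : ℂ) ^ (p + p') / ((p.factorial : ℂ) * (p'.factorial : ℂ))) *
      ((Real.log n ^ (((p + p' : ℕ) : ℝ) - (K.codepth a + K.codepth b : ℕ)) : ℝ) : ℂ) *
      ((∑ k ∈ Finset.Ioc 0 n, Complex.exp (-(Complex.I * θ) * Real.log k) *
        ((Real.log k ^ (p + p') / k : ℝ) : ℂ)) / ((Real.log n ^ (p + p' + 1) : ℝ) : ℂ)) := by
    filter_upwards [hlog] with n hn
    rw [hsum]
    have e : (Real.log n ^ K.expo a)⁻¹ * (Real.log n ^ K.expo b)⁻¹ =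
        Real.log n ^ (((p + p' : ℕ) : ℝ) - (K.codepth a + K.codepth b : ℕ)) /
          Real.log n ^ (p + p' + 1) := by
      rw [← Real.rpow_natCast, ← Real.rpow_sub hn, ← Real.rpow_neg hn.le, ← Real.rpow_neg hn.le,
        ← Real.rpow_add hn, expo_eq, expo_eq]
      congr 1
      push_cast
      ring
    rw [e]
    push_cast
    ring
  refine Tendsto.congr' (EventuallyEq.symm hscale) ?_
  by_cases hmax : p = K.codepth a ∧ p' = K.codepth b
  · have e0 : ((p + p' : ℕ) : ℝ) - (K.codepth a + K.codepth b : ℕ) = 0 := by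
      rw [hmax.1, hmax.2, sub_self]
    simp only [e0, Real.rpow_zero, Complex.ofReal_one, mul_one]
    have h5 := hS.const_mul ((-1 : ℂ) ^ (p + p') / ((p.factorial : ℂ) * (p'.factorial : ℂ)))
    convert h5 using 2
    by_cases hθ0 : θ = 0
    · rw [if_pos ⟨hmax.1, hmax.2, hθ0⟩, if_pos hθ0, limitCoef, ← hmax.1, ← hmax.2]
      push_cast
      rw [div_mul_div_comm, mul_one]
    · rw [if_neg (fun h => hθ0 h.2.2), if_neg hθ0, mul_zero]
  · rw [if_neg (fun h => hmax ⟨h.1, h.2.1⟩)]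
    have hlt : ((p + p' : ℕ) : ℝ) - (K.codepth a + K.codepth b : ℕ) < 0 := by
      rw [sub_neg]
      have : p + p' < K.codepth a + K.codepth b := by omega
      exact_mod_cast this
    have h6 := (Complex.continuous_ofReal.tendsto 0).comp (tendsto_log_rpow_neg hlt)
    have h7 := (h6.const_mul ((-1 : ℂ) ^ (p + p') / ((p.factorial : ℂ) * (p'.factorial : ℂ)))).mul hS
    rw [Complex.ofReal_zero, mul_zero, zero_mul] at h7
    exact h7

theorem tendsto_sum_weight {kap : Fin K.R → ℂ} (hkap : ∀ r, (kap r).re = 1 / 2)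
    (T : Matrix (Σ r : Fin K.R, Fin (K.m r)) (Σ r : Fin K.R, Fin (K.m r)) ℂ) :
    Tendsto (fun n : ℕ => ∑ k ∈ Finset.Ioc 0 n, K.weight K.lam n k * T * (K.weight kap n k)ᵀ)
      atTop (𝓝 (K.limitBlocks (fun s => (starRingEnd ℂ) (kap s)) T)) := by
  classical
  refine tendsto_pi_nhds.2 fun a => tendsto_pi_nhds.2 fun b => ?_
  have h : ∀ n : ℕ, (∑ k ∈ Finset.Ioc 0 n, K.weight K.lam n k * T * (K.weight kap n k)ᵀ) a b =
      ∑ b', ∑ a', T a' b' * ∑ k ∈ Finset.Ioc 0 n, K.weight K.lam n k a a' * K.weight kap n k b b' := by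
    intro n
    rw [Matrix.sum_apply]
    simp only [Matrix.mul_apply, Matrix.transpose_apply, Finset.sum_mul, Finset.mul_sum]
    rw [Finset.sum_comm]
    refine Finset.sum_congr rfl fun b' _ => ?_
    rw [Finset.sum_comm]
    refine Finset.sum_congr rfl fun a' _ => Finset.sum_congr rfl fun k _ => ?_
    ring
  simp only [h]
  have h2 := tendsto_finsetSum Finset.univ fun b' _ => tendsto_finsetSum Finset.univ fun a' _ =>
    (K.tendsto_sum_weight_entries hkap a a' b b').const_mul (T a' b')
  convert h2 using 2
  rw [limitBlocks, Matrix.of_apply]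
  by_cases hl : K.lam a.1 = (starRingEnd ℂ) (kap b.1)
  · simp only [hl, if_true, and_true]
    rw [Finset.sum_eq_single (K.last b.1), Finset.sum_eq_single (K.last a.1)]
    · simp [limitCoef, mul_comm]
    · intro x _ hx; simp [hx]
    · simp
    · intro x _ hx; simp [hx]
    · simp
  · simp [hl]

/-- Only the eigenvalues in the weight are non-real. Hence one transposed limit, with free second
eigenvalues, yields both the covariance and the pseudo-covariance. -/
theorem weight_conjTranspose (n k : ℕ) :
    (K.weight K.lam n k)ᴴ = (K.weight (fun r => (starRingEnd ℂ) (K.lam r)) n k)ᵀ := by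
  ext a b
  rw [Matrix.conjTranspose_apply, Matrix.transpose_apply, weight_apply, weight_apply]
  split_ifs
  · rw [RCLike.star_def, map_mul, map_mul, map_div₀, map_pow, map_neg, Complex.conj_ofReal,
      Complex.conj_ofReal, ← Complex.exp_conj, map_mul, map_neg, Complex.conj_ofReal, map_natCast]
  · simp

theorem tendsto_critical_sum (Sig : Matrix (Fin d) (Fin d) ℝ) :
    Tendsto (fun n : ℕ => ∑ k ∈ Finset.Ioc 0 n,
      (K.Dinv n * toC (flow A (-Real.log k) * projC A)) * toC Sig *
        (K.Dinv n * toC (flow A (-Real.log k) * projC A))ᴴ) atTop (𝓝 (K.XiC Sig)) := by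
  have h := K.tendsto_sum_weight (kap := fun r => (starRingEnd ℂ) (K.lam r))
    (fun r => by rw [Complex.conj_re, K.lam_re]) (K.Qinv * toC Sig * K.Qinvᴴ)
  simp only [Complex.conj_conj] at h
  have hcont : Continuous fun X : Matrix (Σ r : Fin K.R, Fin (K.m r)) (Σ r : Fin K.R, Fin (K.m r)) ℂ =>
      K.Q * X * K.Qᴴ := by fun_prop
  have h2 := (hcont.tendsto _).comp h
  -- Q⁻¹ already vanishes on the kernel of P_c, so the projections around Σ are redundant.
  have e : K.Qinv * toC (projC A * Sig * (projC A)ᵀ) * K.Qinvᴴ = K.Qinv * toC Sig * K.Qinvᴴ := by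
    have e1 : toC ((projC A)ᵀ) = (toC (projC A))ᴴ := by
      ext i j; simp [toC]
    rw [toC_mul, toC_mul, e1, ← Matrix.mul_assoc, ← Matrix.mul_assoc, Qinv_mul_toC_projC,
      Matrix.mul_assoc (K.Qinv * toC Sig), ← Matrix.conjTranspose_mul, Qinv_mul_toC_projC]
  rw [XiC, e]
  refine h2.congr fun n => ?_
  simp only [Function.comp]
  rw [Matrix.mul_sum, Matrix.sum_mul]
  refine Finset.sum_congr rfl fun k _ => ?_
  rw [Dinv_mul_flow, ← weight_conjTranspose]
  simp only [Matrix.conjTranspose_mul, Matrix.mul_assoc]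

theorem tendsto_critical_sum_pseudo (Sig : Matrix (Fin d) (Fin d) ℝ) :
    Tendsto (fun n : ℕ => ∑ k ∈ Finset.Ioc 0 n,
      (K.Dinv n * toC (flow A (-Real.log k) * projC A)) * toC Sig *
        (K.Dinv n * toC (flow A (-Real.log k) * projC A))ᵀ) atTop (𝓝 (K.pseudoXiC Sig)) := by
  have h := K.tendsto_sum_weight (kap := K.lam) K.lam_re (K.Qinv * toC Sig * K.Qinvᵀ)
  have hcont : Continuous fun X : Matrix (Σ r : Fin K.R, Fin (K.m r)) (Σ r : Fin K.R, Fin (K.m r)) ℂ =>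
      K.Q * X * K.Qᵀ := by fun_prop
  have h2 := (hcont.tendsto _).comp h
  have e : K.Qinv * toC (projC A * Sig * (projC A)ᵀ) * K.Qinvᵀ = K.Qinv * toC Sig * K.Qinvᵀ := by
    have e1 : toC ((projC A)ᵀ) = (toC (projC A))ᵀ := by
      ext i j; simp [toC]
    rw [toC_mul, toC_mul, e1, ← Matrix.mul_assoc, ← Matrix.mul_assoc, Qinv_mul_toC_projC,
      Matrix.mul_assoc (K.Qinv * toC Sig), ← Matrix.transpose_mul, Qinv_mul_toC_projC]
  rw [pseudoXiC, e]
  refine h2.congr fun n => ?_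
  simp only [Function.comp]
  rw [Matrix.mul_sum, Matrix.sum_mul]
  refine Finset.sum_congr rfl fun k _ => ?_
  rw [Dinv_mul_flow]
  simp only [Matrix.transpose_mul, Matrix.mul_assoc]

end CriticalJordanForm

end JordanFlow

end RWSD

/-! ### Martingale noise and characteristic functions. -/

namespace RWSD

/-- The action of a rectangular matrix on Euclidean vectors. -/
noncomputable def actRect {𝕜 κ : Type*} [RCLike 𝕜] {d : ℕ} (M : Matrix κ (Fin d) 𝕜)
    (v : EuclideanSpace 𝕜 (Fin d)) : EuclideanSpace 𝕜 κ :=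
  WithLp.toLp 2 (M *ᵥ WithLp.ofLp v)

/-- A sequence of martingale differences `ε 1, ε 2, …`, bounded in `L^q`, whose conditional
covariances converge to `Sig` in mean; the conditional moments are tested against past variables. -/
structure IsNoise {Ω : Type*} {mΩ : MeasurableSpace Ω} (P : Measure Ω) {d : ℕ}
    (F : Filtration ℕ mΩ) (ε : ℕ → Ω → EuclideanSpace ℝ (Fin d))
    (Sig : Matrix (Fin d) (Fin d) ℝ) (q C : ℝ) (e : ℕ → ℝ) : Prop where
  two_lt : 2 < q
  le_three : q ≤ 3
  measurable : ∀ k, Measurable[F (k + 1)] (ε (k + 1))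
  integrable : ∀ k, Integrable (fun ω => ‖ε (k + 1) ω‖ ^ q) P
  moment : ∀ k, ∫ ω, ‖ε (k + 1) ω‖ ^ q ∂P ≤ C
  center : ∀ k (Z : Ω → ℝ), Measurable[F k] Z → MemLp Z 2 P → ∀ i,
    ∫ ω, Z ω * ε (k + 1) ω i ∂P = 0
  cov : ∀ k (Z : Ω → ℝ), Measurable[F k] Z → (∀ ω, |Z ω| ≤ 1) → ∀ i j,
    |∫ ω, Z ω * (ε (k + 1) ω i * ε (k + 1) ω j - Sig i j) ∂P| ≤ e (k + 1)
  err_nonneg : ∀ k, 0 ≤ e k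
  err_tendsto : Tendsto e atTop (𝓝 0)

/-- For |x| ≤ 1 the third-order Taylor bound is at most a multiple of |x|^q since q ≤ 3; for |x| ≥ 1
the terms are bounded one by one by x² ≤ |x|^q since q ≥ 2. -/
theorem norm_cexp_sub_taylor_le {q : ℝ} (hq2 : 2 ≤ q) (hq3 : q ≤ 3) (x : ℝ) :
    ‖Complex.exp (x * Complex.I) - (1 + x * Complex.I - x ^ 2 / 2)‖ ≤ 4 * |x| ^ q := by
  rcases le_total |x| 1 with h | h
  · have h1 := Complex.exp_bound (x := x * Complex.I) (by simpa using h) (n := 3) (by norm_num)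
    have e : ∑ m ∈ Finset.range 3, (x * Complex.I) ^ m / (m.factorial : ℂ) =
        1 + x * Complex.I - x ^ 2 / 2 := by
      simp [Finset.sum_range_succ, mul_pow, Nat.factorial]
      ring
    rw [e] at h1
    refine h1.trans ?_
    have h2 : ‖(x : ℂ) * Complex.I‖ = |x| := by simp
    rw [h2]
    have h3 : |x| ^ 3 ≤ |x| ^ q := by
      rw [← Real.rpow_natCast]
      rcases eq_or_lt_of_le (abs_nonneg x) with h0 | h0
      · rw [← h0, Real.zero_rpow (by norm_num), Real.zero_rpow (by linarith)]
      · exact Real.rpow_le_rpow_of_exponent_ge h0 h (by exact_mod_cast hq3)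
    have h4 : (0 : ℝ) ≤ |x| ^ q := by positivity
    calc |x| ^ 3 * _ ≤ |x| ^ q * 4 := by
          gcongr
          norm_num [Nat.factorial]
      _ = _ := by ring
  · have h1 : ‖Complex.exp (x * Complex.I) - (1 + x * Complex.I - x ^ 2 / 2)‖ ≤
        1 + (1 + |x| + |x| ^ 2 / 2) := by
      refine (norm_sub_le _ _).trans (add_le_add (by rw [Complex.norm_exp_ofReal_mul_I]) ?_)
      refine (norm_sub_le _ _).trans (add_le_add ((norm_add_le _ _).trans ?_) ?_)
      · simp
      · simp
    have h2 : |x| ^ 2 ≤ |x| ^ q := by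
      rw [← Real.rpow_natCast]
      exact Real.rpow_le_rpow_of_exponent_le h (by exact_mod_cast hq2)
    nlinarith

theorem abs_exp_neg_sub_le {v : ℝ} (hv : 0 ≤ v) :
    |Real.exp (-v / 2) - (1 - v / 2)| ≤ v ^ 2 := by
  have h1 := Real.add_one_le_exp (-v / 2)
  rw [abs_of_nonneg (by linarith)]
  have h2 : Real.exp (-v / 2) ≤ 1 / (1 + v / 2) := by
    rw [neg_div, Real.exp_neg, one_div]
    refine inv_anti₀ (by linarith) ?_
    linarith [Real.add_one_le_exp (v / 2)]
  have h3 : 1 / (1 + v / 2) - (1 - v / 2) ≤ v ^ 2 := by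
    rw [sub_le_iff_le_add, div_le_iff₀ (by linarith)]
    nlinarith [mul_nonneg hv (sq_nonneg v)]
  linarith

/-- The moment conditions are tested against real variables; this transfers them to the complex test
variable e^{iL}. -/
theorem norm_integral_mul_ofReal_le {Ω : Type*} {mΩ : MeasurableSpace Ω} {P : Measure Ω}
    {Z : Ω → ℂ} {f : Ω → ℝ} (h : Integrable (fun ω => Z ω * (f ω : ℂ)) P) :
    ‖∫ ω, Z ω * (f ω : ℂ) ∂P‖ ≤ |∫ ω, (Z ω).re * f ω ∂P| + |∫ ω, (Z ω).im * f ω ∂P| := by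
  refine (Complex.norm_le_abs_re_add_abs_im _).trans (le_of_eq ?_)
  have h1 := Complex.reCLM.integral_comp_comm h
  have h2 := Complex.imCLM.integral_comp_comm h
  simp only [Complex.reCLM_apply, Complex.imCLM_apply, Complex.re_mul_ofReal,
    Complex.im_mul_ofReal] at h1 h2
  rw [h1, h2]

namespace IsNoise

variable {Ω : Type*} {mΩ : MeasurableSpace Ω} {P : Measure Ω} {d : ℕ}
  {F : Filtration ℕ mΩ} {ε : ℕ → Ω → EuclideanSpace ℝ (Fin d)} {Sig : Matrix (Fin d) (Fin d) ℝ}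
  {q C : ℝ} {e : ℕ → ℝ}

theorem measurable_partial (h : IsNoise P F ε Sig q C e) (β : ℕ → EuclideanSpace ℝ (Fin d))
    (N : ℕ) : Measurable[F N] fun ω => ∑ k ∈ Finset.range N, inner ℝ (ε (k + 1) ω) (β (k + 1)) := by
  refine Finset.measurable_sum _ fun k hk => ?_
  have h1 : Measurable[F N] (ε (k + 1)) :=
    (h.measurable k).mono (F.mono (by simpa using hk)) le_rfl
  exact (Continuous.measurable (by fun_prop : Continuous fun y : EuclideanSpace ℝ (Fin d) =>
    inner ℝ y (β (k + 1)))).comp h1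

variable [IsProbabilityMeasure P]

theorem memLp (h : IsNoise P F ε Sig q C e) (k : ℕ) : MemLp (ε (k + 1)) 2 P := by
  have hm : AEStronglyMeasurable (ε (k + 1)) P :=
    ((h.measurable k).mono (F.le _) le_rfl).aestronglyMeasurable
  have hq : 0 < q := by linarith [h.two_lt]
  have h1 : MemLp (ε (k + 1)) (ENNReal.ofReal q) P := by
    rw [← integrable_norm_rpow_iff hm (by simpa using hq) ENNReal.ofReal_ne_top,
      ENNReal.toReal_ofReal hq.le]
    exact h.integrable k
  refine h1.mono_exponent ?_
  rw [← ENNReal.ofReal_ofNat]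
  exact ENNReal.ofReal_le_ofReal h.two_lt.le

theorem memLp_inner (h : IsNoise P F ε Sig q C e) (β : EuclideanSpace ℝ (Fin d)) (k : ℕ) :
    MemLp (fun ω => inner ℝ (ε (k + 1) ω) β) 2 P :=
  (h.memLp k).inner_const β

theorem memLp_apply (h : IsNoise P F ε Sig q C e) (k : ℕ) (i : Fin d) :
    MemLp (fun ω => ε (k + 1) ω i) 2 P := by
  have := h.memLp_inner (EuclideanSpace.single i 1) k
  simpa [EuclideanSpace.inner_single_right] using this

theorem inner_eq_sum {d : ℕ} (x β : EuclideanSpace ℝ (Fin d)) :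
    inner ℝ x β = ∑ i, β i * x i := by
  rw [PiLp.inner_apply]
  simp

/-- The variance form of a weight. -/
noncomputable def varForm (Sig : Matrix (Fin d) (Fin d) ℝ) (β : EuclideanSpace ℝ (Fin d)) : ℝ :=
  ∑ i, ∑ j, β i * β j * Sig i j

/-- Expand the last exponential to second order against the past variable e^{iL}. The linear term
vanishes by the martingale property and the quadratic one gives -v/2 up to the covariance error. The
q-th moment controls the Taylor remainder, and e^{-v/2} differs from 1 - v/2 by at most v². No
conditional characteristic function is needed. -/
theorem charFun_step (h : IsNoise P F ε Sig q C e) (hSig : ∀ β, 0 ≤ varForm Sig β)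
    (β : EuclideanSpace ℝ (Fin d)) (k : ℕ) {L : Ω → ℝ} (hL : Measurable[F k] L) :
    ‖∫ ω, Complex.exp ((L ω + inner ℝ (ε (k + 1) ω) β : ℝ) * Complex.I) ∂P -
      (Real.exp (-varForm Sig β / 2) : ℂ) * ∫ ω, Complex.exp (L ω * Complex.I) ∂P‖ ≤
      (d : ℝ) ^ 2 * (‖β‖ ^ 2 * e (k + 1)) + 4 * C * ‖β‖ ^ q + (varForm Sig β) ^ 2 := by
  have hLm : Measurable L := hL.mono (F.le _) le_rfl
  set Z : Ω → ℂ := fun ω => Complex.exp (L ω * Complex.I) with hZ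
  have hZm : Measurable[F k] Z := by
    refine Complex.measurable_exp.comp ?_
    exact (Complex.measurable_ofReal.comp hL).mul_const _
  have hZm' : Measurable Z := hZm.mono (F.le _) le_rfl
  have hZn : ∀ ω, ‖Z ω‖ = 1 := fun ω => Complex.norm_exp_ofReal_mul_I _
  set x : Ω → ℝ := fun ω => inner ℝ (ε (k + 1) ω) β with hx
  set v := varForm Sig β with hv
  have hv0 : 0 ≤ v := hSig β
  have hx2 : MemLp x 2 P := h.memLp_inner β k
  have hxi : Integrable x P := hx2.integrable (by norm_num)
  have hxsq : Integrable (fun ω => x ω ^ 2) P := hx2.integrable_sq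
  have hxm : AEStronglyMeasurable x P := hx2.1
  have hZmul : ∀ {f : Ω → ℂ}, Integrable f P → Integrable (fun ω => Z ω * f ω) P := by
    intro f hf
    exact hf.bdd_mul hZm'.aestronglyMeasurable (Eventually.of_forall fun ω => (hZn ω).le)
  have hqpos : 0 < q := by linarith [h.two_lt]
  -- splitting
  set ρ : Ω → ℂ := fun ω => Complex.exp (x ω * Complex.I) -
    (1 + x ω * Complex.I - (x ω : ℂ) ^ 2 / 2) with hρ
  have hxc : Integrable (fun ω => (x ω : ℂ)) P := hxi.ofReal
  have hyc : Integrable (fun ω => ((x ω ^ 2 - v : ℝ) : ℂ)) P :=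
    (hxsq.sub (integrable_const v)).ofReal
  have hexp : Integrable (fun ω => Complex.exp (x ω * Complex.I)) P := by
    refine Integrable.of_bound (C := 1) ?_ (Eventually.of_forall fun ω => ?_)
    · have : Continuous fun y : ℝ => Complex.exp (y * Complex.I) := by fun_prop
      exact this.comp_aestronglyMeasurable hxm
    · rw [Complex.norm_exp_ofReal_mul_I]
  have hρi : Integrable ρ P := by
    refine hexp.sub (((integrable_const 1).add (hxc.mul_const _)).sub ?_)
    have := hxsq.ofReal (𝕜 := ℂ)
    simpa using this.div_const 2
  have hsplit : ∀ ω, Complex.exp ((L ω + x ω : ℝ) * Complex.I) -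
      (Real.exp (-v / 2) : ℂ) * Z ω =
      Complex.I * (Z ω * (x ω : ℂ)) - (1 / 2) * (Z ω * ((x ω ^ 2 - v : ℝ) : ℂ)) + Z ω * ρ ω -
      ((Real.exp (-v / 2) - (1 - v / 2) : ℝ) : ℂ) * Z ω := by
    intro ω
    have e1 : Complex.exp ((L ω + x ω : ℝ) * Complex.I) = Z ω * Complex.exp (x ω * Complex.I) := by
      rw [hZ, ← Complex.exp_add]; congr 1; push_cast; ring
    rw [e1, hρ]
    push_cast
    ring
  have i1 := (hZmul hxc).const_mul Complex.I
  have i2 := (hZmul hyc).const_mul (1 / 2)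
  have i3 := hZmul hρi
  have i4 : Integrable (fun ω => ((Real.exp (-v / 2) - (1 - v / 2) : ℝ) : ℂ) * Z ω) P := by
    have := (hZmul (integrable_const (1 : ℂ))).const_mul
      ((Real.exp (-v / 2) - (1 - v / 2) : ℝ) : ℂ)
    simpa using this
  have iZ : Integrable Z P := by simpa using hZmul (integrable_const (1 : ℂ))
  have iE : Integrable (fun ω => Complex.exp ((L ω + x ω : ℝ) * Complex.I)) P := by
    have := (((i1.sub i2).add i3).sub i4).add (iZ.const_mul (Real.exp (-v / 2) : ℂ))
    refine this.congr (Eventually.of_forall fun ω => ?_)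
    simp only [Pi.add_apply, Pi.sub_apply]
    rw [← hsplit, sub_add_cancel]
  have hint : ∫ ω, Complex.exp ((L ω + x ω : ℝ) * Complex.I) ∂P -
      (Real.exp (-v / 2) : ℂ) * ∫ ω, Z ω ∂P =
      Complex.I * ∫ ω, Z ω * (x ω : ℂ) ∂P - (1 / 2) * ∫ ω, Z ω * ((x ω ^ 2 - v : ℝ) : ℂ) ∂P +
      ∫ ω, Z ω * ρ ω ∂P - ((Real.exp (-v / 2) - (1 - v / 2) : ℝ) : ℂ) * ∫ ω, Z ω ∂P := by
    rw [← integral_const_mul, ← integral_sub iE (iZ.const_mul _)]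
    simp only [hsplit]
    rw [integral_sub (f := fun ω => Complex.I * (Z ω * (x ω : ℂ)) -
        (1 / 2) * (Z ω * ((x ω ^ 2 - v : ℝ) : ℂ)) + Z ω * ρ ω) ((i1.sub i2).add i3) i4,
      integral_add (f := fun ω => Complex.I * (Z ω * (x ω : ℂ)) -
        (1 / 2) * (Z ω * ((x ω ^ 2 - v : ℝ) : ℂ))) (i1.sub i2) i3, integral_sub i1 i2,
      integral_const_mul, integral_const_mul, integral_const_mul]
  rw [hint]
  -- the linear term vanishes
  have hre : Measurable[F k] fun ω => (Z ω).re := Complex.measurable_re.comp hZm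
  have him : Measurable[F k] fun ω => (Z ω).im := Complex.measurable_im.comp hZm
  have hreb : ∀ ω, |(Z ω).re| ≤ 1 := fun ω => (Complex.abs_re_le_norm _).trans (hZn ω).le
  have himb : ∀ ω, |(Z ω).im| ≤ 1 := fun ω => (Complex.abs_im_le_norm _).trans (hZn ω).le
  have hcen : ∀ Y : Ω → ℝ, Measurable[F k] Y → (∀ ω, |Y ω| ≤ 1) → ∫ ω, Y ω * x ω ∂P = 0 := by
    intro Y hY hYb
    have hYm : Measurable Y := hY.mono (F.le _) le_rfl
    have hY2 : MemLp Y 2 P := MemLp.of_bound hYm.aestronglyMeasurable 1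
      (Eventually.of_forall hYb)
    have e1 : ∀ ω, Y ω * x ω = ∑ i, β i * (Y ω * ε (k + 1) ω i) := by
      intro ω
      rw [hx]; simp only
      rw [inner_eq_sum, Finset.mul_sum]
      exact Finset.sum_congr rfl fun i _ => by ring
    simp only [e1]
    rw [integral_finsetSum]
    · refine Finset.sum_eq_zero fun i _ => ?_
      rw [integral_const_mul, h.center k Y hY hY2 i, mul_zero]
    · intro i _
      exact (hY2.integrable_mul (h.memLp_apply k i)).const_mul _
  have t1 : ∫ ω, Z ω * (x ω : ℂ) ∂P = 0 := by
    rw [← norm_le_zero_iff]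
    refine (norm_integral_mul_ofReal_le (hZmul hxc)).trans ?_
    rw [hcen _ hre hreb, hcen _ him himb]
    simp
  -- the quadratic term
  have hquad : ∀ Y : Ω → ℝ, Measurable[F k] Y → (∀ ω, |Y ω| ≤ 1) →
      |∫ ω, Y ω * (x ω ^ 2 - v) ∂P| ≤ (d : ℝ) ^ 2 * (‖β‖ ^ 2 * e (k + 1)) := by
    intro Y hY hYb
    have hYm : Measurable Y := hY.mono (F.le _) le_rfl
    have e1 : ∀ ω, Y ω * (x ω ^ 2 - v) =
        ∑ i, ∑ j, (β i * β j) * (Y ω * (ε (k + 1) ω i * ε (k + 1) ω j - Sig i j)) := by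
      intro ω
      have e2 : x ω ^ 2 - v = ∑ i, ∑ j, (β i * β j) *
          (ε (k + 1) ω i * ε (k + 1) ω j - Sig i j) := by
        rw [hx, hv, varForm]; simp only
        rw [inner_eq_sum, pow_two, Finset.sum_mul_sum, ← Finset.sum_sub_distrib]
        refine Finset.sum_congr rfl fun i _ => ?_
        rw [← Finset.sum_sub_distrib]
        exact Finset.sum_congr rfl fun j _ => by ring
      rw [e2, Finset.mul_sum]
      refine Finset.sum_congr rfl fun i _ => ?_
      rw [Finset.mul_sum]
      exact Finset.sum_congr rfl fun j _ => by ring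
    simp only [e1]
    have hi : ∀ i j, Integrable (fun ω => (β i * β j) *
        (Y ω * (ε (k + 1) ω i * ε (k + 1) ω j - Sig i j))) P := by
      intro i j
      refine Integrable.const_mul ?_ _
      refine Integrable.bdd_mul (c := 1) ?_ hYm.aestronglyMeasurable (Eventually.of_forall hYb)
      exact ((h.memLp_apply k i).integrable_mul (h.memLp_apply k j)).sub (integrable_const _)
    rw [integral_finsetSum _ fun i _ => integrable_finsetSum _ fun j _ => hi i j]
    refine (Finset.abs_sum_le_sum_abs _ _).trans ?_
    have hβ : ∀ i, |β i| ≤ ‖β‖ := fun i => PiLp.norm_apply_le β i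
    calc _ ≤ ∑ _i : Fin d, ∑ _j : Fin d, ‖β‖ ^ 2 * e (k + 1) := by
          refine Finset.sum_le_sum fun i _ => ?_
          rw [integral_finsetSum _ fun j _ => hi i j]
          refine (Finset.abs_sum_le_sum_abs _ _).trans (Finset.sum_le_sum fun j _ => ?_)
          rw [integral_const_mul, abs_mul, abs_mul, pow_two]
          have := h.cov k Y hY hYb i j
          gcongr
          · exact hβ i
          · exact hβ j
      _ = _ := by simp; ring
  have t2 : ‖(1 / 2 : ℂ) * ∫ ω, Z ω * ((x ω ^ 2 - v : ℝ) : ℂ) ∂P‖ ≤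
      (d : ℝ) ^ 2 * (‖β‖ ^ 2 * e (k + 1)) := by
    have := norm_integral_mul_ofReal_le (hZmul hyc)
    have h1 := hquad _ hre hreb
    have h2 := hquad _ him himb
    rw [norm_mul]
    have h3 : ‖(1 / 2 : ℂ)‖ = 1 / 2 := by norm_num
    rw [h3]
    linarith
  -- the Taylor remainder
  have t3 : ‖∫ ω, Z ω * ρ ω ∂P‖ ≤ 4 * C * ‖β‖ ^ q := by
    refine (norm_integral_le_integral_norm _).trans ?_
    have h1 : ∫ ω, ‖Z ω * ρ ω‖ ∂P ≤ ∫ ω, 4 * ‖β‖ ^ q * ‖ε (k + 1) ω‖ ^ q ∂P := by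
      refine integral_mono i3.norm ((h.integrable k).const_mul _) fun ω => ?_
      simp only [norm_mul, hZn, one_mul]
      refine (norm_cexp_sub_taylor_le h.two_lt.le h.le_three (x ω)).trans ?_
      have h2 : |x ω| ≤ ‖β‖ * ‖ε (k + 1) ω‖ := by
        rw [mul_comm]; exact abs_real_inner_le_norm _ _
      calc 4 * |x ω| ^ q ≤ 4 * (‖β‖ * ‖ε (k + 1) ω‖) ^ q := by gcongr
        _ = _ := by rw [Real.mul_rpow (norm_nonneg _) (norm_nonneg _)]; ring
    refine h1.trans ?_
    rw [integral_const_mul]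
    calc 4 * ‖β‖ ^ q * _ ≤ 4 * ‖β‖ ^ q * C := by gcongr; exact h.moment k
      _ = _ := by ring
  have t4 : ‖((Real.exp (-v / 2) - (1 - v / 2) : ℝ) : ℂ) * ∫ ω, Z ω ∂P‖ ≤ v ^ 2 := by
    rw [norm_mul, Complex.norm_real]
    have h1 : ‖∫ ω, Z ω ∂P‖ ≤ 1 := by
      refine (norm_integral_le_integral_norm _).trans ?_
      simp [hZn]
    calc _ ≤ v ^ 2 * 1 := by
          gcongr
          exact abs_exp_neg_sub_le hv0
      _ = _ := mul_one _
  rw [t1, mul_zero, zero_sub]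
  refine (norm_sub_le _ _).trans (add_le_add ((norm_add_le _ _).trans (add_le_add ?_ t3)) t4)
  rw [norm_neg]; exact t2

/-- The Gaussian factors are deterministic and at most 1, so replacing the increments one after the
other only adds the errors of the single steps. -/
theorem charFun_partial (h : IsNoise P F ε Sig q C e) (hSig : ∀ β, 0 ≤ varForm Sig β)
    (β : ℕ → EuclideanSpace ℝ (Fin d)) (N : ℕ) :
    ‖∫ ω, Complex.exp ((∑ k ∈ Finset.range N, inner ℝ (ε (k + 1) ω) (β (k + 1)) : ℝ) * Complex.I) ∂P -
      (Real.exp (-(∑ k ∈ Finset.range N, varForm Sig (β (k + 1))) / 2) : ℂ)‖ ≤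
      ∑ k ∈ Finset.range N, ((d : ℝ) ^ 2 * (‖β (k + 1)‖ ^ 2 * e (k + 1)) +
        4 * C * ‖β (k + 1)‖ ^ q + (varForm Sig (β (k + 1))) ^ 2) := by
  induction N with
  | zero => simp
  | succ N ih =>
    have hs := h.charFun_step hSig (β (N + 1)) N (h.measurable_partial β N)
    rw [Finset.sum_range_succ (fun k => varForm Sig (β (k + 1))), Finset.sum_range_succ (n := N)
      (f := fun k => ((d : ℝ) ^ 2 * (‖β (k + 1)‖ ^ 2 * e (k + 1)) +
        4 * C * ‖β (k + 1)‖ ^ q + (varForm Sig (β (k + 1))) ^ 2))]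
    simp only [Finset.sum_range_succ (fun k => inner ℝ (ε (k + 1) _) (β (k + 1)))]
    set I1 := ∫ ω, Complex.exp ((∑ k ∈ Finset.range N, inner ℝ (ε (k + 1) ω) (β (k + 1)) +
      inner ℝ (ε (N + 1) ω) (β (N + 1)) : ℝ) * Complex.I) ∂P
    set I0 := ∫ ω, Complex.exp ((∑ k ∈ Finset.range N, inner ℝ (ε (k + 1) ω) (β (k + 1)) : ℝ) *
      Complex.I) ∂P
    set v := varForm Sig (β (N + 1))
    set s := ∑ k ∈ Finset.range N, varForm Sig (β (k + 1))
    have e1 : I1 - (Real.exp (-(s + v) / 2) : ℂ) = (Real.exp (-v / 2) : ℂ) *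
        (I0 - (Real.exp (-s / 2) : ℂ)) + (I1 - (Real.exp (-v / 2) : ℂ) * I0) := by
      have : Real.exp (-(s + v) / 2) = Real.exp (-v / 2) * Real.exp (-s / 2) := by
        rw [← Real.exp_add]; congr 1; ring
      rw [this]; push_cast; ring
    rw [e1]
    refine (norm_add_le _ _).trans (add_le_add ?_ hs)
    rw [norm_mul, Complex.norm_real, Real.norm_of_nonneg (Real.exp_pos _).le]
    have h1 : Real.exp (-v / 2) ≤ 1 := Real.exp_le_one_iff.2 (by
      have : 0 ≤ v := hSig _
      linarith)
    exact (mul_le_of_le_one_left (norm_nonneg _) h1).trans ih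

end IsNoise

end RWSD

namespace RWSD

/-! ### Variance forms and the limit of the characteristic functions. -/

section CLT

open scoped Matrix.Norms.Frobenius

namespace IsNoise

theorem varForm_eq_dotProduct {d : ℕ} (Sig : Matrix (Fin d) (Fin d) ℝ)
    (β : EuclideanSpace ℝ (Fin d)) :
    varForm Sig β = WithLp.ofLp β ⬝ᵥ Sig *ᵥ WithLp.ofLp β := by
  simp only [varForm, dotProduct, Matrix.mulVec, Finset.mul_sum]
  refine Finset.sum_congr rfl fun i _ => Finset.sum_congr rfl fun j _ => ?_
  ring

theorem varForm_pos {d : ℕ} {Sig : Matrix (Fin d) (Fin d) ℝ} (hSig : Sig.PosDef)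
    {β : EuclideanSpace ℝ (Fin d)} (hβ : β ≠ 0) : 0 < varForm Sig β := by
  rw [varForm_eq_dotProduct]
  have h : WithLp.ofLp β ≠ 0 := fun h => hβ ((WithLp.ofLp_injective 2) h)
  simpa using hSig.dotProduct_mulVec_pos h

theorem varForm_nonneg {d : ℕ} {Sig : Matrix (Fin d) (Fin d) ℝ} (hSig : Sig.PosDef)
    (β : EuclideanSpace ℝ (Fin d)) : 0 ≤ varForm Sig β := by
  rcases eq_or_ne β 0 with rfl | h
  · simp [varForm]
  · exact (varForm_pos hSig h).le

theorem varForm_smul {d : ℕ} (Sig : Matrix (Fin d) (Fin d) ℝ) (t : ℝ)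
    (β : EuclideanSpace ℝ (Fin d)) : varForm Sig (t • β) = t ^ 2 * varForm Sig β := by
  simp only [varForm, Finset.mul_sum, PiLp.smul_apply, smul_eq_mul]
  refine Finset.sum_congr rfl fun i _ => Finset.sum_congr rfl fun j _ => ?_
  ring

/-- By compactness of the unit sphere and homogeneity. It lets the sum of the squared weights be
controlled by the sum of the variances. -/
theorem exists_varForm_lower {d : ℕ} {Sig : Matrix (Fin d) (Fin d) ℝ} (hSig : Sig.PosDef) :
    ∃ c : ℝ, 0 < c ∧ ∀ β, c * ‖β‖ ^ 2 ≤ varForm Sig β := by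
  have hcont : Continuous (varForm Sig) := by unfold varForm; fun_prop
  -- The sphere is empty when `d = 0`.
  rcases (Metric.sphere (0 : EuclideanSpace ℝ (Fin d)) 1).eq_empty_or_nonempty with h | h
  · refine ⟨1, one_pos, fun β => ?_⟩
    have : β = 0 := by
      by_contra hβ
      have : ‖β‖⁻¹ • β ∈ Metric.sphere (0 : EuclideanSpace ℝ (Fin d)) 1 := by
        simp [norm_smul, hβ]
      rw [h] at this
      exact this
    simp [this, varForm]
  · obtain ⟨x, hx, hmin⟩ := (isCompact_sphere (0 : EuclideanSpace ℝ (Fin d)) 1).exists_isMinOn h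
      hcont.continuousOn
    have hx0 : x ≠ 0 := by
      rintro rfl
      simp at hx
    refine ⟨varForm Sig x, varForm_pos hSig hx0, fun β => ?_⟩
    rcases eq_or_ne β 0 with rfl | hβ
    · simp [varForm]
    · have hmem : ‖β‖⁻¹ • β ∈ Metric.sphere (0 : EuclideanSpace ℝ (Fin d)) 1 := by
        simp [norm_smul, hβ]
      have h1 : varForm Sig x ≤ varForm Sig (‖β‖⁻¹ • β) := hmin hmem
      rw [varForm_smul] at h1
      have hn : 0 < ‖β‖ := norm_pos_iff.2 hβ
      calc varForm Sig x * ‖β‖ ^ 2 ≤ (‖β‖⁻¹ ^ 2 * varForm Sig β) * ‖β‖ ^ 2 := by gcongr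
        _ = _ := by field_simp

theorem varForm_le {d : ℕ} (Sig : Matrix (Fin d) (Fin d) ℝ) (β : EuclideanSpace ℝ (Fin d)) :
    varForm Sig β ≤ (∑ i, ∑ j, |Sig i j|) * ‖β‖ ^ 2 := by
  rw [varForm, Finset.sum_mul]
  refine Finset.sum_le_sum fun i _ => ?_
  rw [Finset.sum_mul]
  refine Finset.sum_le_sum fun j _ => ?_
  have hβ : ∀ i, |β i| ≤ ‖β‖ := fun i => PiLp.norm_apply_le β i
  calc β i * β j * Sig i j ≤ |β i * β j * Sig i j| := le_abs_self _
    _ = |Sig i j| * (|β i| * |β j|) := by rw [abs_mul, abs_mul]; ring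
    _ ≤ |Sig i j| * (‖β‖ * ‖β‖) := by gcongr <;> exact hβ _
    _ = _ := by ring

/-- A Toeplitz-type lemma for triangular arrays. -/
theorem tendsto_sum_mul_zero {w : ℕ → ℕ → ℝ} {N : ℕ → ℕ} {δ e : ℕ → ℝ} {M : ℝ}
    (hw : ∀ n k, 0 ≤ w n k) (hM : ∀ᶠ n in atTop, ∑ k ∈ Finset.range (N n), w n k ≤ M)
    (hδ : Tendsto δ atTop (𝓝 0)) (hwδ : ∀ᶠ n in atTop, ∀ k ∈ Finset.range (N n), w n k ≤ δ n)
    (he0 : ∀ k, 0 ≤ e k) (he : Tendsto e atTop (𝓝 0)) :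
    Tendsto (fun n => ∑ k ∈ Finset.range (N n), w n k * e k) atTop (𝓝 0) := by
  rw [Metric.tendsto_nhds]
  intro η hη
  have hM1 : 0 < |M| + 1 := by positivity
  obtain ⟨K0, hK0⟩ := eventually_atTop.1 (he.eventually (gt_mem_nhds
    (show 0 < η / 2 / (|M| + 1) by positivity)))
  have h1 : Tendsto (fun n => |δ n| * ∑ k ∈ Finset.range K0, e k) atTop (𝓝 0) := by
    have := (hδ.abs).mul_const (∑ k ∈ Finset.range K0, e k)
    simpa using this
  filter_upwards [hM, hwδ, h1.eventually (gt_mem_nhds (show 0 < η / 2 by positivity))] with n h2 h3 h4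
  rw [Real.dist_eq, sub_zero, abs_of_nonneg (Finset.sum_nonneg fun k _ => mul_nonneg (hw n k) (he0 k))]
  -- Finitely many early indices are handled by the uniform smallness of the weights, the late ones
  -- by the smallness of `e` and the bound on the total weight.
  have h5 : ∀ k ∈ Finset.range (N n), w n k * e k ≤
      (if k < K0 then |δ n| * e k else 0) + w n k * (η / 2 / (|M| + 1)) := by
    intro k hk
    split_ifs with hkK
    · have : w n k * e k ≤ |δ n| * e k :=
        mul_le_mul_of_nonneg_right ((h3 k hk).trans (le_abs_self _)) (he0 k)
      have h6 := mul_nonneg (hw n k) (show 0 ≤ η / 2 / (|M| + 1) by positivity)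
      linarith
    · rw [zero_add]
      exact mul_le_mul_of_nonneg_left (hK0 k (not_lt.1 hkK)).le (hw n k)
  calc _ ≤ ∑ k ∈ Finset.range (N n), ((if k < K0 then |δ n| * e k else 0) +
        w n k * (η / 2 / (|M| + 1))) := Finset.sum_le_sum h5
    _ = (∑ k ∈ Finset.range (N n), if k < K0 then |δ n| * e k else 0) +
        (∑ k ∈ Finset.range (N n), w n k) * (η / 2 / (|M| + 1)) := by
        rw [Finset.sum_add_distrib, Finset.sum_mul]
    _ ≤ |δ n| * (∑ k ∈ Finset.range K0, e k) + (|M| + 1) * (η / 2 / (|M| + 1)) := by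
        gcongr
        · rw [← Finset.sum_filter, Finset.mul_sum]
          refine Finset.sum_le_sum_of_subset_of_nonneg ?_ fun k _ _ =>
            mul_nonneg (abs_nonneg _) (he0 k)
          intro k hk
          rw [Finset.mem_filter] at hk
          exact Finset.mem_range.2 hk.2
        · exact h2.trans (by linarith [le_abs_self M])
    _ < η / 2 + η / 2 := by
        have : (|M| + 1) * (η / 2 / (|M| + 1)) = η / 2 := by field_simp
        rw [this]
        linarith
    _ = η := by ring

variable {Ω : Type*} {mΩ : MeasurableSpace Ω} {P : Measure Ω} {d : ℕ}
  {F : Filtration ℕ mΩ} {ε : ℕ → Ω → EuclideanSpace ℝ (Fin d)} {Sig : Matrix (Fin d) (Fin d) ℝ}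
  {q C : ℝ} {e : ℕ → ℝ}

/-- The squared weights have bounded sum and uniformly small terms, so the covariance errors vanish
by the Toeplitz lemma, and the sums of ‖β‖^q and of squared variances vanish because a small factor
splits off each term. -/
theorem tendsto_charFun_partial [IsProbabilityMeasure P] (h : IsNoise P F ε Sig q C e)
    (hSig : Sig.PosDef) (β : ℕ → ℕ → EuclideanSpace ℝ (Fin d)) (N : ℕ → ℕ) {δ : ℕ → ℝ}
    (hδ : Tendsto δ atTop (𝓝 0))
    (hβ : ∀ᶠ n in atTop, ∀ k ∈ Finset.range (N n), ‖β n (k + 1)‖ ≤ δ n) {v : ℝ}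
    (hv : Tendsto (fun n => ∑ k ∈ Finset.range (N n), varForm Sig (β n (k + 1))) atTop (𝓝 v)) :
    Tendsto (fun n => ∫ ω, Complex.exp ((∑ k ∈ Finset.range (N n),
      inner ℝ (ε (k + 1) ω) (β n (k + 1)) : ℝ) * Complex.I) ∂P) atTop
      (𝓝 (Real.exp (-v / 2) : ℂ)) := by
  obtain ⟨c, hc, hlow⟩ := exists_varForm_lower hSig
  set K := ∑ i, ∑ j, |Sig i j|
  have hK : 0 ≤ K := Finset.sum_nonneg fun _ _ => Finset.sum_nonneg fun _ _ => abs_nonneg _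
  have hq2 := h.two_lt
  have hδ2 : Tendsto (fun n => δ n ^ 2) atTop (𝓝 0) := by simpa using hδ.pow 2
  have hM : ∀ᶠ n in atTop, ∑ k ∈ Finset.range (N n), ‖β n (k + 1)‖ ^ 2 ≤ c⁻¹ * (v + 1) := by
    filter_upwards [hv.eventually (gt_mem_nhds (show v < v + 1 by linarith))] with n hn
    rw [inv_mul_eq_div, le_div_iff₀ hc, Finset.sum_mul]
    refine le_trans (Finset.sum_le_sum fun k _ => ?_) hn.le
    rw [mul_comm]; exact hlow _
  have hwδ : ∀ᶠ n in atTop, ∀ k ∈ Finset.range (N n), ‖β n (k + 1)‖ ^ 2 ≤ δ n ^ 2 := by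
    filter_upwards [hβ] with n hn k hk
    gcongr; exact hn k hk
  -- the error terms
  have e1 := tendsto_sum_mul_zero (w := fun n k => ‖β n (k + 1)‖ ^ 2) (fun _ _ => by positivity)
    hM hδ2 hwδ (fun k => h.err_nonneg (k + 1)) (h.err_tendsto.comp (tendsto_add_atTop_nat 1))
  have e2 : Tendsto (fun n => ∑ k ∈ Finset.range (N n), ‖β n (k + 1)‖ ^ q) atTop (𝓝 0) := by
    have h1 : Tendsto (fun n => |δ n| ^ (q - 2) * (c⁻¹ * (v + 1))) atTop (𝓝 0) := by
      have h2 := (hδ.abs).rpow_const (p := q - 2) (Or.inr (by linarith))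
      rw [abs_zero, Real.zero_rpow (by linarith)] at h2
      simpa using h2.mul_const (c⁻¹ * (v + 1))
    refine squeeze_zero' (Eventually.of_forall fun n => Finset.sum_nonneg fun k _ => by positivity)
      ?_ h1
    filter_upwards [hM, hβ] with n hn hn2
    calc _ ≤ ∑ k ∈ Finset.range (N n), |δ n| ^ (q - 2) * ‖β n (k + 1)‖ ^ 2 := by
          refine Finset.sum_le_sum fun k hk => ?_
          have h3 : ‖β n (k + 1)‖ ^ q = ‖β n (k + 1)‖ ^ (q - 2) * ‖β n (k + 1)‖ ^ 2 := by
            rcases eq_or_lt_of_le (norm_nonneg (β n (k + 1))) with h0 | h0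
            · rw [← h0, Real.zero_rpow (by linarith)]; simp
            · rw [← Real.rpow_natCast, ← Real.rpow_add h0]; norm_num
          rw [h3]
          gcongr
          exact (hn2 k hk).trans (le_abs_self _)
      _ ≤ _ := by
          rw [← Finset.mul_sum]
          gcongr
  have e3 : Tendsto (fun n => ∑ k ∈ Finset.range (N n), (varForm Sig (β n (k + 1))) ^ 2) atTop
      (𝓝 0) := by
    have h1 : Tendsto (fun n => K ^ 2 * (δ n ^ 2 * (c⁻¹ * (v + 1)))) atTop (𝓝 0) := by
      simpa using (hδ2.mul_const (c⁻¹ * (v + 1))).const_mul (K ^ 2)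
    refine squeeze_zero' (Eventually.of_forall fun n => Finset.sum_nonneg fun k _ => by positivity)
      ?_ h1
    filter_upwards [hM, hwδ] with n hn hn2
    calc _ ≤ ∑ k ∈ Finset.range (N n), K ^ 2 * (δ n ^ 2 * ‖β n (k + 1)‖ ^ 2) := by
          refine Finset.sum_le_sum fun k hk => ?_
          calc _ ≤ (K * ‖β n (k + 1)‖ ^ 2) ^ 2 := by
                gcongr
                · exact varForm_nonneg hSig _
                · exact varForm_le _ _
            _ = K ^ 2 * (‖β n (k + 1)‖ ^ 2 * ‖β n (k + 1)‖ ^ 2) := by ring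
            _ ≤ _ := mul_le_mul_of_nonneg_left
                (mul_le_mul_of_nonneg_right (hn2 k hk) (by positivity)) (by positivity)
      _ ≤ _ := by
          rw [← Finset.mul_sum, ← Finset.mul_sum]
          gcongr
  have herr : Tendsto (fun n => ∑ k ∈ Finset.range (N n),
      ((d : ℝ) ^ 2 * (‖β n (k + 1)‖ ^ 2 * e (k + 1)) + 4 * C * ‖β n (k + 1)‖ ^ q +
        (varForm Sig (β n (k + 1))) ^ 2)) atTop (𝓝 0) := by
    have := ((e1.const_mul ((d : ℝ) ^ 2)).add (e2.const_mul (4 * C))).add e3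
    simp only [mul_zero, add_zero] at this
    refine this.congr fun n => ?_
    simp only [Finset.sum_add_distrib, Finset.mul_sum]
  have hdiff := squeeze_zero_norm
    (fun n => h.charFun_partial (varForm_nonneg hSig) (β n) (N n)) herr
  have hlim : Tendsto (fun n => (Real.exp (-(∑ k ∈ Finset.range (N n),
      varForm Sig (β n (k + 1))) / 2) : ℂ)) atTop (𝓝 (Real.exp (-v / 2) : ℂ)) := by
    have := (Complex.continuous_ofReal.comp (Real.continuous_exp.comp
      (continuous_neg.div_const 2))).tendsto v
    exact this.comp hv
  have := hdiff.add hlim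
  simpa using this

theorem sum_Ioc_eq_sum_range {M : Type*} [AddCommMonoid M] (f : ℕ → M) (N : ℕ) :
    ∑ k ∈ Finset.Ioc 0 N, f k = ∑ k ∈ Finset.range N, f (k + 1) := by
  induction N with
  | zero => simp
  | succ N ih =>
    rw [Finset.sum_range_succ, ← ih, ← Finset.insert_Ioc_right_eq_Ioc_add_one (Nat.zero_le N),
      Finset.sum_insert (by simp), add_comm]


end IsNoise

end CLT

/-- Realizes the limit as the identity under its own law, the form in which the limit law is stated.
-/
theorem _root_.MeasureTheory.TendstoInDistribution.exists_probabilityMeasure {Ω Ω' E : Type*}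
    {mΩ : MeasurableSpace Ω} {P : Measure Ω} [IsProbabilityMeasure P] {mΩ' : MeasurableSpace Ω'}
    {μ : Measure Ω'} [IsProbabilityMeasure μ] [TopologicalSpace E] [MeasurableSpace E]
    [OpensMeasurableSpace E] {Y : ℕ → Ω → E} {g : Ω' → E}
    (h : TendstoInDistribution Y atTop g (fun _ => P) μ) :
    ∃ ν : ProbabilityMeasure E, (ν : Measure E) = μ.map g ∧
      TendstoInDistribution Y atTop id (fun _ => P) (ν : Measure E) := by
  obtain ⟨ν, hν⟩ : ∃ ν : ProbabilityMeasure E, (ν : Measure E) = μ.map g :=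
    ⟨⟨μ.map g, Measure.isProbabilityMeasure_map h.aemeasurable_limit⟩, rfl⟩
  refine ⟨ν, hν, ⟨h.forall_aemeasurable, aemeasurable_id, ?_⟩⟩
  convert h.tendsto using 2
  refine congrArg 𝓝 (Subtype.ext ?_)
  simp [Measure.map_id, hν]

/-! ### Vector-valued central limit theorems, real and complex. -/

section VectorCLT

open scoped Matrix.Norms.Frobenius

theorem inner_actRect {κ : Type*} [Fintype κ] {d : ℕ} (M : Matrix κ (Fin d) ℝ)
    (x : EuclideanSpace ℝ (Fin d)) (t : EuclideanSpace ℝ κ) :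
    inner ℝ (actRect M x) t = inner ℝ x (WithLp.toLp 2 (Mᵀ *ᵥ WithLp.ofLp t)) := by
  simp only [EuclideanSpace.inner_eq_star_dotProduct, actRect, star_trivial]
  rw [Matrix.mulVec_transpose, Matrix.dotProduct_mulVec]

theorem norm_transpose_mulVec_le {κ : Type*} [Fintype κ] {d : ℕ} (M : Matrix κ (Fin d) ℝ)
    (t : EuclideanSpace ℝ κ) :
    ‖(WithLp.toLp 2 (Mᵀ *ᵥ WithLp.ofLp t) : EuclideanSpace ℝ (Fin d))‖ ≤ ‖M‖ * ‖t‖ := by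
  have h := Matrix.frobenius_norm_mul Mᵀ (Matrix.replicateCol Unit (WithLp.ofLp t))
  rw [← Matrix.replicateCol_mulVec, Matrix.frobenius_norm_replicateCol,
    Matrix.frobenius_norm_replicateCol, Matrix.frobenius_norm_transpose] at h
  exact h

theorem varForm_transpose_mulVec {κ : Type*} [Fintype κ] {d : ℕ}
    (Sig : Matrix (Fin d) (Fin d) ℝ) (M : Matrix κ (Fin d) ℝ) (t : κ → ℝ) :
    IsNoise.varForm Sig (WithLp.toLp 2 (Mᵀ *ᵥ t)) = t ⬝ᵥ (M * Sig * Mᵀ) *ᵥ t := by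
  rw [IsNoise.varForm_eq_dotProduct]
  change (Mᵀ *ᵥ t) ⬝ᵥ Sig *ᵥ (Mᵀ *ᵥ t) = _
  rw [Matrix.mulVec_mulVec, Matrix.mulVec_transpose, ← Matrix.dotProduct_mulVec,
    Matrix.mulVec_mulVec, Matrix.mul_assoc]

theorem continuous_actRect {𝕜 κ : Type*} [RCLike 𝕜] [Fintype κ] {d : ℕ} (M : Matrix κ (Fin d) 𝕜) :
    Continuous (actRect M) := by
  unfold actRect
  fun_prop

theorem continuous_vecC {d : ℕ} : Continuous (vecC : EuclideanSpace ℝ (Fin d) → _) := by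
  unfold vecC
  fun_prop

variable {Ω : Type*} {mΩ : MeasurableSpace Ω} {P : Measure Ω} {d : ℕ}
  {F : Filtration ℕ mΩ} {ε : ℕ → Ω → EuclideanSpace ℝ (Fin d)} {Sig : Matrix (Fin d) (Fin d) ℝ}
  {q C : ℝ} {e : ℕ → ℝ}

/-- Each b Σ bᵀ is positive semidefinite, and this property is preserved by sums and limits. -/
theorem posSemidef_of_tendsto_sum {κ : Type*} [Fintype κ] [DecidableEq κ] (hSig : Sig.PosDef)
    (b : ℕ → ℕ → Matrix κ (Fin d) ℝ) (N : ℕ → ℕ) {S : Matrix κ κ ℝ}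
    (hS : Tendsto (fun n => ∑ k ∈ Finset.Ioc 0 (N n), b n k * Sig * (b n k)ᵀ) atTop (𝓝 S)) :
    S.PosSemidef := by
  rw [Matrix.posSemidef_iff_dotProduct_mulVec]
  have hpos : ∀ n, (∑ k ∈ Finset.Ioc 0 (N n), b n k * Sig * (b n k)ᵀ).PosSemidef := by
    intro n
    refine Matrix.posSemidef_sum _ fun k _ => ?_
    have := hSig.posSemidef.mul_mul_conjTranspose_same (b n k)
    rwa [Matrix.conjTranspose_eq_transpose_of_trivial] at this
  constructor
  · have h1 := (Continuous.matrix_conjTranspose (continuous_id (X := Matrix κ κ ℝ))).tendsto S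
    refine tendsto_nhds_unique (h1.comp hS) ?_
    refine hS.congr fun n => ?_
    exact (hpos n).1.symm
  · intro x
    have h1 : Continuous fun M : Matrix κ κ ℝ => star x ⬝ᵥ M *ᵥ x := by fun_prop
    exact ge_of_tendsto' ((h1.tendsto S).comp hS) fun n => (hpos n).dotProduct_mulVec_nonneg x

theorem IsNoise.measurable_sum_actRect {𝕜 κ : Type*} [RCLike 𝕜] [Fintype κ]
    (h : IsNoise P F ε Sig q C e)
    {f : EuclideanSpace ℝ (Fin d) → EuclideanSpace 𝕜 (Fin d)} (hf : Continuous f)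
    (b : ℕ → Matrix κ (Fin d) 𝕜) (N : ℕ) :
    Measurable fun ω => ∑ k ∈ Finset.Ioc 0 N, actRect (b k) (f (ε k ω)) := by
  refine Finset.measurable_sum _ fun k hk => ?_
  obtain ⟨j, rfl⟩ : ∃ j, k = j + 1 := ⟨k - 1, by have := Finset.mem_Ioc.1 hk; omega⟩
  exact ((continuous_actRect _).comp hf).measurable.comp ((h.measurable j).mono (F.le _) le_rfl)

/-- A central limit theorem for weighted sums of martingale differences. -/
theorem IsNoise.tendstoInDistribution [IsProbabilityMeasure P] {κ : Type*} [Fintype κ]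
    [DecidableEq κ] (h : IsNoise P F ε Sig q C e)
    (hSig : Sig.PosDef) (b : ℕ → ℕ → Matrix κ (Fin d) ℝ) (N : ℕ → ℕ) {δ : ℕ → ℝ}
    (hδ : Tendsto δ atTop (𝓝 0))
    (hb : ∀ᶠ n in atTop, ∀ k ∈ Finset.Ioc 0 (N n), ‖b n k‖ ≤ δ n) {S : Matrix κ κ ℝ}
    (hS : Tendsto (fun n => ∑ k ∈ Finset.Ioc 0 (N n), b n k * Sig * (b n k)ᵀ) atTop (𝓝 S)) :
    TendstoInDistribution (fun (n : ℕ) ω => ∑ k ∈ Finset.Ioc 0 (N n), actRect (b n k) (ε k ω))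
      atTop id (fun _ => P) (multivariateGaussian 0 S) := by
  have hpsd := posSemidef_of_tendsto_sum hSig b N hS
  have hm : ∀ n, Measurable fun ω => ∑ k ∈ Finset.Ioc 0 (N n), actRect (b n k) (ε k ω) :=
    fun n => h.measurable_sum_actRect continuous_id (b n) (N n)
  refine ⟨fun n => (hm n).aemeasurable, aemeasurable_id, ?_⟩
  refine ProbabilityMeasure.tendsto_iff_tendsto_charFun.2 fun t => ?_
  have hlim : charFun ((multivariateGaussian 0 S).map id) t =
      (Real.exp (-(WithLp.ofLp t ⬝ᵥ S *ᵥ WithLp.ofLp t) / 2) : ℂ) := by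
    rw [Measure.map_id, charFun_multivariateGaussian hpsd]
    simp [neg_div]
  simp only [ProbabilityMeasure.coe_mk]
  rw [hlim]
  -- Cramér–Wold: pairing with `t` moves the matrix weights to vector weights bᵀ t, whose variances
  -- are the quadratic form of b Σ bᵀ at `t`.
  have key := h.tendsto_charFun_partial hSig
    (fun n k => WithLp.toLp 2 ((b n k)ᵀ *ᵥ WithLp.ofLp t)) N (δ := fun n => δ n * ‖t‖)
    (by simpa using hδ.mul_const ‖t‖) ?_ (v := WithLp.ofLp t ⬝ᵥ S *ᵥ WithLp.ofLp t) ?_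
  · refine key.congr fun n => ?_
    rw [charFun_apply, integral_map (hm n).aemeasurable (by fun_prop)]
    refine integral_congr_ae (.of_forall fun ω => ?_)
    beta_reduce
    rw [sum_inner, IsNoise.sum_Ioc_eq_sum_range]
    simp only [inner_actRect]
  · filter_upwards [hb] with n hn k hk
    refine (norm_transpose_mulVec_le _ _).trans ?_
    gcongr
    exact hn (k + 1) (Finset.mem_Ioc.2 ⟨k.succ_pos, Finset.mem_range.1 hk⟩)
  · have h1 : Continuous fun M : Matrix κ κ ℝ => WithLp.ofLp t ⬝ᵥ M *ᵥ WithLp.ofLp t := by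
      fun_prop
    refine ((h1.tendsto S).comp hS).congr fun n => ?_
    simp only [varForm_transpose_mulVec]
    rw [← IsNoise.sum_Ioc_eq_sum_range
      (fun k => WithLp.ofLp t ⬝ᵥ (b n k * Sig * (b n k)ᵀ) *ᵥ WithLp.ofLp t)]
    simp only [Function.comp, Matrix.sum_mulVec, dotProduct_sum]

/-- The complex vector with prescribed real and imaginary parts, as a continuous linear map. -/
noncomputable def ofReIm (ι : Type*) [Fintype ι] :
    EuclideanSpace ℝ (ι ⊕ ι) →L[ℝ] EuclideanSpace ℂ ι :=
  LinearMap.toContinuousLinearMap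
    { toFun := fun v => WithLp.toLp 2 fun i => (v (Sum.inl i) : ℂ) + v (Sum.inr i) * Complex.I
      map_add' := fun u v => by ext i; simp; ring
      map_smul' := fun c v => by ext i; simp; ring }

theorem ofReIm_apply {ι : Type*} [Fintype ι] (v : EuclideanSpace ℝ (ι ⊕ ι)) (i : ι) :
    ofReIm ι v i = (v (Sum.inl i) : ℂ) + v (Sum.inr i) * Complex.I := rfl

/-- The covariance of the real and imaginary parts of a complex vector with covariance `Gam` and
pseudo-covariance `C`. -/
noncomputable def reImCov {ι : Type*} (Gam C : Matrix ι ι ℂ) : Matrix (ι ⊕ ι) (ι ⊕ ι) ℝ :=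
  Matrix.fromBlocks (Matrix.of fun i j => (Gam i j + C i j).re / 2)
    (Matrix.of fun i j => (C i j - Gam i j).im / 2)
    (Matrix.of fun i j => (C i j + Gam i j).im / 2)
    (Matrix.of fun i j => (Gam i j - C i j).re / 2)

theorem tendsto_reImCov {ι α : Type*} {l : Filter α} {f g : α → Matrix ι ι ℂ} {Gam C : Matrix ι ι ℂ}
    (hf : Tendsto f l (𝓝 Gam)) (hg : Tendsto g l (𝓝 C)) :
    Tendsto (fun x => reImCov (f x) (g x)) l (𝓝 (reImCov Gam C)) := by
  refine tendsto_pi_nhds.2 fun a => tendsto_pi_nhds.2 fun b => ?_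
  have hf' := fun i j => tendsto_pi_nhds.1 (tendsto_pi_nhds.1 hf i) j
  have hg' := fun i j => tendsto_pi_nhds.1 (tendsto_pi_nhds.1 hg i) j
  have hre := fun z : ℂ => Complex.continuous_re.tendsto z
  have him := fun z : ℂ => Complex.continuous_im.tendsto z
  rcases a with i | i <;> rcases b with j | j
  · exact ((hre _).comp ((hf' i j).add (hg' i j))).div_const 2
  · exact ((him _).comp ((hg' i j).sub (hf' i j))).div_const 2
  · exact ((him _).comp ((hg' i j).add (hf' i j))).div_const 2
  · exact ((hre _).comp ((hf' i j).sub (hg' i j))).div_const 2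

theorem reImCov_sum {ι : Type*} {κ : Type*} (s : Finset κ) (Gam C : κ → Matrix ι ι ℂ) :
    ∑ k ∈ s, reImCov (Gam k) (C k) = reImCov (∑ k ∈ s, Gam k) (∑ k ∈ s, C k) := by
  ext (i | i) (j | j) <;>
  simp [reImCov, Matrix.sum_apply, ← Finset.sum_div, Finset.sum_add_distrib, Finset.sum_sub_distrib]

/-- Real and imaginary parts of the rows of a complex matrix. -/
noncomputable def reImRows {ι κ : Type*} (c : Matrix ι κ ℂ) : Matrix (ι ⊕ ι) κ ℝ :=
  Matrix.fromRows (c.map Complex.re) (c.map Complex.im)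

/-- Polarization: products of real and imaginary parts are combinations of z w̄ and z w. Hence the
limits of both complex sums determine the real covariance of the doubled vector. -/
theorem reImRows_mul_mul {ι : Type*} (c : Matrix ι (Fin d) ℂ) (Sig : Matrix (Fin d) (Fin d) ℝ) :
    reImRows c * Sig * (reImRows c)ᵀ =
      reImCov (c * toC Sig * cᴴ) (c * toC Sig * cᵀ) := by
  ext (i | i) (j | j) <;>
  · simp only [reImRows, reImCov, toC, Matrix.mul_apply, Matrix.transpose_apply,
      Matrix.fromRows_apply_inl, Matrix.fromRows_apply_inr, Matrix.map_apply, Matrix.of_apply,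
      Matrix.fromBlocks_apply₁₁, Matrix.fromBlocks_apply₁₂, Matrix.fromBlocks_apply₂₁,
      Matrix.fromBlocks_apply₂₂, Matrix.conjTranspose_apply, ← Finset.sum_add_distrib,
      ← Finset.sum_sub_distrib, Finset.sum_mul, Complex.re_sum, Complex.im_sum, Finset.sum_div]
    refine Finset.sum_congr rfl fun k _ => ?_
    refine Finset.sum_congr rfl fun l _ => ?_
    simp <;> ring

theorem norm_reImRows_le {ι κ : Type*} [Fintype ι] [Fintype κ] (c : Matrix ι κ ℂ) :
    ‖reImRows c‖ ≤ ‖c‖ := by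
  rw [Matrix.frobenius_norm_def, Matrix.frobenius_norm_def]
  refine Real.rpow_le_rpow (by positivity) (le_of_eq ?_) (by norm_num)
  simp only [Fintype.sum_sum_type, reImRows, Matrix.fromRows_apply_inl, Matrix.fromRows_apply_inr,
    Matrix.map_apply, ← Finset.sum_add_distrib]
  refine Finset.sum_congr rfl fun i _ => Finset.sum_congr rfl fun j _ => ?_
  rw [Real.rpow_ofNat, Real.rpow_ofNat, Real.rpow_ofNat, ← Complex.normSq_eq_norm_sq,
    Complex.normSq_apply]
  simp [sq]

theorem ofReIm_actRect {ι : Type*} [Fintype ι] (c : Matrix ι (Fin d) ℂ)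
    (x : EuclideanSpace ℝ (Fin d)) : ofReIm ι (actRect (reImRows c) x) = actRect c (vecC x) := by
  ext i
  rw [ofReIm_apply]
  simp only [actRect, reImRows, vecC, Matrix.mulVec, dotProduct, Matrix.fromRows_apply_inl,
    Matrix.fromRows_apply_inr, Matrix.map_apply, Complex.ofReal_sum, Finset.sum_mul,
    ← Finset.sum_add_distrib]
  refine Finset.sum_congr rfl fun j _ => ?_
  conv_rhs => rw [← Complex.re_add_im (c i j)]
  push_cast
  ring

/-- The law is the linear image of a real Gaussian; expanding z_i z̄_j and z_i z_j in real
coordinates inverts the formulas for the blocks of `reImCov`. -/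
theorem isCentredComplexGaussian_map {ι : Type*} [Fintype ι] [DecidableEq ι] {Gam C : Matrix ι ι ℂ}
    (hS : (reImCov Gam C).PosSemidef) :
    IsCentredComplexGaussian ((multivariateGaussian 0 (reImCov Gam C)).map (ofReIm ι)) Gam C := by
  set μ := multivariateGaussian 0 (reImCov Gam C) with hμ
  have hL : ∀ a, MemLp (fun v : EuclideanSpace ℝ (ι ⊕ ι) => v a) 2 μ := by
    intro a
    have := IsGaussian.memLp_dual μ (EuclideanSpace.proj a) 2 (by norm_num)
    exact this
  have hmean : ∀ a, ∫ v : EuclideanSpace ℝ (ι ⊕ ι), v a ∂μ = 0 := by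
    intro a
    have h1 := (EuclideanSpace.proj (𝕜 := ℝ) a : EuclideanSpace ℝ (ι ⊕ ι) →L[ℝ] ℝ).integral_comp_id_comm
      (μ := μ) IsGaussian.integrable_id
    rw [integral_id_multivariateGaussian] at h1
    simpa using h1
  have hcov : ∀ a b, ∫ v : EuclideanSpace ℝ (ι ⊕ ι), v a * v b ∂μ = reImCov Gam C a b := by
    intro a b
    have h1 := covariance_eval_multivariateGaussian (μ := 0) hS a b
    rw [covariance_eq_sub (hL a) (hL b), hmean a] at h1
    simpa using h1
  have hint : ∀ a b, Integrable (fun v : EuclideanSpace ℝ (ι ⊕ ι) => ((v a * v b : ℝ) : ℂ)) μ :=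
    fun a b => ((hL a).integrable_mul (hL b)).ofReal
  have hcovC : ∀ a b, ∫ v : EuclideanSpace ℝ (ι ⊕ ι), ((v a * v b : ℝ) : ℂ) ∂μ =
      (reImCov Gam C a b : ℂ) := fun a b => by rw [← hcov a b]; exact integral_ofReal
  have hm := (ofReIm ι).continuous.measurable
  refine ⟨isGaussian_map _, ?_, fun i j => ?_, fun i j => ?_⟩
  · rw [ContinuousLinearMap.integral_id_map, integral_id_multivariateGaussian, map_zero]
    exact IsGaussian.integrable_id
  · rw [integral_map hm.aemeasurable (by fun_prop)]
    have e : ∀ v : EuclideanSpace ℝ (ι ⊕ ι), ofReIm ι v i * (starRingEnd ℂ) (ofReIm ι v j) =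
        ((v (.inl i) * v (.inl j) : ℝ) : ℂ) + ((v (.inr i) * v (.inr j) : ℝ) : ℂ) +
        Complex.I * (((v (.inr i) * v (.inl j) : ℝ) : ℂ) - ((v (.inl i) * v (.inr j) : ℝ) : ℂ)) := by
      intro v
      rw [ofReIm_apply, ofReIm_apply]
      apply Complex.ext <;> simp <;> ring
    simp only [e]
    rw [integral_add (f := fun v : EuclideanSpace ℝ (ι ⊕ ι) =>
      ((v (.inl i) * v (.inl j) : ℝ) : ℂ) + ((v (.inr i) * v (.inr j) : ℝ) : ℂ))
      (g := fun v : EuclideanSpace ℝ (ι ⊕ ι) => Complex.I * (((v (.inr i) * v (.inl j) : ℝ) : ℂ) -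
        ((v (.inl i) * v (.inr j) : ℝ) : ℂ))) ((hint _ _).add (hint _ _))
      (((hint _ _).sub (hint _ _)).const_mul _), integral_add (hint _ _) (hint _ _),
      integral_const_mul, integral_sub (hint _ _) (hint _ _), hcovC, hcovC, hcovC, hcovC]
    apply Complex.ext <;> simp [reImCov] <;> ring
  · rw [integral_map hm.aemeasurable (by fun_prop)]
    have e : ∀ v : EuclideanSpace ℝ (ι ⊕ ι), ofReIm ι v i * ofReIm ι v j =
        ((v (.inl i) * v (.inl j) : ℝ) : ℂ) - ((v (.inr i) * v (.inr j) : ℝ) : ℂ) +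
        Complex.I * (((v (.inr i) * v (.inl j) : ℝ) : ℂ) + ((v (.inl i) * v (.inr j) : ℝ) : ℂ)) := by
      intro v
      rw [ofReIm_apply, ofReIm_apply]
      apply Complex.ext <;> simp <;> ring
    simp only [e]
    rw [integral_add (f := fun v : EuclideanSpace ℝ (ι ⊕ ι) =>
      ((v (.inl i) * v (.inl j) : ℝ) : ℂ) - ((v (.inr i) * v (.inr j) : ℝ) : ℂ))
      (g := fun v : EuclideanSpace ℝ (ι ⊕ ι) => Complex.I * (((v (.inr i) * v (.inl j) : ℝ) : ℂ) +
        ((v (.inl i) * v (.inr j) : ℝ) : ℂ))) ((hint _ _).sub (hint _ _))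
      (((hint _ _).add (hint _ _)).const_mul _), integral_sub (hint _ _) (hint _ _),
      integral_const_mul, integral_add (hint _ _) (hint _ _), hcovC, hcovC, hcovC, hcovC]
    apply Complex.ext <;> simp [reImCov] <;> ring

/-- A central limit theorem for complex weighted sums of real martingale differences. -/
theorem IsNoise.exists_tendstoInDistribution_complex [IsProbabilityMeasure P] {ι : Type*}
    [Fintype ι] [DecidableEq ι] (h : IsNoise P F ε Sig q C e)
    (hSig : Sig.PosDef) (c : ℕ → ℕ → Matrix ι (Fin d) ℂ) (N : ℕ → ℕ) {δ : ℕ → ℝ}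
    (hδ : Tendsto δ atTop (𝓝 0))
    (hc : ∀ᶠ n in atTop, ∀ k ∈ Finset.Ioc 0 (N n), ‖c n k‖ ≤ δ n) {Gam C : Matrix ι ι ℂ}
    (hGam : Tendsto (fun n => ∑ k ∈ Finset.Ioc 0 (N n), c n k * toC Sig * (c n k)ᴴ) atTop (𝓝 Gam))
    (hC : Tendsto (fun n => ∑ k ∈ Finset.Ioc 0 (N n), c n k * toC Sig * (c n k)ᵀ) atTop (𝓝 C)) :
    ∃ ν : ProbabilityMeasure (EuclideanSpace ℂ ι),
      IsCentredComplexGaussian (ν : Measure (EuclideanSpace ℂ ι)) Gam C ∧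
      TendstoInDistribution
        (fun (n : ℕ) ω => ∑ k ∈ Finset.Ioc 0 (N n), actRect (c n k) (vecC (ε k ω)))
        atTop id (fun _ => P) (ν : Measure (EuclideanSpace ℂ ι)) := by
  have hS : Tendsto (fun n => ∑ k ∈ Finset.Ioc 0 (N n),
      reImRows (c n k) * Sig * (reImRows (c n k))ᵀ) atTop (𝓝 (reImCov Gam C)) := by
    simp only [reImRows_mul_mul, reImCov_sum]
    exact tendsto_reImCov hGam hC
  have hpsd := posSemidef_of_tendsto_sum hSig (fun n k => reImRows (c n k)) N hS
  have hlim := h.tendstoInDistribution hSig (fun n k => reImRows (c n k)) N hδ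
    (hc.mono fun n hn k hk => (norm_reImRows_le _).trans (hn k hk)) hS
  have hlim2 := hlim.continuous_comp (ofReIm ι).continuous
  obtain ⟨ν, hν, hT⟩ := hlim2.exists_probabilityMeasure
  refine ⟨ν, ?_, ?_⟩
  · rw [hν, Function.comp_id]
    exact isCentredComplexGaussian_map hpsd
  · convert hT using 3
    simp only [Function.comp, map_sum, ofReIm_actRect]

end VectorCLT

/-! ### Orthogonality of martingale differences, and variation of constants. -/

section MartingaleDifferences

open scoped Matrix.Norms.Frobenius

section Act

variable {𝕜 : Type*} [RCLike 𝕜] {d : ℕ}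

theorem act_add (M : Matrix (Fin d) (Fin d) 𝕜) (v w : EuclideanSpace 𝕜 (Fin d)) :
    act M (v + w) = act M v + act M w := by
  simp only [act, WithLp.ofLp_add, Matrix.mulVec_add, WithLp.toLp_add]

theorem act_sub (M : Matrix (Fin d) (Fin d) 𝕜) (v w : EuclideanSpace 𝕜 (Fin d)) :
    act M (v - w) = act M v - act M w := by
  simp only [act, WithLp.ofLp_sub, Matrix.mulVec_sub, WithLp.toLp_sub]

theorem smul_act (M : Matrix (Fin d) (Fin d) 𝕜) (c : 𝕜) (v : EuclideanSpace 𝕜 (Fin d)) :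
    act (c • M) v = c • act M v := by
  simp only [act, Matrix.smul_mulVec, WithLp.toLp_smul]

theorem add_act (M N : Matrix (Fin d) (Fin d) 𝕜) (v : EuclideanSpace 𝕜 (Fin d)) :
    act (M + N) v = act M v + act N v := by
  simp only [act, Matrix.add_mulVec, WithLp.toLp_add]

theorem mul_act (M N : Matrix (Fin d) (Fin d) 𝕜) (v : EuclideanSpace 𝕜 (Fin d)) :
    act (M * N) v = act M (act N v) := by
  simp only [act, Matrix.mulVec_mulVec]

theorem one_act (v : EuclideanSpace 𝕜 (Fin d)) : act 1 v = v := by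
  simp [act]

theorem act_zero (M : Matrix (Fin d) (Fin d) 𝕜) : act M 0 = 0 := by
  simp [act]

theorem act_sum (M : Matrix (Fin d) (Fin d) 𝕜) {ι : Type*} (s : Finset ι)
    (f : ι → EuclideanSpace 𝕜 (Fin d)) : act M (∑ k ∈ s, f k) = ∑ k ∈ s, act M (f k) := by
  classical
  induction s using Finset.induction_on with
  | empty => simp [act_zero]
  | insert a s ha ih => rw [Finset.sum_insert ha, Finset.sum_insert ha, act_add, ih]

theorem continuous_act (M : Matrix (Fin d) (Fin d) 𝕜) : Continuous (act M) := by
  unfold act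
  fun_prop

theorem inner_act_eq_sum (M : Matrix (Fin d) (Fin d) ℝ) (v w : EuclideanSpace ℝ (Fin d)) :
    inner ℝ v (act M w) = ∑ i, act Mᵀ v i * w i := by
  have h := inner_actRect Mᵀ v w
  rw [Matrix.transpose_transpose] at h
  change inner ℝ v (actRect M w) = _
  rw [show actRect M w = WithLp.toLp 2 (M *ᵥ WithLp.ofLp w) from rfl, ← h, PiLp.inner_apply]
  simp only [actRect, act, RCLike.inner_apply, conj_trivial]
  exact Finset.sum_congr rfl fun i _ => mul_comm _ _

end Act

variable {Ω : Type*} {mΩ : MeasurableSpace Ω} {P : Measure Ω} {d : ℕ}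

theorem MemLp_act {p : ENNReal} {f : Ω → EuclideanSpace ℝ (Fin d)} (hf : MemLp f p P)
    (M : Matrix (Fin d) (Fin d) ℝ) : MemLp (fun ω => act M (f ω)) p P :=
  hf.of_le_mul (c := ‖M‖) ((continuous_act M).comp_aestronglyMeasurable hf.1)
    (.of_forall fun ω => norm_act_le M (f ω))

/-- Square integrable martingale differences `ε 1, ε 2, …` with second moments bounded by `V`. -/
structure IsMartingaleDiff (P : Measure Ω) (F : Filtration ℕ mΩ)
    (ε : ℕ → Ω → EuclideanSpace ℝ (Fin d)) (V : ℝ) : Prop where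
  measurable : ∀ k, Measurable[F (k + 1)] (ε (k + 1))
  memLp : ∀ k, MemLp (ε (k + 1)) 2 P
  center : ∀ k (Z : Ω → ℝ), Measurable[F k] Z → MemLp Z 2 P → ∀ i,
    ∫ ω, Z ω * ε (k + 1) ω i ∂P = 0
  sq_le : ∀ k, ∫ ω, ‖ε (k + 1) ω‖ ^ 2 ∂P ≤ V

namespace IsMartingaleDiff

variable {F : Filtration ℕ mΩ} {ε : ℕ → Ω → EuclideanSpace ℝ (Fin d)} {V : ℝ}

theorem nonneg (h : IsMartingaleDiff P F ε V) : 0 ≤ V :=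
  (integral_nonneg fun _ => by positivity).trans (h.sq_le 0)

theorem memLp_of_mem (h : IsMartingaleDiff P F ε V) {n k : ℕ} (hk : k ∈ Finset.Ioc 0 n) :
    MemLp (ε k) 2 P := by
  obtain ⟨j, rfl⟩ : ∃ j, k = j + 1 := ⟨k - 1, by have := Finset.mem_Ioc.1 hk; omega⟩
  exact h.memLp j

theorem memLp_sum (h : IsMartingaleDiff P F ε V) (M : ℕ → Matrix (Fin d) (Fin d) ℝ) (n : ℕ) :
    MemLp (fun ω => ∑ k ∈ Finset.Ioc 0 n, act (M k) (ε k ω)) 2 P :=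
  memLp_finsetSum _ fun _ hk => MemLp_act (h.memLp_of_mem hk) _

theorem measurable_sum (h : IsMartingaleDiff P F ε V) (M : ℕ → Matrix (Fin d) (Fin d) ℝ) (n : ℕ) :
    Measurable[F n] fun ω => ∑ k ∈ Finset.Ioc 0 n, act (M k) (ε k ω) := by
  refine Finset.measurable_sum _ fun k hk => ?_
  obtain ⟨j, rfl⟩ : ∃ j, k = j + 1 := ⟨k - 1, by have := Finset.mem_Ioc.1 hk; omega⟩
  exact (continuous_act _).measurable.comp
    ((h.measurable j).mono (F.mono (Finset.mem_Ioc.1 hk).2) le_rfl)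

theorem memLp_apply {p : ENNReal} {f : Ω → EuclideanSpace ℝ (Fin d)} (hf : MemLp f p P)
    (i : Fin d) : MemLp (fun ω => f ω i) p P :=
  hf.of_le_mul (c := 1)
    ((EuclideanSpace.proj (𝕜 := ℝ) i).continuous.comp_aestronglyMeasurable hf.1)
    (.of_forall fun ω => by rw [one_mul]; exact PiLp.norm_apply_le (f ω) i)

theorem integral_inner_eq_zero (h : IsMartingaleDiff P F ε V) {k : ℕ}
    {Y : Ω → EuclideanSpace ℝ (Fin d)} (hY : Measurable[F k] Y) (hY2 : MemLp Y 2 P)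
    (M : Matrix (Fin d) (Fin d) ℝ) : ∫ ω, inner ℝ (Y ω) (act M (ε (k + 1) ω)) ∂P = 0 := by
  simp only [inner_act_eq_sum]
  have hZ : ∀ i, MemLp (fun ω => act Mᵀ (Y ω) i) 2 P := fun i => memLp_apply (MemLp_act hY2 _) i
  rw [integral_finsetSum (f := fun i ω => act Mᵀ (Y ω) i * ε (k + 1) ω i) _
    fun i _ => (hZ i).integrable_mul (memLp_apply (h.memLp k) i)]
  refine Finset.sum_eq_zero fun i _ => h.center k _ ?_ (hZ i) i
  exact ((EuclideanSpace.proj (𝕜 := ℝ) i).continuous.comp (continuous_act _)).measurable.comp hY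

/-- Orthogonality of martingale differences. -/
theorem integral_norm_sq_sum_le (h : IsMartingaleDiff P F ε V) (M : ℕ → Matrix (Fin d) (Fin d) ℝ)
    (n : ℕ) : ∫ ω, ‖∑ k ∈ Finset.Ioc 0 n, act (M k) (ε k ω)‖ ^ 2 ∂P ≤
      V * ∑ k ∈ Finset.Ioc 0 n, ‖M k‖ ^ 2 := by
  induction n with
  | zero => simp
  | succ n ih =>
    set Y := fun ω => ∑ k ∈ Finset.Ioc 0 n, act (M k) (ε k ω) with hY
    have hYm : MemLp Y 2 P := h.memLp_sum M n
    have hDm : MemLp (fun ω => act (M (n + 1)) (ε (n + 1) ω)) 2 P := MemLp_act (h.memLp n) _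
    have e1 : ∀ ω, ‖∑ k ∈ Finset.Ioc 0 (n + 1), act (M k) (ε k ω)‖ ^ 2 =
        ‖Y ω‖ ^ 2 + 2 * inner ℝ (Y ω) (act (M (n + 1)) (ε (n + 1) ω)) +
          ‖act (M (n + 1)) (ε (n + 1) ω)‖ ^ 2 := by
      intro ω
      rw [← Finset.insert_Ioc_right_eq_Ioc_add_one (Nat.zero_le n), Finset.sum_insert (by simp),
        add_comm, norm_add_sq_real]
    have hin : Integrable (fun ω => 2 * inner ℝ (Y ω) (act (M (n + 1)) (ε (n + 1) ω))) P := by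
      refine Integrable.const_mul ?_ _
      simp only [inner_act_eq_sum]
      exact integrable_finsetSum _ fun i _ =>
        (memLp_apply (MemLp_act hYm _) i).integrable_mul (memLp_apply (h.memLp n) i)
    have hD2 : ∫ ω, ‖act (M (n + 1)) (ε (n + 1) ω)‖ ^ 2 ∂P ≤ V * ‖M (n + 1)‖ ^ 2 := by
      have h1 : ∫ ω, ‖act (M (n + 1)) (ε (n + 1) ω)‖ ^ 2 ∂P ≤
          ∫ ω, ‖M (n + 1)‖ ^ 2 * ‖ε (n + 1) ω‖ ^ 2 ∂P := by
        refine integral_mono hDm.norm.integrable_sq ((h.memLp n).norm.integrable_sq.const_mul _)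
          fun ω => ?_
        simp only
        rw [← mul_pow]
        gcongr
        exact norm_act_le _ _
      refine h1.trans ?_
      rw [integral_const_mul, mul_comm]
      gcongr
      exact h.sq_le n
    simp only [e1]
    rw [integral_add (f := fun ω => ‖Y ω‖ ^ 2 +
        2 * inner ℝ (Y ω) (act (M (n + 1)) (ε (n + 1) ω)))
        (hYm.norm.integrable_sq.add hin) hDm.norm.integrable_sq,
      integral_add (f := fun ω => ‖Y ω‖ ^ 2) hYm.norm.integrable_sq hin, integral_const_mul,
      h.integral_inner_eq_zero (h.measurable_sum M n) hYm,
      ← Finset.insert_Ioc_right_eq_Ioc_add_one (Nat.zero_le n), Finset.sum_insert (by simp)]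
    linarith

theorem lpNorm_two_eq_sqrt {E : Type*} [NormedAddCommGroup E] {f : Ω → E} (hf : MemLp f 2 P) :
    lpNorm f 2 P = Real.sqrt (∫ ω, ‖f ω‖ ^ 2 ∂P) := by
  rw [lpNorm_eq_integral_norm_rpow_toReal (by norm_num) (by norm_num) hf.1, Real.sqrt_eq_rpow]
  norm_num

theorem lpNorm_two_sum_le (h : IsMartingaleDiff P F ε V) (M : ℕ → Matrix (Fin d) (Fin d) ℝ)
    (n : ℕ) : lpNorm (fun ω => ∑ k ∈ Finset.Ioc 0 n, act (M k) (ε k ω)) 2 P ≤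
      Real.sqrt (V * ∑ k ∈ Finset.Ioc 0 n, ‖M k‖ ^ 2) := by
  rw [lpNorm_two_eq_sqrt (h.memLp_sum M n)]
  exact Real.sqrt_le_sqrt (h.integral_norm_sq_sum_le M n)

end IsMartingaleDiff

section Recursion

/-- The innovations `ε_{k+1} = X_{k+1} - (1/k) A S_k`. -/
noncomputable def noise (A : Matrix (Fin d) (Fin d) ℝ) (X : ℕ → Ω → EuclideanSpace ℝ (Fin d))
    (k : ℕ) (ω : Ω) : EuclideanSpace ℝ (Fin d) :=
  X k ω - (1 / ((k - 1 : ℕ) : ℝ)) • act A (walk X (k - 1) ω)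

/-- For k = 0 the coefficient `1 / 0` is zero and so is the walk: the first innovation is `X 1`. -/
theorem noise_succ (A : Matrix (Fin d) (Fin d) ℝ) (X : ℕ → Ω → EuclideanSpace ℝ (Fin d))
    (k : ℕ) (ω : Ω) :
    noise A X (k + 1) ω = X (k + 1) ω - (1 / (k : ℝ)) • act A (walk X k ω) := rfl

theorem walk_zero (X : ℕ → Ω → EuclideanSpace ℝ (Fin d)) (ω : Ω) : walk X 0 ω = 0 := rfl

theorem walk_succ (X : ℕ → Ω → EuclideanSpace ℝ (Fin d)) (n : ℕ) (ω : Ω) :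
    walk X (n + 1) ω = walk X n ω + X (n + 1) ω :=
  Finset.sum_Icc_succ_top (by omega) _

/-- Variation of constants, exact for every n: the correction is linear in the earlier walk with
coefficients given by the defects. The free matrix `M` serves to insert projections and flows. -/
theorem act_flow_walk (M A : Matrix (Fin d) (Fin d) ℝ) (X : ℕ → Ω → EuclideanSpace ℝ (Fin d))
    (n : ℕ) (ω : Ω) :
    act (M * flow A (-Real.log n)) (walk X n ω) =
      ∑ k ∈ Finset.Ioc 0 n, act (M * flow A (-Real.log k)) (noise A X k ω) +
      ∑ k ∈ Finset.range n, act (M * flow A (-Real.log k) * defect A k) (walk X k ω) := by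
  induction n with
  | zero => simp [walk_zero, act_zero]
  | succ n ih =>
    rw [← Finset.insert_Ioc_right_eq_Ioc_add_one (Nat.zero_le n), Finset.sum_insert (by simp),
      Finset.sum_range_succ]
    have e1 : walk X (n + 1) ω = act (1 + (1 / (n : ℝ)) • A) (walk X n ω) +
        noise A X (n + 1) ω := by
      rw [walk_succ, noise_succ, add_act, one_act, smul_act]
      abel
    -- This is the definition of the defect: one step of the recursion, pulled back by the flow, is
    -- the identity plus the defect.
    have e2 : flow A (-Real.log ((n + 1 : ℕ) : ℝ)) * (1 + (1 / (n : ℝ)) • A) =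
        flow A (-Real.log n) + flow A (-Real.log n) * defect A n := by
      have : flow A (-Real.log ((n + 1 : ℕ) : ℝ)) =
          flow A (-Real.log n) * flow A (Real.log n - Real.log (n + 1)) := by
        rw [← flow_add]
        congr 1
        push_cast
        ring
      rw [this, defect, mul_sub, mul_one, mul_assoc]
      exact (add_sub_cancel _ _).symm
    rw [e1, act_add, ← mul_act, mul_assoc M, e2, mul_add, add_act, ih, ← mul_assoc M]
    abel

end Recursion

end MartingaleDifferences

/-! ### Moments of the walk and of its innovations. -/

section WalkMoments

open scoped Matrix.Norms.Frobenius

section LpNorm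

variable {Ω : Type*} {mΩ : MeasurableSpace Ω} {P : Measure Ω}

theorem lpNorm_mono_exponent [IsProbabilityMeasure P] {E : Type*} [NormedAddCommGroup E] {f : Ω → E}
    {p q : ENNReal} (hpq : p ≤ q) (hf : MemLp f q P) : lpNorm f p P ≤ lpNorm f q P := by
  rw [← toReal_eLpNorm hf.1, ← toReal_eLpNorm hf.1]
  exact ENNReal.toReal_mono hf.2.ne (eLpNorm_le_eLpNorm_of_exponent_le hpq hf.1)

theorem lpNorm_act_le {d : ℕ} {p : ENNReal} {f : Ω → EuclideanSpace ℝ (Fin d)} (hf : MemLp f p P)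
    (M : Matrix (Fin d) (Fin d) ℝ) : lpNorm (fun ω => act M (f ω)) p P ≤ ‖M‖ * lpNorm f p P := by
  have h1 := lpNorm_mono_real (f := fun ω => act M (f ω)) (g := ‖M‖ • fun ω => ‖f ω‖)
    (hf.norm.const_smul ‖M‖) fun ω => norm_act_le M (f ω)
  rw [lpNorm_const_smul, lpNorm_norm hf.1] at h1
  simpa using h1

/-- Pull the past variable out of the conditional expectation, then integrate. All conditional
hypotheses enter through such tested identities. -/
theorem integral_mul_eq_of_condExp [IsFiniteMeasure P] {m : MeasurableSpace Ω} (hm : m ≤ mΩ)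
    {Z f g : Ω → ℝ} (hZ : Measurable[m] Z) (hZf : Integrable (fun ω => Z ω * f ω) P)
    (hf : Integrable f P) (h : P[f | m] =ᵐ[P] g) :
    ∫ ω, Z ω * f ω ∂P = ∫ ω, Z ω * g ω ∂P := by
  have h1 : P[Z * f | m] =ᵐ[P] Z * P[f | m] :=
    condExp_mul_of_stronglyMeasurable_left hZ.stronglyMeasurable hZf hf
  have h2 : ∫ ω, (P[Z * f | m]) ω ∂P = ∫ ω, Z ω * f ω ∂P := integral_condExp hm
  rw [← h2]
  refine integral_congr_ae ?_
  filter_upwards [h1, h] with ω e1 e2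
  rw [e1, Pi.mul_apply, e2]

end LpNorm

namespace IsLinearWalk

variable {Ω : Type*} {mΩ : MeasurableSpace Ω} {P : Measure Ω} {d : ℕ}
  {X : ℕ → Ω → EuclideanSpace ℝ (Fin d)} {A Sig : Matrix (Fin d) (Fin d) ℝ}
  {Err : ℕ → Ω → Matrix (Fin d) (Fin d) ℝ}

/-- The natural filtration of the increments. -/
def pastFiltration (hX : IsLinearWalk P X A Sig Err) : Filtration ℕ mΩ where
  seq := past X
  mono' := fun _ _ h => biSup_mono fun _ hk =>
    Finset.mem_Icc.2 ⟨(Finset.mem_Icc.1 hk).1, (Finset.mem_Icc.1 hk).2.trans h⟩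
  le' := fun _ => iSup₂_le fun k hk => (hX.measurable k (Finset.mem_Icc.1 hk).1).comap_le

theorem measurable_past (hX : IsLinearWalk P X A Sig Err) {n k : ℕ} (hk : 1 ≤ k) (hkn : k ≤ n) :
    Measurable[hX.pastFiltration n] (X k) := by
  refine (comap_measurable (X k)).mono ?_ le_rfl
  exact le_iSup₂_of_le (f := fun k (_ : k ∈ Finset.Icc 1 n) =>
    MeasurableSpace.comap (X k) inferInstance) k (Finset.mem_Icc.2 ⟨hk, hkn⟩) le_rfl

theorem measurable_walk_past (hX : IsLinearWalk P X A Sig Err) (n : ℕ) :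
    Measurable[hX.pastFiltration n] (walk X n) :=
  Finset.measurable_sum _ fun _ hk =>
    hX.measurable_past (Finset.mem_Icc.1 hk).1 (Finset.mem_Icc.1 hk).2

theorem measurable_walk (hX : IsLinearWalk P X A Sig Err) (n : ℕ) : Measurable (walk X n) :=
  (hX.measurable_walk_past n).mono (hX.pastFiltration.le n) le_rfl

theorem measurable_noise (hX : IsLinearWalk P X A Sig Err) (k : ℕ) :
    Measurable[hX.pastFiltration (k + 1)] (noise A X (k + 1)) := by
  have h1 : Measurable[hX.pastFiltration (k + 1)] (walk X k) :=
    (hX.measurable_walk_past k).mono (hX.pastFiltration.mono k.le_succ) le_rfl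
  exact (hX.measurable_past (by omega) le_rfl).sub
    (((continuous_act A).const_smul (1 / (k : ℝ))).measurable.comp h1)

theorem memLp_walk {p : ENNReal} (hp : ∀ n, 1 ≤ n → MemLp (X n) p P) (n : ℕ) :
    MemLp (walk X n) p P :=
  memLp_finsetSum _ fun k hk => hp k (Finset.mem_Icc.1 hk).1

theorem memLp_noise {p : ENNReal} (hp : ∀ n, 1 ≤ n → MemLp (X n) p P)
    (A : Matrix (Fin d) (Fin d) ℝ) (k : ℕ) : MemLp (noise A X (k + 1)) p P :=
  (hp _ (by omega)).sub ((MemLp_act (memLp_walk hp k) A).const_smul (1 / (k : ℝ)))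

theorem lpNorm_walk_le {p : ENNReal} (hp1 : 1 ≤ p) {M : ℝ}
    (hp : ∀ n, 1 ≤ n → MemLp (X n) p P ∧ lpNorm (X n) p P ≤ M) (n : ℕ) :
    lpNorm (walk X n) p P ≤ n * M := by
  have h1 : walk X n = ∑ k ∈ Finset.Icc 1 n, X k := by
    funext ω
    rw [Finset.sum_apply]
    rfl
  rw [h1]
  refine (lpNorm_sum_le (fun k hk => (hp k (Finset.mem_Icc.1 hk).1).1) hp1).trans ?_
  refine (Finset.sum_le_card_nsmul _ _ M fun k hk => (hp k (Finset.mem_Icc.1 hk).1).2).trans ?_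
  simp

theorem lpNorm_noise_le {p : ENNReal} (hp1 : 1 ≤ p) {M : ℝ} (hM : 0 ≤ M)
    (hp : ∀ n, 1 ≤ n → MemLp (X n) p P ∧ lpNorm (X n) p P ≤ M)
    (A : Matrix (Fin d) (Fin d) ℝ) (k : ℕ) :
    lpNorm (noise A X (k + 1)) p P ≤ M + ‖A‖ * M := by
  have hp' := fun n hn => (hp n hn).1
  have h1 : noise A X (k + 1) = X (k + 1) - (1 / (k : ℝ)) • fun ω => act A (walk X k ω) := rfl
  rw [h1]
  refine (lpNorm_sub_le (hp' _ (by omega)) hp1).trans (add_le_add (hp _ (by omega)).2 ?_)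
  rw [lpNorm_const_smul]
  have h2 := (lpNorm_act_le (memLp_walk hp' k) A).trans
    (mul_le_mul_of_nonneg_left (lpNorm_walk_le hp1 hp k) (norm_nonneg A))
  have h3 : |1 / (k : ℝ)| * k ≤ 1 := by
    rcases Nat.eq_zero_or_pos k with rfl | hk
    · simp
    · have : (0 : ℝ) < k := by exact_mod_cast hk
      rw [abs_of_pos (by positivity)]
      field_simp
      rfl
  calc ‖1 / (k : ℝ)‖₊ * lpNorm (fun ω => act A (walk X k ω)) p P
      ≤ |1 / (k : ℝ)| * (‖A‖ * (k * M)) := by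
        rw [coe_nnnorm, Real.norm_eq_abs]
        gcongr
    _ = (|1 / (k : ℝ)| * k) * (‖A‖ * M) := by ring
    _ ≤ _ := mul_le_of_le_one_left (by positivity) h3

theorem lpNorm_defect_le {a b c C : ℝ} (hr : HasRates A a b c C) {p : ENNReal} (hp1 : 1 ≤ p) {M : ℝ}
    (hp : ∀ n, 1 ≤ n → MemLp (X n) p P ∧ lpNorm (X n) p P ≤ M)
    (N : Matrix (Fin d) (Fin d) ℝ) (k : ℕ) :
    lpNorm (fun ω => act (N * defect A k) (walk X k ω)) p P ≤ ‖N‖ * (C * M * (1 / (k : ℝ))) := by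
  have h1 := lpNorm_act_le (memLp_walk (fun n hn => (hp n hn).1) k) (N * defect A k)
  refine h1.trans ?_
  rcases Nat.eq_zero_or_pos k with rfl | hk
  · have : lpNorm (walk X 0) p P = 0 := by
      have : walk X 0 = 0 := rfl
      rw [this, lpNorm_zero]
    rw [this]
    simp
  · have hk0 : (0 : ℝ) < k := by exact_mod_cast hk
    have hC := hr.C_pos
    calc ‖N * defect A k‖ * lpNorm (walk X k) p P
        ≤ (‖N‖ * (C * (1 / (k : ℝ)) ^ 2)) * (k * M) := by
          refine mul_le_mul ((norm_mul_le _ _).trans ?_) (lpNorm_walk_le hp1 hp k) lpNorm_nonneg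
            (by positivity)
          exact mul_le_mul_of_nonneg_left (hr.defect k hk) (norm_nonneg _)
      _ = _ := by field_simp

/-- The `L^p` size of the remainders caused by the defects. -/
theorem lpNorm_sum_defect_le {a b c C : ℝ} (hr : HasRates A a b c C) {p : ENNReal} (hp1 : 1 ≤ p)
    {M : ℝ} (hM : 0 ≤ M) (hp : ∀ n, 1 ≤ n → MemLp (X n) p P ∧ lpNorm (X n) p P ≤ M)
    (N : ℕ → Matrix (Fin d) (Fin d) ℝ) (s : Finset ℕ) {K t : ℝ} (ht : t < 1)
    (hN : ∀ k ∈ s, 1 ≤ k → ‖N k‖ ≤ K * (k : ℝ) ^ t) :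
    MemLp (fun ω => ∑ k ∈ s, act (N k * defect A k) (walk X k ω)) p P ∧
    lpNorm (fun ω => ∑ k ∈ s, act (N k * defect A k) (walk X k ω)) p P ≤
      K * (C * M) * ∑ k ∈ s, (k : ℝ) ^ (t - 1) := by
  have hm : ∀ k ∈ s, MemLp (fun ω => act (N k * defect A k) (walk X k ω)) p P :=
    fun k _ => MemLp_act (memLp_walk (fun n hn => (hp n hn).1) k) _
  refine ⟨memLp_finsetSum _ hm, ?_⟩
  have h1 : (fun ω => ∑ k ∈ s, act (N k * defect A k) (walk X k ω)) =
      ∑ k ∈ s, fun ω => act (N k * defect A k) (walk X k ω) := by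
    funext ω
    rw [Finset.sum_apply]
  rw [h1, Finset.mul_sum]
  refine (lpNorm_sum_le hm hp1).trans (Finset.sum_le_sum fun k hk => ?_)
  refine (lpNorm_defect_le hr hp1 hp (N k) k).trans ?_
  have hC := hr.C_pos
  rcases Nat.eq_zero_or_pos k with rfl | hk1
  · simp [Real.zero_rpow (show t - 1 ≠ 0 by linarith)]
  · have hk0 : (0 : ℝ) < k := by exact_mod_cast hk1
    calc ‖N k‖ * (C * M * (1 / (k : ℝ))) ≤ (K * (k : ℝ) ^ t) * (C * M * (1 / (k : ℝ))) := by
          gcongr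
          exact hN k hk hk1
      _ = _ := by
          rw [Real.rpow_sub_one hk0.ne']
          ring

/-- The error of the conditional covariance of the innovations. -/
noncomputable def covError (P : Measure Ω) (X : ℕ → Ω → EuclideanSpace ℝ (Fin d))
    (A Sig : Matrix (Fin d) (Fin d) ℝ) (Err : ℕ → Ω → Matrix (Fin d) (Fin d) ℝ) : ℕ → ℝ
  | 0 => 0
  | 1 => ∫ ω, ∑ i, ∑ j, |noise A X 1 ω i * noise A X 1 ω j - Sig i j| ∂P
  | (k + 2) => ∫ ω, ∑ i, ∑ j, |Err (k + 1) ω i j| ∂P +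
      (1 / ((k + 1 : ℕ) : ℝ)) ^ 2 * ‖A‖ ^ 2 * lpNorm (walk X (k + 1)) 2 P ^ 2

theorem covError_nonneg (k : ℕ) : 0 ≤ covError P X A Sig Err k := by
  match k with
  | 0 => exact le_rfl
  | 1 => exact integral_nonneg fun ω => Finset.sum_nonneg fun _ _ => Finset.sum_nonneg fun _ _ =>
      abs_nonneg _
  | (k + 2) =>
    refine add_nonneg (integral_nonneg fun ω => Finset.sum_nonneg fun _ _ =>
      Finset.sum_nonneg fun _ _ => abs_nonneg _) (by positivity)

theorem abs_integral_mul_le {Z f : Ω → ℝ} (hZ : ∀ ω, |Z ω| ≤ 1) (hf : Integrable f P) :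
    |∫ ω, Z ω * f ω ∂P| ≤ ∫ ω, |f ω| ∂P := by
  rw [← Real.norm_eq_abs]
  refine norm_integral_le_of_norm_le hf.abs (.of_forall fun ω => ?_)
  rw [Real.norm_eq_abs, abs_mul]
  exact mul_le_of_le_one_left (abs_nonneg _) (hZ ω)

theorem abs_le_sum_sum (f : Fin d → Fin d → ℝ) (i j : Fin d) : |f i j| ≤ ∑ i, ∑ j, |f i j| :=
  (Finset.single_le_sum (f := fun j => |f i j|) (fun _ _ => abs_nonneg _) (Finset.mem_univ j)).trans
    (Finset.single_le_sum (f := fun i => ∑ j, |f i j|)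
      (fun _ _ => Finset.sum_nonneg fun _ _ => abs_nonneg _) (Finset.mem_univ i))

variable [IsProbabilityMeasure P]

theorem exists_lpNorm_le (hX : IsLinearWalk P X A Sig Err) :
    ∃ q : ℝ, 2 < q ∧ q ≤ 3 ∧ ∃ M : ℝ, 0 ≤ M ∧ ∀ n, 1 ≤ n →
      MemLp (X n) (ENNReal.ofReal q) P ∧ lpNorm (X n) (ENNReal.ofReal q) P ≤ M := by
  obtain ⟨p, hp, C, hC⟩ := hX.moment
  have hp0 : 0 < p := by linarith
  -- The exponent is lowered to at most 3 because the second-order Taylor remainder is bounded by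
  -- |x|^q only for q ≤ 3.
  refine ⟨min p 3, lt_min hp (by norm_num), min_le_right _ _, ((C : ENNReal) ^ (1 / p)).toReal,
    ENNReal.toReal_nonneg, fun n hn => ?_⟩
  have hfin : (C : ENNReal) ^ (1 / p) ≠ ⊤ := ENNReal.rpow_ne_top_of_nonneg (by positivity) (by simp)
  have h1 : eLpNorm (X n) (ENNReal.ofReal p) P ≤ (C : ENNReal) ^ (1 / p) := by
    rw [eLpNorm_eq_lintegral_rpow_enorm_toReal (by simpa using hp0) ENNReal.ofReal_ne_top,
      ENNReal.toReal_ofReal hp0.le]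
    gcongr
    exact hC n hn
  have hm : AEStronglyMeasurable (X n) P := (hX.measurable n hn).aestronglyMeasurable
  have h2 : eLpNorm (X n) (ENNReal.ofReal (min p 3)) P ≤ (C : ENNReal) ^ (1 / p) :=
    (eLpNorm_le_eLpNorm_of_exponent_le (ENNReal.ofReal_le_ofReal (min_le_left _ _)) hm).trans h1
  refine ⟨⟨hm, h2.trans_lt hfin.lt_top⟩, ?_⟩
  rw [← toReal_eLpNorm hm]
  exact ENNReal.toReal_mono hfin h2

theorem condExp_succ (hX : IsLinearWalk P X A Sig Err) (k : ℕ) :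
    P[X (k + 1) | hX.pastFiltration k] =ᵐ[P] fun ω => (1 / (k : ℝ)) • act A (walk X k ω) := by
  rcases Nat.eq_zero_or_pos k with rfl | hk
  · have h1 : hX.pastFiltration 0 = ⊥ := by
      change past X 0 = ⊥
      simp [past]
    rw [h1, condExp_bot, zero_add, hX.mean_one]
    exact .of_forall fun ω => by simp
  · exact hX.drift k hk

theorem condExp_succ_apply (hX : IsLinearWalk P X A Sig Err) {k : ℕ} (hi : Integrable (X (k + 1)) P)
    (i : Fin d) :
    P[fun ω => X (k + 1) ω i | hX.pastFiltration k] =ᵐ[P]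
      fun ω => ((1 / (k : ℝ)) • act A (walk X k ω)) i := by
  have h1 := ContinuousLinearMap.comp_condExp_comm (m := hX.pastFiltration k) hi
    (EuclideanSpace.proj (𝕜 := ℝ) i : EuclideanSpace ℝ (Fin d) →L[ℝ] ℝ)
  refine h1.symm.trans ?_
  filter_upwards [hX.condExp_succ k] with ω hω
  simp [hω]

theorem integral_mul_noise (hX : IsLinearWalk P X A Sig Err)
    (h2 : ∀ n, 1 ≤ n → MemLp (X n) 2 P) (k : ℕ) (Z : Ω → ℝ)
    (hZ : Measurable[hX.pastFiltration k] Z) (hZ2 : MemLp Z 2 P) (i : Fin d) :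
    ∫ ω, Z ω * noise A X (k + 1) ω i ∂P = 0 := by
  have hXi := IsMartingaleDiff.memLp_apply (h2 (k + 1) (by omega)) i
  have hb := IsMartingaleDiff.memLp_apply
    ((MemLp_act (memLp_walk h2 k) A).const_smul (1 / (k : ℝ))) i
  have h3 := integral_mul_eq_of_condExp (hX.pastFiltration.le k) hZ (hZ2.integrable_mul hXi)
    (hXi.integrable (by norm_num))
    (hX.condExp_succ_apply ((h2 (k + 1) (by omega)).integrable (by norm_num)) i)
  have e : ∀ ω, Z ω * noise A X (k + 1) ω i =
      Z ω * X (k + 1) ω i - Z ω * ((1 / (k : ℝ)) • act A (walk X k ω)) i := by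
    intro ω
    rw [noise_succ, PiLp.sub_apply, mul_sub]
  simp only [e]
  rw [integral_sub (f := fun ω => Z ω * X (k + 1) ω i)
    (g := fun ω => Z ω * ((1 / (k : ℝ)) • act A (walk X k ω)) i)
    (hZ2.integrable_mul hXi) (hZ2.integrable_mul hb), h3, sub_self]

theorem isMartingaleDiff (hX : IsLinearWalk P X A Sig Err) {M : ℝ} (hM : 0 ≤ M)
    (h2 : ∀ n, 1 ≤ n → MemLp (X n) 2 P ∧ lpNorm (X n) 2 P ≤ M) :
    IsMartingaleDiff P hX.pastFiltration (noise A X) ((M + ‖A‖ * M) ^ 2) where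
  measurable := hX.measurable_noise
  memLp := memLp_noise (fun n hn => (h2 n hn).1) A
  center := hX.integral_mul_noise fun n hn => (h2 n hn).1
  sq_le := fun k => by
    have h3 := lpNorm_noise_le (by norm_num) hM h2 A k
    rw [IsMartingaleDiff.lpNorm_two_eq_sqrt (memLp_noise (fun n hn => (h2 n hn).1) A k)] at h3
    exact Real.sqrt_le_left (by positivity) |>.1 h3

/-- The walk grows at most like `n ^ b` in `L²`. -/
theorem exists_lpNorm_walk_le (hX : IsLinearWalk P X A Sig Err) {a b c C : ℝ}
    (hr : HasRates A a b c C) {M : ℝ} (hM : 0 ≤ M)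
    (h2 : ∀ n, 1 ≤ n → MemLp (X n) 2 P ∧ lpNorm (X n) 2 P ≤ M) :
    ∃ K : ℝ, 0 ≤ K ∧ ∀ n : ℕ, 1 ≤ n → lpNorm (walk X n) 2 P ≤ K * (n : ℝ) ^ b := by
  have hD := hX.isMartingaleDiff hM h2
  set V := (M + ‖A‖ * M) ^ 2
  have hV : 0 ≤ V := hD.nonneg
  have hC := hr.C_pos
  have hb := hr.b_gt
  set Z1 := ∑' k : ℕ, (k : ℝ) ^ (-(2 * b))
  set Z2 := ∑' k : ℕ, (k : ℝ) ^ (-(b + 1))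
  have hZ1 : 0 ≤ Z1 := tsum_nonneg fun k => by positivity
  have hZ2 : 0 ≤ Z2 := tsum_nonneg fun k => by positivity
  -- The first term bounds the noise, by orthogonality and Σ k^{-2b} < ∞ (b > 1/2); the second
  -- bounds the defects, with summands k^{-b} · k⁻¹.
  refine ⟨Real.sqrt (V * (C ^ 2 * Z1)) + C * (C * M) * Z2, by positivity, fun n hn => ?_⟩
  have hn0 : (0 : ℝ) ≤ n := n.cast_nonneg
  have hflow : ∀ k : ℕ, flow A (Real.log n) * flow A (-Real.log k) =
      flow A (Real.log n - Real.log k) := fun k => by rw [← flow_add, sub_eq_add_neg]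
  have e : walk X n = (fun ω => ∑ k ∈ Finset.Ioc 0 n,
      act (flow A (Real.log n) * flow A (-Real.log k)) (noise A X k ω)) +
      fun ω => ∑ k ∈ Finset.range n,
        act (flow A (Real.log n) * flow A (-Real.log k) * defect A k) (walk X k ω) := by
    funext ω
    have h := act_flow_walk (flow A (Real.log n)) A X n ω
    rw [hflow n, sub_self, flow_zero, one_act] at h
    exact h
  have h1 := hD.lpNorm_two_sum_le (fun k => flow A (Real.log n) * flow A (-Real.log k)) n
  have h3 := lpNorm_sum_defect_le hr (p := 2) (by norm_num) hM h2
    (fun k => flow A (Real.log n) * flow A (-Real.log k)) (Finset.range n)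
    (K := C * (n : ℝ) ^ b) (t := -b) (by linarith) (fun k hk hk1 => by
      rw [hflow, mul_assoc]
      exact hr.total n k hk1 (Finset.mem_range.1 hk).le)
  rw [e]
  refine (lpNorm_add_le (hD.memLp_sum _ n) (by norm_num)).trans ?_
  rw [add_mul]
  refine add_le_add (h1.trans ?_) (h3.2.trans ?_)
  · have h4 : ∑ k ∈ Finset.Ioc 0 n, ‖flow A (Real.log n) * flow A (-Real.log k)‖ ^ 2 ≤
        (C ^ 2 * Z1) * ((n : ℝ) ^ b) ^ 2 := by
      calc _ ≤ ∑ k ∈ Finset.Ioc 0 n, C ^ 2 * ((n : ℝ) ^ b) ^ 2 * (k : ℝ) ^ (-(2 * b)) := by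
            refine Finset.sum_le_sum fun k hk => ?_
            have hk' := Finset.mem_Ioc.1 hk
            rw [hflow]
            calc _ ≤ (C * ((n : ℝ) ^ b * (k : ℝ) ^ (-b))) ^ 2 := by
                  gcongr
                  exact hr.total n k hk'.1 hk'.2
              _ = C ^ 2 * ((n : ℝ) ^ b) ^ 2 * ((k : ℝ) ^ (-b)) ^ 2 := by ring
              _ = _ := by rw [rpow_sq k.cast_nonneg]; ring_nf
        _ ≤ C ^ 2 * ((n : ℝ) ^ b) ^ 2 * Z1 := by
            rw [← Finset.mul_sum]
            gcongr
            exact sum_rpow_le_tsum (by linarith) _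
        _ = _ := by ring
    calc _ ≤ Real.sqrt (V * (C ^ 2 * Z1) * ((n : ℝ) ^ b) ^ 2) := by
          refine Real.sqrt_le_sqrt ?_
          rw [mul_assoc]
          gcongr
      _ = _ := by rw [Real.sqrt_mul (by positivity), Real.sqrt_sq (by positivity)]
  · have h5 : ∑ k ∈ Finset.range n, (k : ℝ) ^ (-b - 1) ≤ Z2 := by
      rw [show -b - 1 = -(b + 1) by ring]
      exact sum_rpow_le_tsum (by linarith) _
    calc _ ≤ C * (n : ℝ) ^ b * (C * M) * Z2 := by gcongr
      _ = _ := by ring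

theorem tendsto_covError (hX : IsLinearWalk P X A Sig Err) {a b c C : ℝ}
    (hr : HasRates A a b c C) {M : ℝ} (hM : 0 ≤ M)
    (h2 : ∀ n, 1 ≤ n → MemLp (X n) 2 P ∧ lpNorm (X n) 2 P ≤ M) :
    Tendsto (covError P X A Sig Err) atTop (𝓝 0) := by
  obtain ⟨K, hK, hgrow⟩ := hX.exists_lpNorm_walk_le hr hM h2
  rw [← tendsto_add_atTop_iff_nat 2]
  have h1 : Tendsto (fun k : ℕ => (1 / (k : ℝ)) ^ 2 * ‖A‖ ^ 2 * lpNorm (walk X k) 2 P ^ 2) atTop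
      (𝓝 0) := by
    have h3 := (tendsto_natCast_rpow_neg (s := 2 * b - 2) (by linarith [hr.b_lt])).const_mul
      (‖A‖ ^ 2 * K ^ 2)
    rw [mul_zero] at h3
    refine squeeze_zero' (.of_forall fun k => by positivity) ?_ h3
    filter_upwards [eventually_ge_atTop 1] with k hk
    have hk0 : (0 : ℝ) < k := by exact_mod_cast hk
    calc _ ≤ (1 / (k : ℝ)) ^ 2 * ‖A‖ ^ 2 * (K * (k : ℝ) ^ b) ^ 2 := by
          have := lpNorm_nonneg (f := walk X k) (p := 2) (μ := P)
          gcongr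
          exact hgrow k hk
      _ = ‖A‖ ^ 2 * K ^ 2 * (((k : ℝ) ^ b) ^ 2 * (1 / (k : ℝ) ^ (2 : ℝ))) := by
          rw [Real.rpow_two]; ring
      _ = _ := by rw [rpow_sq hk0.le, Real.rpow_sub hk0]; ring
  have h4 := (hX.err_tendsto.comp (tendsto_add_atTop_nat 1)).add
    (h1.comp (tendsto_add_atTop_nat 1))
  rw [add_zero] at h4
  exact h4

theorem abs_integral_cov_le (hX : IsLinearWalk P X A Sig Err)
    (h2 : ∀ n, 1 ≤ n → MemLp (X n) 2 P) (k : ℕ) (Z : Ω → ℝ)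
    (hZ : Measurable[hX.pastFiltration k] Z) (hZ1 : ∀ ω, |Z ω| ≤ 1) (i j : Fin d) :
    |∫ ω, Z ω * (noise A X (k + 1) ω i * noise A X (k + 1) ω j - Sig i j) ∂P| ≤
      covError P X A Sig Err (k + 1) := by
  have hZm : Measurable Z := hZ.mono (hX.pastFiltration.le k) le_rfl
  have hZmul : ∀ {f : Ω → ℝ}, Integrable f P → Integrable (fun ω => Z ω * f ω) P :=
    fun hf => hf.bdd_mul hZm.aestronglyMeasurable (c := 1) (.of_forall hZ1)
  have hε := fun i => IsMartingaleDiff.memLp_apply (memLp_noise h2 A k) i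
  have hεε := fun i j => (hε i).integrable_mul (hε j)
  rcases Nat.eq_zero_or_pos k with rfl | hk
  -- Nothing is assumed on the second moment of the first increment beyond its finiteness; the first
  -- error is simply the mean deviation itself.
  · have hint : ∀ i j, Integrable (fun ω => noise A X 1 ω i * noise A X 1 ω j - Sig i j) P :=
      fun i j => (hεε i j).sub (integrable_const _)
    refine (abs_integral_mul_le hZ1 (hint i j)).trans ?_
    refine integral_mono (hint i j).abs (integrable_finsetSum _ fun i _ =>
      integrable_finsetSum _ fun j _ => (hint i j).abs) fun ω => ?_
    exact abs_le_sum_sum (fun i j => noise A X 1 ω i * noise A X 1 ω j - Sig i j) i j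
  · obtain ⟨k, rfl⟩ : ∃ l, k = l + 1 := ⟨k - 1, by omega⟩
    set B : Ω → EuclideanSpace ℝ (Fin d) :=
      fun ω => (1 / ((k + 1 : ℕ) : ℝ)) • act A (walk X (k + 1) ω) with hB
    have hBL : MemLp B 2 P :=
      (MemLp_act (memLp_walk h2 (k + 1)) A).const_smul (1 / ((k + 1 : ℕ) : ℝ))
    have hBm : Measurable[hX.pastFiltration (k + 1)] B :=
      ((continuous_act A).const_smul (1 / ((k + 1 : ℕ) : ℝ))).measurable.comp
        (hX.measurable_walk_past (k + 1))
    have hBi := fun i => IsMartingaleDiff.memLp_apply hBL i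
    have hBmi : ∀ i, Measurable[hX.pastFiltration (k + 1)] fun ω => B ω i := fun i =>
      (EuclideanSpace.proj (𝕜 := ℝ) i).continuous.measurable.comp hBm
    have hXi := fun i => IsMartingaleDiff.memLp_apply (h2 (k + 1 + 1) (by omega)) i
    have hXX := fun i j => (hXi i).integrable_mul (hXi j)
    have hsec := fun i j => hX.second (k + 1) (by omega) i j
    have hErr : ∀ i j, Integrable (fun ω => Err (k + 1) ω i j) P := fun i j => by
      have h3 := ((integrable_condExp (m := past X (k + 1)) (μ := P)
        (f := fun ω => X (k + 1 + 1) ω i * X (k + 1 + 1) ω j)).congr (hsec i j)).sub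
        (integrable_const (Sig i j))
      refine h3.congr (.of_forall fun ω => ?_)
      simp
    have hE : ∫ ω, Z ω * (X (k + 1 + 1) ω i * X (k + 1 + 1) ω j) ∂P =
        ∫ ω, Z ω * (Sig i j + Err (k + 1) ω i j) ∂P := integral_mul_eq_of_condExp (hX.pastFiltration.le (k + 1)) hZ (hZmul (hXX i j))
      (hXX i j) (hsec i j)
    -- The product Z B is unbounded but in L²; this is why centering is tested against square
    -- integrable variables.
    have hZB : ∀ i j, ∫ ω, (Z ω * B ω j) * noise A X (k + 1 + 1) ω i ∂P = 0 := fun i j => by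
      refine hX.integral_mul_noise h2 (k + 1) _ (hZ.mul (hBmi j)) ?_ i
      refine (hBi j).of_le_mul (c := 1) (hZm.mul ((hBmi j).mono (hX.pastFiltration.le _)
        le_rfl)).aestronglyMeasurable (.of_forall fun ω => ?_)
      rw [Pi.mul_apply, norm_mul]
      gcongr
      exact hZ1 ω
    have hZBi : ∀ i j, Integrable (fun ω => (Z ω * B ω j) * noise A X (k + 1 + 1) ω i) P :=
      fun i j => by
        have := hZmul ((hBi j).integrable_mul (hε i))
        simpa [mul_assoc] using this
    have hBB := fun i j => (hBi i).integrable_mul (hBi j)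
    have e : ∀ ω, Z ω * (noise A X (k + 1 + 1) ω i * noise A X (k + 1 + 1) ω j - Sig i j) =
        (Z ω * (X (k + 1 + 1) ω i * X (k + 1 + 1) ω j) - Z ω * Sig i j) -
        ((Z ω * B ω j) * noise A X (k + 1 + 1) ω i + (Z ω * B ω i) * noise A X (k + 1 + 1) ω j +
          Z ω * (B ω i * B ω j)) := by
      intro ω
      have : ∀ i, X (k + 1 + 1) ω i = noise A X (k + 1 + 1) ω i + B ω i := fun i => by
        rw [noise_succ, PiLp.sub_apply]
        simp only [hB]
        ring
      rw [this i, this j]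
      ring
    have hval : ∫ ω, Z ω * (noise A X (k + 1 + 1) ω i * noise A X (k + 1 + 1) ω j - Sig i j) ∂P =
        ∫ ω, Z ω * Err (k + 1) ω i j ∂P - ∫ ω, Z ω * (B ω i * B ω j) ∂P := by
      simp only [e]
      have hc : Integrable (fun ω => Z ω * Sig i j) P := hZmul (integrable_const _)
      rw [integral_sub (f := fun ω => Z ω * (X (k + 1 + 1) ω i * X (k + 1 + 1) ω j) - Z ω * Sig i j)
          (g := fun ω => (Z ω * B ω j) * noise A X (k + 1 + 1) ω i +
            (Z ω * B ω i) * noise A X (k + 1 + 1) ω j + Z ω * (B ω i * B ω j))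
          ((hZmul (hXX i j)).sub hc) (((hZBi i j).add (hZBi j i)).add (hZmul (hBB i j))),
        integral_sub (f := fun ω => Z ω * (X (k + 1 + 1) ω i * X (k + 1 + 1) ω j))
          (hZmul (hXX i j)) hc,
        integral_add (f := fun ω => (Z ω * B ω j) * noise A X (k + 1 + 1) ω i +
            (Z ω * B ω i) * noise A X (k + 1 + 1) ω j) (g := fun ω => Z ω * (B ω i * B ω j))
          ((hZBi i j).add (hZBi j i)) (hZmul (hBB i j)),
        integral_add (hZBi i j) (hZBi j i), hZB, hZB, zero_add, zero_add, hE]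
      have h5 : ∫ ω, Z ω * (Sig i j + Err (k + 1) ω i j) ∂P =
          ∫ ω, Z ω * Sig i j ∂P + ∫ ω, Z ω * Err (k + 1) ω i j ∂P := by
        simp only [mul_add]
        exact integral_add hc (hZmul (hErr i j))
      rw [h5]
      ring
    rw [hval]
    refine (abs_sub _ _).trans (add_le_add ?_ ?_)
    · refine (abs_integral_mul_le hZ1 (hErr i j)).trans ?_
      refine integral_mono (hErr i j).abs (integrable_finsetSum _ fun i _ =>
        integrable_finsetSum _ fun j _ => (hErr i j).abs) fun ω => ?_
      exact abs_le_sum_sum (fun i j => Err (k + 1) ω i j) i j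
    · refine (abs_integral_mul_le hZ1 (hBB i j)).trans ?_
      have h6 : ∫ ω, |B ω i * B ω j| ∂P ≤ ∫ ω, ‖B ω‖ ^ 2 ∂P := by
        refine integral_mono (hBB i j).abs hBL.norm.integrable_sq fun ω => ?_
        simp only
        rw [abs_mul, sq]
        gcongr
        · exact PiLp.norm_apply_le (B ω) i
        · exact PiLp.norm_apply_le (B ω) j
      have h7 : ∫ ω, ‖B ω‖ ^ 2 ∂P = lpNorm B 2 P ^ 2 := by
        rw [IsMartingaleDiff.lpNorm_two_eq_sqrt hBL, Real.sq_sqrt]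
        exact integral_nonneg fun ω => by positivity
      have h8 : lpNorm B 2 P ≤ (1 / ((k + 1 : ℕ) : ℝ)) * (‖A‖ * lpNorm (walk X (k + 1)) 2 P) := by
        have h9 : B = (1 / ((k + 1 : ℕ) : ℝ)) • fun ω => act A (walk X (k + 1) ω) := rfl
        rw [h9, lpNorm_const_smul, coe_nnnorm, Real.norm_of_nonneg (by positivity)]
        gcongr
        exact lpNorm_act_le (memLp_walk h2 _) A
      rw [h7] at h6
      refine h6.trans ?_
      calc _ ≤ ((1 / ((k + 1 : ℕ) : ℝ)) * (‖A‖ * lpNorm (walk X (k + 1)) 2 P)) ^ 2 := by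
            have := lpNorm_nonneg (f := B) (p := 2) (μ := P)
            gcongr
        _ = _ := by ring

/-- The innovations of a linear walk satisfy the hypotheses of the central limit theorem. -/
theorem exists_isNoise (hX : IsLinearWalk P X A Sig Err) {a b c C : ℝ}
    (hr : HasRates A a b c C) :
    ∃ (q C' M V : ℝ) (e : ℕ → ℝ), 0 ≤ M ∧ IsNoise P hX.pastFiltration (noise A X) Sig q C' e ∧
      IsMartingaleDiff P hX.pastFiltration (noise A X) V ∧
      ∀ n, 1 ≤ n → MemLp (X n) 2 P ∧ lpNorm (X n) 2 P ≤ M := by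
  obtain ⟨q, hq2, hq3, M, hM, hq⟩ := hX.exists_lpNorm_le
  have hq0 : 0 < q := by linarith
  have h2q : (2 : ENNReal) ≤ ENNReal.ofReal q := by
    rw [← ENNReal.ofReal_ofNat]
    exact ENNReal.ofReal_le_ofReal hq2.le
  have h1q : (1 : ENNReal) ≤ ENNReal.ofReal q := le_trans (by norm_num) h2q
  have h2 : ∀ n, 1 ≤ n → MemLp (X n) 2 P ∧ lpNorm (X n) 2 P ≤ M := fun n hn =>
    ⟨(hq n hn).1.mono_exponent h2q, (lpNorm_mono_exponent h2q (hq n hn).1).trans (hq n hn).2⟩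
  refine ⟨q, (M + ‖A‖ * M) ^ q, M, (M + ‖A‖ * M) ^ 2, covError P X A Sig Err, hM, ?_,
    hX.isMartingaleDiff hM h2, h2⟩
  have hn := memLp_noise (fun n hn => (hq n hn).1) A
  refine ⟨hq2, hq3, hX.measurable_noise, fun k => ?_, fun k => ?_,
    hX.integral_mul_noise fun n hn => (h2 n hn).1,
    hX.abs_integral_cov_le fun n hn => (h2 n hn).1, covError_nonneg, hX.tendsto_covError hr hM h2⟩
  · have := (integrable_norm_rpow_iff (hn k).1 (by simpa using hq0) ENNReal.ofReal_ne_top).2 (hn k)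
    rwa [ENNReal.toReal_ofReal hq0.le] at this
  · have h3 := lpNorm_noise_le h1q hM hq A k
    rw [lpNorm_eq_integral_norm_rpow_toReal (by simpa using hq0) ENNReal.ofReal_ne_top (hn k).1,
      ENNReal.toReal_ofReal hq0.le] at h3
    have hI : 0 ≤ ∫ ω, ‖noise A X (k + 1) ω‖ ^ q ∂P := integral_nonneg fun ω => by positivity
    calc _ = ((∫ ω, ‖noise A X (k + 1) ω‖ ^ q ∂P) ^ q⁻¹) ^ q := by
          rw [← Real.rpow_mul hI, inv_mul_cancel₀ hq0.ne', Real.rpow_one]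
      _ ≤ _ := by gcongr

end IsLinearWalk

end WalkMoments

/-! ### Almost sure convergence of the unstable component. -/

section AlmostSureConvergence

open scoped Matrix.Norms.Frobenius

variable {Ω : Type*} {mΩ : MeasurableSpace Ω} {P : Measure Ω} {d : ℕ}

/-- By monotone convergence the sum of the norms has finite mean. -/
theorem ae_summable_norm_of_lpNorm_le {E : Type*} [NormedAddCommGroup E] {f : ℕ → Ω → E} {u : ℕ → ℝ}
    (hf : ∀ k, MemLp (f k) 1 P) (hu : ∀ k, lpNorm (f k) 1 P ≤ u k) (hs : Summable u) :
    ∀ᵐ ω ∂P, Summable fun k => ‖f k ω‖ := by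
  have h1 : ∫⁻ ω, ∑' k, ‖f k ω‖ₑ ∂P ≠ ⊤ := by
    rw [lintegral_tsum fun k => (hf k).1.enorm]
    refine ne_top_of_le_ne_top (hs.tsum_ofReal_ne_top) (ENNReal.tsum_le_tsum fun k => ?_)
    rw [← eLpNorm_one_eq_lintegral_enorm, ← ENNReal.ofReal_toReal (hf k).2.ne,
      toReal_eLpNorm (hf k).1]
    exact ENNReal.ofReal_le_ofReal (hu k)
  filter_upwards [ae_lt_top' (AEMeasurable.tsum fun k => (hf k).1.enorm) h1] with ω hω
  exact (ENNReal.tsum_coe_ne_top_iff_summable_coe (f := fun k => ‖f k ω‖₊)).1 hω.ne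

namespace IsMartingaleDiff

variable {F : Filtration ℕ mΩ} {ε : ℕ → Ω → EuclideanSpace ℝ (Fin d)} {V : ℝ}

theorem memLp_sum_Ioc (h : IsMartingaleDiff P F ε V) (M : ℕ → Matrix (Fin d) (Fin d) ℝ)
    (m n : ℕ) : MemLp (fun ω => ∑ k ∈ Finset.Ioc m n, act (M k) (ε k ω)) 2 P :=
  memLp_finsetSum _ fun _ hk => MemLp_act (h.memLp_of_mem (n := n)
    (Finset.mem_Ioc.2 ⟨by have := Finset.mem_Ioc.1 hk; omega, (Finset.mem_Ioc.1 hk).2⟩)) _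

theorem lpNorm_two_sum_Ioc_le (h : IsMartingaleDiff P F ε V) (M : ℕ → Matrix (Fin d) (Fin d) ℝ)
    (m n : ℕ) : lpNorm (fun ω => ∑ k ∈ Finset.Ioc m n, act (M k) (ε k ω)) 2 P ≤
      Real.sqrt (V * ∑ k ∈ Finset.Ioc m n, ‖M k‖ ^ 2) := by
  have hf : Finset.Ioc m n = (Finset.Ioc 0 n).filter fun k => m < k := by
    ext k
    simp only [Finset.mem_Ioc, Finset.mem_filter]
    omega
  have h1 := h.lpNorm_two_sum_le (fun k => if m < k then M k else 0) n
  rw [hf, Finset.sum_filter]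
  simp only [Finset.sum_filter]
  convert h1 using 7 with ω k k
  · split_ifs <;> simp [act]
  · split_ifs <;> simp

variable [IsProbabilityMeasure P]

/-- Weighted sums of martingale differences with square summable weights converge. -/
theorem ae_exists_tendsto (h : IsMartingaleDiff P F ε V) (M : ℕ → Matrix (Fin d) (Fin d) ℝ) {K : ℝ}
    (hK : ∀ n, ∑ k ∈ Finset.Ioc 0 n, ‖M k‖ ^ 2 ≤ K) :
    ∀ᵐ ω ∂P, ∃ l, Tendsto (fun n => ∑ k ∈ Finset.Ioc 0 n, act (M k) (ε k ω)) atTop (𝓝 l) := by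
  set Y : ℕ → Ω → EuclideanSpace ℝ (Fin d) :=
    fun n ω => ∑ k ∈ Finset.Ioc 0 n, act (M k) (ε k ω) with hY
  have hYL : ∀ n i, MemLp (fun ω => Y n ω i) 2 P := fun n i => memLp_apply (h.memLp_sum M n) i
  have hYi : ∀ n i, Integrable (fun ω => Y n ω i) P := fun n i => (hYL n i).integrable (by norm_num)
  -- The scalar convergence theorem is applied to each coordinate; an L² bound gives the required L¹
  -- bound.
  have hmart : ∀ i, Martingale (fun n ω => Y n ω i) F P := by
    intro i
    refine martingale_of_condExp_sub_eq_zero_nat (fun n => ?_) (fun n => hYi n i) fun n => ?_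
    · exact ((EuclideanSpace.proj (𝕜 := ℝ) i).continuous.measurable.comp
        (h.measurable_sum M n)).stronglyMeasurable
    · refine (ae_eq_condExp_of_forall_setIntegral_eq (F.le n) ((hYi (n + 1) i).sub (hYi n i))
        (fun s _ _ => integrableOn_zero) (fun s hs _ => ?_) aestronglyMeasurable_zero).symm
      -- Orthogonality to the indicator of a past event times a basis vector says that the
      -- coordinate increment integrates to zero over that event.
      have h1 := h.integral_inner_eq_zero (k := n)
        (Y := s.indicator fun _ => EuclideanSpace.single i 1)
        (measurable_const.indicator hs)
        ((memLp_const (EuclideanSpace.single i (1 : ℝ))).indicator (F.le n _ hs)) (M (n + 1))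
      have h2 : ∀ ω, inner ℝ (s.indicator (fun _ => EuclideanSpace.single i (1 : ℝ)) ω)
          (act (M (n + 1)) (ε (n + 1) ω)) =
          s.indicator ((fun ω => Y (n + 1) ω i) - fun ω => Y n ω i) ω := by
        intro ω
        by_cases hω : ω ∈ s
        · rw [Set.indicator_of_mem hω, Set.indicator_of_mem hω, Pi.sub_apply, hY]
          simp only
          rw [← Finset.insert_Ioc_right_eq_Ioc_add_one (Nat.zero_le n),
            Finset.sum_insert (by simp), PiLp.add_apply, add_sub_cancel_right,
            EuclideanSpace.inner_single_left]
          simp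
        · rw [Set.indicator_of_notMem hω, Set.indicator_of_notMem hω, inner_zero_left]
      simp only [h2] at h1
      rw [integral_indicator (F.le n _ hs)] at h1
      simpa using h1.symm
  have hbdd : ∀ i n, eLpNorm (fun ω => Y n ω i) 1 P ≤ (Real.sqrt (V * K)).toNNReal := by
    intro i n
    have h1 : eLpNorm (fun ω => Y n ω i) 1 P ≤ eLpNorm (Y n) 2 P :=
      (eLpNorm_mono fun ω => PiLp.norm_apply_le (Y n ω) i).trans
        (eLpNorm_le_eLpNorm_of_exponent_le (by norm_num) (h.memLp_sum M n).1)
    refine h1.trans ?_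
    rw [← ENNReal.ofReal_toReal (h.memLp_sum M n).2.ne, toReal_eLpNorm (h.memLp_sum M n).1]
    refine ENNReal.ofReal_le_ofReal ((h.lpNorm_two_sum_le M n).trans (Real.sqrt_le_sqrt ?_))
    exact mul_le_mul_of_nonneg_left (hK n) h.nonneg
  have hconv : ∀ᵐ ω ∂P, ∀ i, ∃ l, Tendsto (fun n => Y n ω i) atTop (𝓝 l) := by
    rw [ae_all_iff]
    intro i
    filter_upwards [(hmart i).submartingale.exists_ae_tendsto_of_bdd (hbdd i)] with ω hω
    exact hω
  filter_upwards [hconv] with ω hω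
  choose l hl using hω
  exact ⟨WithLp.toLp 2 l, ((PiLp.continuous_toLp 2 _).tendsto l).comp (tendsto_pi_nhds.2 hl)⟩

end IsMartingaleDiff

namespace IsLinearWalk

variable {X : ℕ → Ω → EuclideanSpace ℝ (Fin d)} {A Sig : Matrix (Fin d) (Fin d) ℝ}
  {Err : ℕ → Ω → Matrix (Fin d) (Fin d) ℝ} {a b c C : ℝ} {F : Filtration ℕ mΩ} {V M : ℝ}

/-- The rescaled unstable component of the walk converges almost surely. -/
theorem ae_exists_tendsto_unstable [IsProbabilityMeasure P] (hr : HasRates A a b c C)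
    (hD : IsMartingaleDiff P F (noise A X) V)
    (h2 : ∀ n, 1 ≤ n → MemLp (X n) 2 P ∧ lpNorm (X n) 2 P ≤ M) :
    ∀ᵐ ω ∂P, ∃ l, Tendsto (fun n : ℕ => act (projU A * flow A (-Real.log n)) (walk X n ω)) atTop
      (𝓝 l) := by
  have hC := hr.C_pos
  have hM : 0 ≤ M := lpNorm_nonneg.trans (h2 1 le_rfl).2
  have hU : ∀ k : ℕ, 1 ≤ k → ‖projU A * flow A (-Real.log k)‖ ≤ C * (k : ℝ) ^ (-c) := by
    intro k hk
    have h := hr.unstable 1 k le_rfl hk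
    rw [Nat.cast_one, Real.log_one, zero_sub, Real.one_rpow, one_mul,
      flow_mul_comm (mul_projU A)] at h
    exact h
  have h1 := hD.ae_exists_tendsto (fun k => projU A * flow A (-Real.log k))
    (K := C ^ 2 * ∑' k : ℕ, (k : ℝ) ^ (-(2 * c))) (fun n => by
      calc _ ≤ ∑ k ∈ Finset.Ioc 0 n, C ^ 2 * (k : ℝ) ^ (-(2 * c)) := by
            refine Finset.sum_le_sum fun k hk => ?_
            calc _ ≤ (C * (k : ℝ) ^ (-c)) ^ 2 := by
                  gcongr
                  exact hU k (Finset.mem_Ioc.1 hk).1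
              _ = _ := by rw [mul_pow, rpow_sq k.cast_nonneg]; ring_nf
        _ ≤ _ := by
            rw [← Finset.mul_sum]
            gcongr
            exact sum_rpow_le_tsum (by linarith [hr.c_gt]) _)
  have h1p : ∀ n, 1 ≤ n → MemLp (X n) 1 P ∧ lpNorm (X n) 1 P ≤ M := fun n hn =>
    ⟨(h2 n hn).1.mono_exponent (by norm_num),
      (lpNorm_mono_exponent (by norm_num) (h2 n hn).1).trans (h2 n hn).2⟩
  -- The defect series converges absolutely: its L¹ norms are O(k^{-c-1}).
  have h3 : ∀ᵐ ω ∂P, Summable fun k : ℕ =>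
      ‖act (projU A * flow A (-Real.log k) * defect A k) (walk X k ω)‖ := by
    refine ae_summable_norm_of_lpNorm_le (u := fun k : ℕ => C * (C * M) * (k : ℝ) ^ (-(c + 1)))
      (fun k => MemLp_act (memLp_walk (fun n hn => (h1p n hn).1) k) _) (fun k => ?_)
      ((summable_natCast_rpow (by linarith [hr.c_gt])).mul_left _)
    refine (lpNorm_defect_le hr le_rfl h1p _ k).trans ?_
    rcases Nat.eq_zero_or_pos k with rfl | hk
    · have : 0 ≤ ((0 : ℕ) : ℝ) ^ (-(c + 1)) := by positivity
      simp only [Nat.cast_zero, div_zero, mul_zero] at this ⊢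
      positivity
    · have hk0 : (0 : ℝ) < k := by exact_mod_cast hk
      calc _ ≤ (C * (k : ℝ) ^ (-c)) * (C * M * (1 / (k : ℝ))) := by
            gcongr
            exact hU k hk
        _ = _ := by
            rw [neg_add, ← sub_eq_add_neg, Real.rpow_sub_one hk0.ne']
            ring
  filter_upwards [h1, h3] with ω ⟨l, hl⟩ hs
  refine ⟨_, (hl.add hs.of_norm.hasSum.tendsto_sum_nat).congr fun n => ?_⟩
  exact (act_flow_walk (projU A) A X n ω).symm

end IsLinearWalk

end AlmostSureConvergence

/-! ### Reduction to weighted sums of innovations. -/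

section Remainders

open scoped Matrix.Norms.Frobenius

theorem sum_Ioc_sq_ite_le {E : Type*} [AddCommMonoid E] (g : ℕ → E) (n : ℕ) :
    ∑ k ∈ Finset.Ioc 0 (n ^ 2), (if k ≤ n then g k else 0) = ∑ k ∈ Finset.Ioc 0 n, g k := by
  rw [← Finset.sum_filter]
  congr 1
  ext k
  have := Nat.le_self_pow two_ne_zero n
  simp only [Finset.mem_filter, Finset.mem_Ioc]
  omega

theorem sum_Ioc_sq_ite_lt {E : Type*} [AddCommMonoid E] (g : ℕ → E) (n : ℕ) :
    ∑ k ∈ Finset.Ioc 0 (n ^ 2), (if n < k then g k else 0) = ∑ k ∈ Finset.Ioc n (n ^ 2), g k := by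
  rw [← Finset.sum_filter]
  congr 1
  ext k
  simp only [Finset.mem_filter, Finset.mem_Ioc]
  omega

theorem inv_sqrt_natCast (n : ℕ) : (Real.sqrt n)⁻¹ = (n : ℝ) ^ (-(1 / 2) : ℝ) := by
  rw [Real.sqrt_eq_rpow, Real.rpow_neg n.cast_nonneg]

theorem rpow_neg_add_le {m k : ℝ} (hm : 0 < m) (hmk : m ≤ k) {s t : ℝ} (ht : 0 ≤ t) :
    k ^ (-(s + t)) ≤ m ^ (-t) * k ^ (-s) := by
  have hk := hm.trans_le hmk
  rw [neg_add, Real.rpow_add hk, mul_comm]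
  exact mul_le_mul_of_nonneg_right (Real.rpow_le_rpow_of_nonpos hm hmk (by linarith)) (by positivity)

variable {Ω : Type*} {mΩ : MeasurableSpace Ω} {P : Measure Ω} {d : ℕ}
  {X : ℕ → Ω → EuclideanSpace ℝ (Fin d)} {A Sig : Matrix (Fin d) (Fin d) ℝ}
  {a b c C : ℝ} {F : Filtration ℕ mΩ} {V M : ℝ}

/-- The weight of the innovation `ε_k` in the stable component. -/
noncomputable def weightS (A : Matrix (Fin d) (Fin d) ℝ) (n k : ℕ) : Matrix (Fin d) (Fin d) ℝ :=
  if k ≤ n then (Real.sqrt n)⁻¹ • (flow A (Real.log n - Real.log k) * projS A) else 0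

/-- The weight of the innovation `ε_k` in the critical component, before normalization. -/
noncomputable def weightC (A : Matrix (Fin d) (Fin d) ℝ) (n k : ℕ) : Matrix (Fin d) (Fin d) ℝ :=
  if k ≤ n then flow A (-Real.log k) * projC A else 0

/-- The weight of the innovation `ε_k` in the unstable component. -/
noncomputable def weightU (A : Matrix (Fin d) (Fin d) ℝ) (n k : ℕ) : Matrix (Fin d) (Fin d) ℝ :=
  if n < k then -(Real.sqrt n)⁻¹ • (flow A (Real.log n - Real.log k) * projU A) else 0

/-- The remainder of the stable component. -/
noncomputable def remS (A : Matrix (Fin d) (Fin d) ℝ) (X : ℕ → Ω → EuclideanSpace ℝ (Fin d))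
    (n : ℕ) (ω : Ω) : EuclideanSpace ℝ (Fin d) :=
  (Real.sqrt n)⁻¹ • act (projS A) (walk X n ω) -
    ∑ k ∈ Finset.Ioc 0 (n ^ 2), act (weightS A n k) (noise A X k ω)

/-- The remainder of the critical component, before normalization. -/
noncomputable def remC (A : Matrix (Fin d) (Fin d) ℝ) (X : ℕ → Ω → EuclideanSpace ℝ (Fin d))
    (n : ℕ) (ω : Ω) : EuclideanSpace ℝ (Fin d) :=
  act (natPow n (-(A * projC A)) * projC A) (walk X n ω) -
    ∑ k ∈ Finset.Ioc 0 (n ^ 2), act (weightC A n k) (noise A X k ω)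

/-- The remainder of the unstable component. -/
noncomputable def remU (A : Matrix (Fin d) (Fin d) ℝ) (X : ℕ → Ω → EuclideanSpace ℝ (Fin d))
    (W : Ω → EuclideanSpace ℝ (Fin d)) (n : ℕ) (ω : Ω) : EuclideanSpace ℝ (Fin d) :=
  (Real.sqrt n)⁻¹ • (act (projU A) (walk X n ω) - act (natPow n (A * projU A)) (W ω)) -
    ∑ k ∈ Finset.Ioc 0 (n ^ 2), act (weightU A n k) (noise A X k ω)

theorem zero_act {𝕜 : Type*} [RCLike 𝕜] (v : EuclideanSpace 𝕜 (Fin d)) : act 0 v = 0 := by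
  simp [act]

theorem flow_mul_proj_mul_flow {A Q : Matrix (Fin d) (Fin d) ℝ} (h : A * Q = Q * A) (s t : ℝ) :
    flow A s * Q * flow A (-t) = flow A (s - t) * Q := by
  rw [mul_assoc, ← flow_mul_comm h, ← mul_assoc, ← flow_add, sub_eq_add_neg]

/-- In variation of constants the noise part is exactly the weighted sum that is subtracted, so only
the defects remain. -/
theorem remS_eq (A : Matrix (Fin d) (Fin d) ℝ) (X : ℕ → Ω → EuclideanSpace ℝ (Fin d))
    (n : ℕ) (ω : Ω) : remS A X n ω = (Real.sqrt n)⁻¹ • ∑ k ∈ Finset.range n,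
      act (flow A (Real.log n - Real.log k) * projS A * defect A k) (walk X k ω) := by
  have h := act_flow_walk (flow A (Real.log n) * projS A) A X n ω
  simp only [flow_mul_proj_mul_flow (mul_projS A), sub_self, flow_zero, one_mul] at h
  have e : ∑ k ∈ Finset.Ioc 0 (n ^ 2), act (weightS A n k) (noise A X k ω) =
      (Real.sqrt n)⁻¹ • ∑ k ∈ Finset.Ioc 0 n,
        act (flow A (Real.log n - Real.log k) * projS A) (noise A X k ω) := by
    rw [Finset.smul_sum]
    refine Eq.trans ?_ (sum_Ioc_sq_ite_le _ n)
    refine Finset.sum_congr rfl fun k _ => ?_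
    rw [weightS]
    split_ifs
    · rw [smul_act]
    · rw [zero_act]
  rw [remS, e, h, ← smul_sub, add_sub_cancel_left]

theorem remC_eq (A : Matrix (Fin d) (Fin d) ℝ) (X : ℕ → Ω → EuclideanSpace ℝ (Fin d))
    (n : ℕ) (ω : Ω) : remC A X n ω = ∑ k ∈ Finset.range n,
      act (flow A (-Real.log k) * projC A * defect A k) (walk X k ω) := by
  have h := act_flow_walk (flow A 0 * projC A) A X n ω
  simp only [flow_mul_proj_mul_flow (mul_projC A), zero_sub] at h
  have e : ∑ k ∈ Finset.Ioc 0 (n ^ 2), act (weightC A n k) (noise A X k ω) =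
      ∑ k ∈ Finset.Ioc 0 n, act (flow A (-Real.log k) * projC A) (noise A X k ω) := by
    refine Eq.trans ?_ (sum_Ioc_sq_ite_le _ n)
    refine Finset.sum_congr rfl fun k _ => ?_
    rw [weightC]
    split_ifs
    · rfl
    · rw [zero_act]
  rw [remC, e, natPow_neg_mul_proj (projC_mul_self A) (mul_projC A), h, add_sub_cancel_left]

/-- The approximation of the remainder of the unstable component at the horizon `N`. -/
noncomputable def remUAt (A : Matrix (Fin d) (Fin d) ℝ) (X : ℕ → Ω → EuclideanSpace ℝ (Fin d))
    (n N : ℕ) (ω : Ω) : EuclideanSpace ℝ (Fin d) :=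
  -(Real.sqrt n)⁻¹ • (∑ k ∈ Finset.Ioc (n ^ 2) N,
      act (flow A (Real.log n - Real.log k) * projU A) (noise A X k ω) +
    ∑ k ∈ Finset.Ico n N,
      act (flow A (Real.log n - Real.log k) * projU A * defect A k) (walk X k ω))

/-- Difference of variation of constants at `n` and at the horizon `N`: the innovations between `n`
and n² form the weighted sum, those beyond n² and the defects form the remainder. As `N` grows, the
pulled-back walk becomes W_u. -/
theorem remUAt_eq (A : Matrix (Fin d) (Fin d) ℝ) (X : ℕ → Ω → EuclideanSpace ℝ (Fin d))
    {n N : ℕ} (hN : n ^ 2 ≤ N) (ω : Ω) :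
    remUAt A X n N ω = (Real.sqrt n)⁻¹ • (act (projU A) (walk X n ω) -
      act (flow A (Real.log n) * projU A) (act (projU A * flow A (-Real.log N)) (walk X N ω))) -
      ∑ k ∈ Finset.Ioc 0 (n ^ 2), act (weightU A n k) (noise A X k ω) := by
  have hn2 := Nat.le_self_pow two_ne_zero n
  have h1 := act_flow_walk (flow A (Real.log n) * projU A) A X n ω
  have h2 := act_flow_walk (flow A (Real.log n) * projU A) A X N ω
  have e0 : act (flow A (Real.log n) * projU A) (act (projU A * flow A (-Real.log N)) (walk X N ω))
      = act (flow A (Real.log n) * projU A * flow A (-Real.log N)) (walk X N ω) := by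
    rw [← mul_act]
    congr 1
    rw [mul_assoc, ← mul_assoc (projU A), projU_mul_self, mul_assoc]
  simp only [flow_mul_proj_mul_flow (mul_projU A)] at h1 h2 e0
  rw [sub_self, flow_zero, one_mul] at h1
  have e : ∑ k ∈ Finset.Ioc 0 (n ^ 2), act (weightU A n k) (noise A X k ω) =
      -(Real.sqrt n)⁻¹ • ∑ k ∈ Finset.Ioc n (n ^ 2),
        act (flow A (Real.log n - Real.log k) * projU A) (noise A X k ω) := by
    rw [Finset.smul_sum, ← sum_Ioc_sq_ite_lt]
    refine Finset.sum_congr rfl fun k _ => ?_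
    rw [weightU]
    split_ifs
    · rw [smul_act]
    · rw [zero_act]
  have e1 := Finset.sum_Ioc_consecutive (fun k : ℕ =>
    act (flow A (Real.log n - Real.log k) * projU A) (noise A X k ω)) (Nat.zero_le n) (hn2.trans hN)
  have e2 := Finset.sum_Ioc_consecutive (fun k : ℕ =>
    act (flow A (Real.log n - Real.log k) * projU A) (noise A X k ω)) hn2 hN
  have e3 := Finset.sum_range_add_sum_Ico (fun k : ℕ =>
    act (flow A (Real.log n - Real.log k) * projU A * defect A k) (walk X k ω)) (hn2.trans hN)
  rw [e0, e, h1, h2, ← e1, ← e2, ← e3, remUAt, neg_smul, neg_smul, sub_neg_eq_add, ← smul_neg,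
    ← smul_add]
  congr 1
  abel

theorem exists_eLpNorm_remS_le (hr : HasRates A a b c C)
    (h1 : ∀ n, 1 ≤ n → MemLp (X n) 1 P ∧ lpNorm (X n) 1 P ≤ M) :
    ∃ K : ℝ, ∀ n : ℕ, 1 ≤ n →
      eLpNorm (remS A X n) 1 P ≤ ENNReal.ofReal (K * (n : ℝ) ^ (a - 1 / 2)) := by
  have hC := hr.C_pos
  have hM : 0 ≤ M := lpNorm_nonneg.trans (h1 1 le_rfl).2
  refine ⟨C * (C * M) * ∑' k : ℕ, (k : ℝ) ^ (-(a + 1)), fun n hn => ?_⟩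
  have hn0 : (0 : ℝ) < n := by exact_mod_cast hn
  have h := IsLinearWalk.lpNorm_sum_defect_le hr le_rfl hM h1
    (fun k => flow A (Real.log n - Real.log k) * projS A) (Finset.range n)
    (K := C * (n : ℝ) ^ a) (t := -a) (by linarith [hr.a_pos]) (fun k hk hk1 => by
      rw [mul_assoc]
      exact hr.stable n k hk1 (Finset.mem_range.1 hk).le)
  have e : remS A X n = (Real.sqrt n)⁻¹ • fun ω => ∑ k ∈ Finset.range n,
      act (flow A (Real.log n - Real.log k) * projS A * defect A k) (walk X k ω) :=
    funext fun ω => remS_eq A X n ω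
  have hm := h.1.const_smul (Real.sqrt n)⁻¹
  rw [e, ← ENNReal.ofReal_toReal hm.2.ne, toReal_eLpNorm hm.1, lpNorm_const_smul, coe_nnnorm,
    Real.norm_of_nonneg (by positivity)]
  refine ENNReal.ofReal_le_ofReal ?_
  have h5 : ∑ k ∈ Finset.range n, (k : ℝ) ^ (-a - 1) ≤ ∑' k : ℕ, (k : ℝ) ^ (-(a + 1)) := by
    rw [show -a - 1 = -(a + 1) by ring]
    exact sum_rpow_le_tsum (by linarith [hr.a_pos]) _
  calc _ ≤ (n : ℝ) ^ (-(1 / 2) : ℝ) * (C * (n : ℝ) ^ a * (C * M) *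
        ∑' k : ℕ, (k : ℝ) ^ (-(a + 1))) := by
        rw [inv_sqrt_natCast]
        gcongr
        exact h.2.trans (by gcongr)
    _ = _ := by
        rw [sub_eq_add_neg, Real.rpow_add hn0]
        ring

/-- The critical defects are of size k^{-5/4} in L¹, hence summable; decay in `n` is left to D_n⁻¹.
-/
theorem exists_eLpNorm_remC_le (hr : HasRates A a b c C)
    (h1 : ∀ n, 1 ≤ n → MemLp (X n) 1 P ∧ lpNorm (X n) 1 P ≤ M) :
    ∃ K : ℝ, ∀ n : ℕ, eLpNorm (remC A X n) 1 P ≤ ENNReal.ofReal K := by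
  have hC := hr.C_pos
  have hM : 0 ≤ M := lpNorm_nonneg.trans (h1 1 le_rfl).2
  refine ⟨C * (C * M) * ∑' k : ℕ, (k : ℝ) ^ (-(5 / 4) : ℝ), fun n => ?_⟩
  have h := IsLinearWalk.lpNorm_sum_defect_le hr le_rfl hM h1
    (fun k => flow A (-Real.log k) * projC A) (Finset.range n)
    (K := C) (t := -(1 / 4)) (by norm_num) (fun k hk hk1 => hr.critical k hk1)
  have e : remC A X n = fun ω => ∑ k ∈ Finset.range n,
      act (flow A (-Real.log k) * projC A * defect A k) (walk X k ω) :=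
    funext fun ω => remC_eq A X n ω
  rw [e, ← ENNReal.ofReal_toReal h.1.2.ne, toReal_eLpNorm h.1.1]
  refine ENNReal.ofReal_le_ofReal (h.2.trans ?_)
  gcongr
  rw [show (-(1 / 4) - 1 : ℝ) = -(5 / 4) by norm_num]
  exact sum_rpow_le_tsum (by norm_num) _

variable [IsProbabilityMeasure P]

/-- The bound is uniform in `N`, as Fatou's lemma will require. Noise beyond n² is estimated by
orthogonality, the defects by summing their norms, both after division by √n. -/
theorem exists_eLpNorm_remUAt_le (hr : HasRates A a b c C)
    (hD : IsMartingaleDiff P F (noise A X) V)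
    (h1 : ∀ n, 1 ≤ n → MemLp (X n) 1 P ∧ lpNorm (X n) 1 P ≤ M) :
    ∃ K : ℝ, ∀ n N : ℕ, 1 ≤ n → AEStronglyMeasurable (remUAt A X n N) P ∧
      eLpNorm (remUAt A X n N) 1 P ≤
        ENNReal.ofReal (K * ((n : ℝ) ^ (-((2 * c - 1) / 4)) + (n : ℝ) ^ (-(1 / 4) : ℝ))) := by
  have hC := hr.C_pos
  have hc := hr.c_gt
  have hM : 0 ≤ M := lpNorm_nonneg.trans (h1 1 le_rfl).2
  have hV := hD.nonneg
  -- Thus 2c = 1 + 4η: the exponent 1 + η is kept for summability, and 3η is spent on k ≥ n², giving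
  -- the factor n^{-6η}.
  set η := (2 * c - 1) / 4 with hη
  have hη0 : 0 < η := by rw [hη]; linarith
  set Z1 := ∑' k : ℕ, (k : ℝ) ^ (-(1 + η))
  set Z2 := ∑' k : ℕ, (k : ℝ) ^ (-(5 / 4) : ℝ)
  have hZ1 : 0 ≤ Z1 := tsum_nonneg fun k => by positivity
  have hZ2 : 0 ≤ Z2 := tsum_nonneg fun k => by positivity
  set K1 := Real.sqrt (V * (C ^ 2 * Z1))
  set K2 := C * (C * M) * Z2
  have hK1 : 0 ≤ K1 := Real.sqrt_nonneg _
  have hK2 : 0 ≤ K2 := by positivity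
  refine ⟨K1 + K2, fun n N hn => ?_⟩
  have hn0 : (0 : ℝ) < n := by exact_mod_cast hn
  have hU : ∀ k, n ≤ k → ‖flow A (Real.log n - Real.log k) * projU A‖ ≤
      C * (n : ℝ) ^ c * (k : ℝ) ^ (-c) := fun k hk => by
    rw [mul_assoc]; exact hr.unstable n k hn hk
  have hd := IsLinearWalk.lpNorm_sum_defect_le hr le_rfl hM h1
    (fun k => flow A (Real.log n - Real.log k) * projU A) (Finset.Ico n N)
    (K := C * (n : ℝ) ^ c) (t := -c) (by linarith) (fun k hk _ => hU k (Finset.mem_Ico.1 hk).1)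
  have hm2 := hD.memLp_sum_Ioc (fun k => flow A (Real.log n - Real.log k) * projU A) (n ^ 2) N
  have hm1 := hm2.mono_exponent (show (1 : ENNReal) ≤ 2 by norm_num)
  have hl := (lpNorm_mono_exponent (show (1 : ENNReal) ≤ 2 by norm_num) hm2).trans
    (hD.lpNorm_two_sum_Ioc_le _ _ _)
  set f1 := fun ω => ∑ k ∈ Finset.Ioc (n ^ 2) N,
    act (flow A (Real.log n - Real.log k) * projU A) (noise A X k ω)
  set f2 := fun ω => ∑ k ∈ Finset.Ico n N,
    act (flow A (Real.log n - Real.log k) * projU A * defect A k) (walk X k ω)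
  have e : remUAt A X n N = -(Real.sqrt n)⁻¹ • (f1 + f2) := rfl
  have hm := (hm1.add hd.1).const_smul (-(Real.sqrt n)⁻¹)
  refine ⟨hm.1, ?_⟩
  rw [e, ← ENNReal.ofReal_toReal hm.2.ne, toReal_eLpNorm hm.1, lpNorm_const_smul, coe_nnnorm,
    norm_neg, Real.norm_of_nonneg (by positivity)]
  refine ENNReal.ofReal_le_ofReal ?_
  have s1 : ∑ k ∈ Finset.Ioc (n ^ 2) N, ‖flow A (Real.log n - Real.log k) * projU A‖ ^ 2 ≤
      (C ^ 2 * Z1) * ((n : ℝ) ^ (1 / 2 - η)) ^ 2 := by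
    calc _ ≤ ∑ k ∈ Finset.Ioc (n ^ 2) N,
          C ^ 2 * ((n : ℝ) ^ (1 / 2 - η)) ^ 2 * (k : ℝ) ^ (-(1 + η)) := by
          refine Finset.sum_le_sum fun k hk => ?_
          have hk1 : n ^ 2 < k := (Finset.mem_Ioc.1 hk).1
          have hnk : n ≤ k := (Nat.le_self_pow two_ne_zero n).trans hk1.le
          have hm0 : (0 : ℝ) < (n : ℝ) ^ 2 := by positivity
          have h6 := rpow_neg_add_le hm0 (show (n : ℝ) ^ 2 ≤ k by exact_mod_cast hk1.le)
            (s := 1 + η) (t := 3 * η) (by positivity)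
          calc _ ≤ (C * (n : ℝ) ^ c * (k : ℝ) ^ (-c)) ^ 2 := by
                gcongr
                exact hU k hnk
            _ = C ^ 2 * (n : ℝ) ^ (2 * c) * (k : ℝ) ^ (-(1 + η + 3 * η)) := by
                rw [mul_pow, mul_pow, rpow_sq k.cast_nonneg, rpow_sq hn0.le, hη]
                ring_nf
            _ ≤ C ^ 2 * (n : ℝ) ^ (2 * c) * (((n : ℝ) ^ 2) ^ (-(3 * η)) * (k : ℝ) ^ (-(1 + η))) := by
                gcongr
            _ = _ := by
                rw [← Real.rpow_natCast_mul hn0.le, rpow_sq hn0.le, ← mul_assoc, mul_assoc (C ^ 2),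
                  ← Real.rpow_add hn0]
                congr 3
                push_cast
                rw [hη]
                ring
      _ ≤ C ^ 2 * ((n : ℝ) ^ (1 / 2 - η)) ^ 2 * Z1 := by
          rw [← Finset.mul_sum]
          gcongr
          exact sum_rpow_le_tsum (by linarith) _
      _ = _ := by ring
  have l1 : lpNorm f1 1 P ≤ K1 * (n : ℝ) ^ (1 / 2 - η) := by
    refine hl.trans ?_
    calc _ ≤ Real.sqrt (V * (C ^ 2 * Z1) * ((n : ℝ) ^ (1 / 2 - η)) ^ 2) := by
          refine Real.sqrt_le_sqrt ?_
          rw [mul_assoc]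
          gcongr
      _ = _ := by rw [Real.sqrt_mul (by positivity), Real.sqrt_sq (by positivity)]
  -- Of the exponent c + 1, 5/4 is kept for summability and c - 1/4 is spent on k ≥ n.
  have l2 : lpNorm f2 1 P ≤ K2 * (n : ℝ) ^ (1 / 4 : ℝ) := by
    have h5 : ∑ k ∈ Finset.Ico n N, (k : ℝ) ^ (-c - 1) ≤ (n : ℝ) ^ (-(c - 1 / 4)) * Z2 := by
      calc _ ≤ ∑ k ∈ Finset.Ico n N, (n : ℝ) ^ (-(c - 1 / 4)) * (k : ℝ) ^ (-(5 / 4) : ℝ) := by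
            refine Finset.sum_le_sum fun k hk => ?_
            have hk1 : n ≤ k := (Finset.mem_Ico.1 hk).1
            have h6 := rpow_neg_add_le hn0 (show (n : ℝ) ≤ k by exact_mod_cast hk1)
              (s := 5 / 4) (t := c - 1 / 4) (by linarith)
            rwa [show -(5 / 4 + (c - 1 / 4)) = -c - 1 by ring] at h6
        _ ≤ _ := by
            rw [← Finset.mul_sum]
            gcongr
            exact sum_rpow_le_tsum (by norm_num) _
    refine hd.2.trans ?_
    calc _ ≤ C * (n : ℝ) ^ c * (C * M) * ((n : ℝ) ^ (-(c - 1 / 4)) * Z2) := by gcongr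
      _ = K2 * ((n : ℝ) ^ c * (n : ℝ) ^ (-(c - 1 / 4))) := by ring
      _ = _ := by
          rw [← Real.rpow_add hn0]
          congr 2
          ring
  have r1 : (n : ℝ) ^ (-(1 / 2) : ℝ) * (n : ℝ) ^ (1 / 2 - η) = (n : ℝ) ^ (-η) := by
    rw [← Real.rpow_add hn0]; congr 1; ring
  have r2 : (n : ℝ) ^ (-(1 / 2) : ℝ) * (n : ℝ) ^ (1 / 4 : ℝ) = (n : ℝ) ^ (-(1 / 4) : ℝ) := by
    rw [← Real.rpow_add hn0]; congr 1; norm_num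
  calc _ ≤ (n : ℝ) ^ (-(1 / 2) : ℝ) * (K1 * (n : ℝ) ^ (1 / 2 - η) + K2 * (n : ℝ) ^ (1 / 4 : ℝ)) := by
        rw [inv_sqrt_natCast]
        gcongr
        exact (lpNorm_add_le hm1 le_rfl).trans (add_le_add l1 l2)
    _ = K1 * (n : ℝ) ^ (-η) + K2 * (n : ℝ) ^ (-(1 / 4) : ℝ) := by
        rw [← r1, ← r2]; ring
    _ ≤ (K1 + K2) * (n : ℝ) ^ (-η) + (K1 + K2) * (n : ℝ) ^ (-(1 / 4) : ℝ) := by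
        gcongr <;> linarith
    _ = _ := by ring

/-- Fatou's lemma controls the remainder of the unstable component. -/
theorem exists_eLpNorm_remU_le (hr : HasRates A a b c C)
    (hD : IsMartingaleDiff P F (noise A X) V)
    (h1 : ∀ n, 1 ≤ n → MemLp (X n) 1 P ∧ lpNorm (X n) 1 P ≤ M)
    {W : Ω → EuclideanSpace ℝ (Fin d)}
    (hW : ∀ᵐ ω ∂P, Tendsto
      (fun n : ℕ => act (projU A * flow A (-Real.log n)) (walk X n ω)) atTop (𝓝 (W ω))) :
    ∃ K : ℝ, ∀ n : ℕ, 1 ≤ n → eLpNorm (remU A X W n) 1 P ≤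
        ENNReal.ofReal (K * ((n : ℝ) ^ (-((2 * c - 1) / 4)) + (n : ℝ) ^ (-(1 / 4) : ℝ))) := by
  obtain ⟨K, hK⟩ := exists_eLpNorm_remUAt_le hr hD h1
  refine ⟨K, fun n hn => ?_⟩
  have hlim : ∀ᵐ ω ∂P, Tendsto (fun N => remUAt A X n N ω) atTop (𝓝 (remU A X W n ω)) := by
    filter_upwards [hW] with ω hω
    -- The limit lies in E_u. This matters because the power of `A * projU A` is the flow of `A`
    -- only there.
    have hPW : act (projU A) (W ω) = W ω := by
      refine tendsto_nhds_unique (((continuous_act (projU A)).tendsto _).comp hω) ?_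
      refine hω.congr fun N => ?_
      rw [Function.comp, ← mul_act, ← mul_assoc, projU_mul_self]
    have e : act (natPow n (A * projU A)) (W ω) = act (flow A (Real.log n) * projU A) (W ω) := by
      rw [← natPow_mul_proj (projU_mul_self A) (mul_projU A), mul_act, hPW]
    rw [remU, e]
    refine Tendsto.congr' ?_ (((tendsto_const_nhds.sub
      (((continuous_act (flow A (Real.log n) * projU A)).tendsto _).comp hω)).const_smul
        (Real.sqrt n)⁻¹).sub tendsto_const_nhds)
    filter_upwards [eventually_ge_atTop (n ^ 2)] with N hN
    exact (remUAt_eq A X hN ω).symm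
  refine (Lp.eLpNorm_lim_le_liminf_eLpNorm (fun N => (hK n N hn).1) _ hlim).trans ?_
  exact (liminf_le_liminf (.of_forall fun N => (hK n N hn).2)).trans_eq (liminf_const _)

end Remainders

/-! ### Joint covariances of the stacked weights. -/

section Stacking

open scoped Matrix.Norms.Frobenius

variable {d : ℕ}

/-- Three square matrices stacked into one. -/
def stackRows {𝕜 : Type*} (x y z : Matrix (Fin d) (Fin d) 𝕜) :
    Matrix (Fin d ⊕ Fin d ⊕ Fin d) (Fin d) 𝕜 :=
  Matrix.fromRows x (Matrix.fromRows y z)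

section Vectors

variable {𝕜 : Type*} [RCLike 𝕜]

theorem actRect_stackRows (x y z : Matrix (Fin d) (Fin d) 𝕜) (v : EuclideanSpace 𝕜 (Fin d)) :
    actRect (stackRows x y z) v = stack (act x v) (act y v) (act z v) := by
  ext i
  rcases i with i | i | i <;> rfl

theorem stack_sub (x y z x' y' z' : EuclideanSpace 𝕜 (Fin d)) :
    stack x y z - stack x' y' z' = stack (x - x') (y - y') (z - z') := by
  ext i
  rcases i with i | i | i <;> rfl

theorem stack_add (x y z x' y' z' : EuclideanSpace 𝕜 (Fin d)) :
    stack x y z + stack x' y' z' = stack (x + x') (y + y') (z + z') := by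
  ext i
  rcases i with i | i | i <;> rfl

theorem stack_sum {ι : Type*} (s : Finset ι) (x y z : ι → EuclideanSpace 𝕜 (Fin d)) :
    ∑ k ∈ s, stack (x k) (y k) (z k) = stack (∑ k ∈ s, x k) (∑ k ∈ s, y k) (∑ k ∈ s, z k) := by
  classical
  induction s using Finset.induction_on with
  | empty =>
    ext i
    rcases i with i | i | i <;> rfl
  | insert a s ha ih =>
    rw [Finset.sum_insert ha, Finset.sum_insert ha, Finset.sum_insert ha, Finset.sum_insert ha, ih,
      stack_add]

theorem norm_stack_le (x y z : EuclideanSpace 𝕜 (Fin d)) :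
    ‖stack x y z‖ ≤ ‖x‖ + ‖y‖ + ‖z‖ := by
  have h : stack x y z = stack x 0 0 + stack 0 y 0 + stack 0 0 z := by
    rw [stack_add, stack_add]
    simp
  rw [h]
  refine norm_add₃_le.trans (le_of_eq ?_)
  congr 1
  · congr 1
    all_goals
      rw [EuclideanSpace.norm_eq, EuclideanSpace.norm_eq]
      simp [stack]
  · rw [EuclideanSpace.norm_eq, EuclideanSpace.norm_eq]
    simp [stack]

theorem continuous_stack {α : Type*} [TopologicalSpace α] {f g h : α → EuclideanSpace 𝕜 (Fin d)}
    (hf : Continuous f) (hg : Continuous g) (hh : Continuous h) :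
    Continuous fun x => stack (f x) (g x) (h x) := by
  refine (PiLp.continuous_toLp 2 _).comp (continuous_pi fun i => ?_)
  rcases i with i | i | i
  · exact (EuclideanSpace.proj (𝕜 := 𝕜) i).continuous.comp hf
  · exact (EuclideanSpace.proj (𝕜 := 𝕜) i).continuous.comp hg
  · exact (EuclideanSpace.proj (𝕜 := 𝕜) i).continuous.comp hh

theorem norm_stackRows_le (x y z : Matrix (Fin d) (Fin d) 𝕜) :
    ‖stackRows x y z‖ ≤ ‖x‖ + ‖y‖ + ‖z‖ := by
  have h : stackRows x y z = stackRows x 0 0 + stackRows 0 y 0 + stackRows 0 0 z := by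
    ext i
    rcases i with i | i | i <;> simp [stackRows]
  rw [h]
  refine norm_add₃_le.trans (le_of_eq ?_)
  congr 1
  · congr 1
    all_goals
      rw [Matrix.frobenius_norm_def, Matrix.frobenius_norm_def]
      simp [stackRows]
  · rw [Matrix.frobenius_norm_def, Matrix.frobenius_norm_def]
    simp [stackRows]

end Vectors

theorem vecC_sub (x y : EuclideanSpace ℝ (Fin d)) : vecC (x - y) = vecC x - vecC y := by
  ext i
  simp [vecC]

theorem vecC_add (x y : EuclideanSpace ℝ (Fin d)) : vecC (x + y) = vecC x + vecC y := by
  ext i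
  simp [vecC]

theorem vecC_sum {ι : Type*} (s : Finset ι) (x : ι → EuclideanSpace ℝ (Fin d)) :
    vecC (∑ k ∈ s, x k) = ∑ k ∈ s, vecC (x k) := by
  classical
  induction s using Finset.induction_on with
  | empty => ext i; simp [vecC]
  | insert a s ha ih => rw [Finset.sum_insert ha, Finset.sum_insert ha, vecC_add, ih]

theorem vecC_act (M : Matrix (Fin d) (Fin d) ℝ) (x : EuclideanSpace ℝ (Fin d)) :
    vecC (act M x) = act (toC M) (vecC x) := by
  ext i
  simp [vecC, act, toC, Matrix.mulVec, dotProduct]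

theorem norm_vecC (x : EuclideanSpace ℝ (Fin d)) : ‖vecC x‖ = ‖x‖ := by
  rw [EuclideanSpace.norm_eq, EuclideanSpace.norm_eq]
  simp [vecC]

theorem toC_sum {m n ι : Type*} (s : Finset ι) (M : ι → Matrix m n ℝ) :
    toC (∑ k ∈ s, M k) = ∑ k ∈ s, toC (M k) := by
  ext i j
  simp [toC, Matrix.sum_apply]

theorem continuous_toC {m n : Type*} : Continuous (toC : Matrix m n ℝ → Matrix m n ℂ) :=
  continuous_id.matrix_map Complex.continuous_ofReal

theorem toC_transpose {m n : Type*} (M : Matrix m n ℝ) : toC Mᵀ = (toC M)ᵀ := rfl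

theorem toC_stackRows (x y z : Matrix (Fin d) (Fin d) ℝ) :
    toC (stackRows x y z) = stackRows (toC x) (toC y) (toC z) := by
  ext i j
  rcases i with i | i | i <;> rfl

theorem conjTranspose_stackRows (x y z : Matrix (Fin d) (Fin d) ℂ) :
    (stackRows x y z)ᴴ = (stackRows (x.map (starRingEnd ℂ)) (y.map (starRingEnd ℂ))
      (z.map (starRingEnd ℂ)))ᵀ := by
  ext j i
  rcases i with i | i | i <;> rfl

theorem toC_map_conj {m n : Type*} (M : Matrix m n ℝ) : (toC M).map (starRingEnd ℂ) = toC M := by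
  ext i j
  simp [toC]

theorem norm_map_conj {m n : Type*} [Fintype m] [Fintype n] (M : Matrix m n ℂ) :
    ‖M.map (starRingEnd ℂ)‖ = ‖M‖ :=
  Matrix.frobenius_norm_map_eq _ _ fun z => by simp

/-! ### Limits of the covariances of the weights -/

/-- Induction on `n`; the step is Bernoulli's inequality for the concave power 1 - s. -/
theorem sum_rpow_neg_le {s : ℝ} (h0 : 0 < s) (h1 : s < 1) (n : ℕ) :
    ∑ k ∈ Finset.Ioc 0 n, (k : ℝ) ^ (-s) ≤ (n : ℝ) ^ (1 - s) / (1 - s) := by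
  have hr : 0 < 1 - s := by linarith
  rw [le_div_iff₀ hr]
  induction n with
  | zero => simp [Real.zero_rpow hr.ne']
  | succ n ih =>
    rw [← Finset.insert_Ioc_right_eq_Ioc_add_one (Nat.zero_le n), Finset.sum_insert (by simp),
      add_mul]
    have hn : (0 : ℝ) < ((n + 1 : ℕ) : ℝ) := by positivity
    have h2 := rpow_one_add_le_one_add_mul_self (s := -(1 / ((n + 1 : ℕ) : ℝ))) (p := 1 - s)
      (by
        have : 1 / ((n + 1 : ℕ) : ℝ) ≤ 1 := by
          rw [div_le_one hn]; push_cast; linarith [n.cast_nonneg (α := ℝ)]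
        linarith) hr.le (by linarith)
    have h3 : 1 + -(1 / ((n + 1 : ℕ) : ℝ)) = n / ((n + 1 : ℕ) : ℝ) := by
      field_simp
      push_cast
      ring
    rw [h3, Real.div_rpow n.cast_nonneg hn.le, div_le_iff₀ (by positivity)] at h2
    have h4 : (((n + 1 : ℕ) : ℝ)) ^ (-s) = (((n + 1 : ℕ) : ℝ)) ^ (1 - s) * (1 / ((n + 1 : ℕ) : ℝ)) := by
      rw [show -s = (1 - s) - 1 by ring, Real.rpow_sub_one hn.ne']
      ring
    rw [h4]
    linarith

variable {A Sig : Matrix (Fin d) (Fin d) ℝ} {a b c C : ℝ}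

theorem norm_weightS_le (hr : HasRates A a b c C) {n k : ℕ} (hk : 1 ≤ k) (hkn : k ≤ n) :
    ‖weightS A n k‖ ≤ C * ((n : ℝ) ^ (a - 1 / 2) * (k : ℝ) ^ (-a)) := by
  have hn0 : (0 : ℝ) < n := by exact_mod_cast hk.trans hkn
  rw [weightS, if_pos hkn, norm_smul, Real.norm_of_nonneg (by positivity), inv_sqrt_natCast]
  calc _ ≤ (n : ℝ) ^ (-(1 / 2) : ℝ) * (C * ((n : ℝ) ^ a * (k : ℝ) ^ (-a))) := by
        gcongr
        exact hr.stable n k hk hkn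
    _ = _ := by
        rw [sub_eq_add_neg, Real.rpow_add hn0]
        ring

theorem norm_weightU_le (hr : HasRates A a b c C) {n k : ℕ} (hn : 1 ≤ n) :
    ‖weightU A n k‖ ≤ C * (n : ℝ) ^ (-(1 / 2) : ℝ) := by
  have hn0 : (0 : ℝ) < n := by exact_mod_cast hn
  have hC := hr.C_pos
  rw [weightU]
  split_ifs with h
  · have hk0 : (0 : ℝ) < k := by exact_mod_cast (hn.trans h.le)
    rw [norm_smul, norm_neg, Real.norm_of_nonneg (by positivity), inv_sqrt_natCast, mul_comm]
    gcongr
    refine (hr.unstable n k hn h.le).trans (mul_le_of_le_one_right hC.le ?_)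
    rw [Real.rpow_neg hk0.le, mul_inv_le_iff₀ (by positivity), one_mul]
    exact Real.rpow_le_rpow hn0.le (by exact_mod_cast h.le) (by linarith [hr.c_gt])
  · rw [norm_zero]
    positivity

/-- The covariances between the stable and the critical components vanish in the limit. -/
theorem tendsto_cross_sum (hr : HasRates A a b c C) {f : ℕ → ℕ → Matrix (Fin d) (Fin d) ℂ} {B : ℝ}
    (hf0 : ∀ n k, n < k → f n k = 0)
    (hf : ∀ n k : ℕ, 1 ≤ k → k ≤ n → 1 ≤ Real.log n → ‖f n k‖ ≤
      B * (((n : ℝ) ^ (a - 1 / 2) * (k : ℝ) ^ (-a)) *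
        ((k : ℝ) ^ (-(1 / 2) : ℝ) * Real.log n ^ (-(1 / 2) : ℝ)))) :
    Tendsto (fun n : ℕ => ∑ k ∈ Finset.Ioc 0 (n ^ 2), f n k) atTop (𝓝 0) := by
  have ha := hr.a_pos
  have ha2 := hr.a_lt
  have hlim := (CriticalJordanForm.tendsto_log_rpow_neg (s := -(1 / 2)) (by norm_num)).const_mul
    (|B| * (1 / (1 / 2 - a)))
  rw [mul_zero] at hlim
  refine squeeze_zero_norm' ?_ hlim
  filter_upwards [tendsto_log_natCast.eventually_ge_atTop 1, eventually_ge_atTop 1] with n hlog hn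
  have hn0 : (0 : ℝ) < n := by exact_mod_cast hn
  have e : ∑ k ∈ Finset.Ioc 0 (n ^ 2), f n k = ∑ k ∈ Finset.Ioc 0 n, f n k := by
    refine Eq.trans ?_ (sum_Ioc_sq_ite_le _ n)
    refine Finset.sum_congr rfl fun k _ => ?_
    split_ifs with h
    · rfl
    · exact hf0 n k (not_le.1 h)
  rw [e]
  have hL : 0 ≤ Real.log n ^ (-(1 / 2) : ℝ) := by positivity
  calc ‖∑ k ∈ Finset.Ioc 0 n, f n k‖
      ≤ ∑ k ∈ Finset.Ioc 0 n, |B| * (n : ℝ) ^ (a - 1 / 2) * Real.log n ^ (-(1 / 2) : ℝ) *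
        (k : ℝ) ^ (-(a + 1 / 2)) := by
        refine norm_sum_le_of_le _ fun k hk => ?_
        have hk' := Finset.mem_Ioc.1 hk
        have hk0 : (0 : ℝ) < k := by exact_mod_cast hk'.1
        calc _ ≤ _ := hf n k hk'.1 hk'.2 hlog
          _ ≤ |B| * (((n : ℝ) ^ (a - 1 / 2) * (k : ℝ) ^ (-a)) *
              ((k : ℝ) ^ (-(1 / 2) : ℝ) * Real.log n ^ (-(1 / 2) : ℝ))) := by
              gcongr
              exact le_abs_self B
          _ = _ := by
              rw [neg_add, Real.rpow_add hk0]
              ring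
    _ ≤ |B| * (n : ℝ) ^ (a - 1 / 2) * Real.log n ^ (-(1 / 2) : ℝ) *
        ((n : ℝ) ^ (1 - (a + 1 / 2)) / (1 - (a + 1 / 2))) := by
        rw [← Finset.mul_sum]
        gcongr
        exact sum_rpow_neg_le (by linarith) (by linarith) n
    _ = |B| * (1 / (1 / 2 - a)) * Real.log n ^ (-(1 / 2) : ℝ) *
        ((n : ℝ) ^ (a - 1 / 2) * (n : ℝ) ^ (1 - (a + 1 / 2))) := by
        rw [show 1 - (a + 1 / 2) = 1 / 2 - a by ring]
        ring
    -- The powers of `n` cancel exactly, so the decay of the cross-covariance is only (log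
    -- n)^{-1/2}.
    _ = _ := by
        rw [← Real.rpow_add hn0, show a - 1 / 2 + (1 - (a + 1 / 2)) = 0 by ring, Real.rpow_zero,
          mul_one]

theorem tendsto_weightS_sum (hr : HasRates A a b c C) {XiS : Matrix (Fin d) (Fin d) ℝ}
    (hS : IsLyapunovSolution (projS A) ((1 / 2 : ℝ) • projS A - A * projS A) Sig XiS) :
    Tendsto (fun n : ℕ => ∑ k ∈ Finset.Ioc 0 (n ^ 2),
      toC (weightS A n k) * toC Sig * (toC (weightS A n k))ᵀ) atTop (𝓝 (toC XiS)) := by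
  refine ((continuous_toC.tendsto _).comp (tendsto_stable_sum hr hS)).congr fun n => ?_
  rw [Function.comp, ← sum_Ioc_sq_ite_le, toC_sum]
  refine Finset.sum_congr rfl fun k _ => ?_
  rw [← toC_transpose, ← toC_mul, ← toC_mul, weightS]
  split_ifs
  · rw [Matrix.transpose_smul, smul_mul_assoc, smul_mul_assoc, mul_smul_comm, smul_smul,
      ← mul_inv, Real.mul_self_sqrt n.cast_nonneg]
  · simp

theorem tendsto_weightU_sum (hr : HasRates A a b c C) {XiU : Matrix (Fin d) (Fin d) ℝ}
    (hU : IsLyapunovSolution (projU A) (A * projU A - (1 / 2 : ℝ) • projU A) Sig XiU) :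
    Tendsto (fun n : ℕ => ∑ k ∈ Finset.Ioc 0 (n ^ 2),
      toC (weightU A n k) * toC Sig * (toC (weightU A n k))ᵀ) atTop (𝓝 (toC XiU)) := by
  refine ((continuous_toC.tendsto _).comp (tendsto_unstable_sum hr hU)).congr fun n => ?_
  rw [Function.comp, ← sum_Ioc_sq_ite_lt, toC_sum]
  refine Finset.sum_congr rfl fun k _ => ?_
  rw [← toC_transpose, ← toC_mul, ← toC_mul, weightU]
  split_ifs
  · rw [Matrix.transpose_smul, smul_mul_assoc, smul_mul_assoc, mul_smul_comm, smul_smul,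
      neg_mul_neg, ← mul_inv, Real.mul_self_sqrt n.cast_nonneg]
  · simp

/-- The joint limit of the covariances of the stacked weights. -/
theorem tendsto_stack_sum (hr : HasRates A a b c C) {XiS XiU : Matrix (Fin d) (Fin d) ℝ}
    (hS : IsLyapunovSolution (projS A) ((1 / 2 : ℝ) • projS A - A * projS A) Sig XiS)
    (hU : IsLyapunovSolution (projU A) (A * projU A - (1 / 2 : ℝ) • projU A) Sig XiU)
    {y y' : ℕ → ℕ → Matrix (Fin d) (Fin d) ℂ} {G : Matrix (Fin d) (Fin d) ℂ} {B : ℝ} (hB : 0 ≤ B)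
    (hy : ∀ n k : ℕ, 1 ≤ k → k ≤ n → 1 ≤ Real.log n →
      ‖y n k‖ ≤ B * ((k : ℝ) ^ (-(1 / 2) : ℝ) * Real.log n ^ (-(1 / 2) : ℝ)))
    (hy' : ∀ n k : ℕ, 1 ≤ k → k ≤ n → 1 ≤ Real.log n →
      ‖y' n k‖ ≤ B * ((k : ℝ) ^ (-(1 / 2) : ℝ) * Real.log n ^ (-(1 / 2) : ℝ)))
    (hy0 : ∀ n k, n < k → y n k = 0) (hy0' : ∀ n k, n < k → y' n k = 0)
    (hG : Tendsto (fun n : ℕ => ∑ k ∈ Finset.Ioc 0 (n ^ 2), y n k * toC Sig * (y' n k)ᵀ) atTop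
      (𝓝 G)) :
    Tendsto (fun n : ℕ => ∑ k ∈ Finset.Ioc 0 (n ^ 2),
      stackRows (toC (weightS A n k)) (y n k) (toC (weightU A n k)) * toC Sig *
        (stackRows (toC (weightS A n k)) (y' n k) (toC (weightU A n k)))ᵀ) atTop
      (𝓝 (blockDiag (toC XiS) G (toC XiU))) := by
  have hC := hr.C_pos
  have hSC : Tendsto (fun n : ℕ => ∑ k ∈ Finset.Ioc 0 (n ^ 2),
      toC (weightS A n k) * toC Sig * (y' n k)ᵀ) atTop (𝓝 0) := by
    refine tendsto_cross_sum hr (B := C * ‖toC Sig‖ * B) (fun n k h => by simp [hy0' n k h])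
      fun n k hk hkn hn => ?_
    calc _ ≤ ‖weightS A n k‖ * ‖toC Sig‖ * ‖y' n k‖ := by
          refine (norm_mul_le _ _).trans ?_
          rw [Matrix.frobenius_norm_transpose, ← norm_toC (weightS A n k)]
          gcongr
          exact norm_mul_le _ _
      _ ≤ (C * ((n : ℝ) ^ (a - 1 / 2) * (k : ℝ) ^ (-a))) * ‖toC Sig‖ *
          (B * ((k : ℝ) ^ (-(1 / 2) : ℝ) * Real.log n ^ (-(1 / 2) : ℝ))) := by
          gcongr
          · exact norm_weightS_le hr hk hkn
          · exact hy' n k hk hkn hn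
      _ = _ := by ring
  have hCS : Tendsto (fun n : ℕ => ∑ k ∈ Finset.Ioc 0 (n ^ 2),
      y n k * toC Sig * (toC (weightS A n k))ᵀ) atTop (𝓝 0) := by
    refine tendsto_cross_sum hr (B := C * ‖toC Sig‖ * B) (fun n k h => by simp [hy0 n k h])
      fun n k hk hkn hn => ?_
    calc _ ≤ ‖y n k‖ * ‖toC Sig‖ * ‖weightS A n k‖ := by
          refine (norm_mul_le _ _).trans ?_
          rw [Matrix.frobenius_norm_transpose, ← norm_toC (weightS A n k)]
          gcongr
          exact norm_mul_le _ _
      _ ≤ (B * ((k : ℝ) ^ (-(1 / 2) : ℝ) * Real.log n ^ (-(1 / 2) : ℝ))) * ‖toC Sig‖ *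
          (C * ((n : ℝ) ^ (a - 1 / 2) * (k : ℝ) ^ (-a))) := by
          gcongr
          · exact hy n k hk hkn hn
          · exact norm_weightS_le hr hk hkn
      _ = _ := by ring
  have hzero : ∀ {f : ℕ → ℕ → Matrix (Fin d) (Fin d) ℂ}, (∀ n k, f n k = 0) →
      Tendsto (fun n : ℕ => ∑ k ∈ Finset.Ioc 0 (n ^ 2), f n k) atTop (𝓝 0) := fun hf => by
    simp only [hf, Finset.sum_const_zero]
    exact tendsto_const_nhds
  -- Unstable weights live on k > n, stable and critical ones on k ≤ n; every product of the two
  -- kinds is zero.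
  have hSU := hzero (f := fun n k => toC (weightS A n k) * toC Sig * (toC (weightU A n k))ᵀ)
    fun n k => by
      rcases le_or_gt k n with h | h
      · simp [weightU, not_lt.2 h, toC]
      · simp [weightS, not_le.2 h, toC]
  have hUS := hzero (f := fun n k => toC (weightU A n k) * toC Sig * (toC (weightS A n k))ᵀ)
    fun n k => by
      rcases le_or_gt k n with h | h
      · simp [weightU, not_lt.2 h, toC]
      · simp [weightS, not_le.2 h, toC]
  have hCU := hzero (f := fun n k => y n k * toC Sig * (toC (weightU A n k))ᵀ)
    fun n k => by
      rcases le_or_gt k n with h | h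
      · simp [weightU, not_lt.2 h, toC]
      · simp [hy0 n k h]
  have hUC := hzero (f := fun n k => toC (weightU A n k) * toC Sig * (y' n k)ᵀ)
    fun n k => by
      rcases le_or_gt k n with h | h
      · simp [weightU, not_lt.2 h, toC]
      · simp [hy0' n k h]
  have hSS := tendsto_weightS_sum hr hS
  have hUU := tendsto_weightU_sum hr hU
  refine tendsto_pi_nhds.2 fun i => tendsto_pi_nhds.2 fun j => ?_
  have entry : ∀ {f : ℕ → ℕ → Matrix (Fin d) (Fin d) ℂ} {L : Matrix (Fin d) (Fin d) ℂ},
      Tendsto (fun n : ℕ => ∑ k ∈ Finset.Ioc 0 (n ^ 2), f n k) atTop (𝓝 L) → ∀ i j,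
      Tendsto (fun n : ℕ => ∑ k ∈ Finset.Ioc 0 (n ^ 2), f n k i j) atTop (𝓝 (L i j)) := by
    intro f L h i j
    have h1 := tendsto_pi_nhds.1 (tendsto_pi_nhds.1 h i) j
    simpa only [Matrix.sum_apply] using h1
  simp only [Matrix.sum_apply]
  rcases i with i | i | i <;> rcases j with j | j | j
  · exact entry hSS i j
  · exact entry hSC i j
  · exact entry hSU i j
  · exact entry hCS i j
  · exact entry hG i j
  · exact entry hCU i j
  · exact entry hUS i j
  · exact entry hUC i j
  · exact entry hUU i j

end Stacking

/-! ### Joint weights, real normalizations and the limit laws. -/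

section Assembly

open scoped Matrix.Norms.Frobenius

variable {d : ℕ} {A Sig : Matrix (Fin d) (Fin d) ℝ} {a b c C : ℝ}

namespace CriticalJordanForm

variable (K : CriticalJordanForm A)

/-- The normalized weight of the innovation `ε_k` in the critical component. -/
noncomputable def criticalWeight (n k : ℕ) : Matrix (Fin d) (Fin d) ℂ :=
  K.Dinv n * toC (weightC A n k)

/-- The weight of the innovation `ε_k` in the stacked vector. -/
noncomputable def jointWeight (n k : ℕ) : Matrix (Fin d ⊕ Fin d ⊕ Fin d) (Fin d) ℂ :=
  stackRows (toC (weightS A n k)) (K.criticalWeight n k) (toC (weightU A n k))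

theorem criticalWeight_of_lt {n k : ℕ} (h : n < k) : K.criticalWeight n k = 0 := by
  simp [criticalWeight, weightC, not_le.2 h, toC]

theorem exists_norm_criticalWeight_le : ∃ B : ℝ, 0 ≤ B ∧ ∀ n k : ℕ, 1 ≤ k → k ≤ n →
    1 ≤ Real.log n →
    ‖K.criticalWeight n k‖ ≤ B * ((k : ℝ) ^ (-(1 / 2) : ℝ) * Real.log n ^ (-(1 / 2) : ℝ)) := by
  obtain ⟨B, hB, h⟩ := K.exists_norm_Dinv_mul_flow_le
  refine ⟨B, hB.le, fun n k hk hkn hn => ?_⟩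
  rw [criticalWeight, weightC, if_pos hkn]
  exact h n k hk hkn hn

theorem tendsto_criticalWeight_sum (Sig : Matrix (Fin d) (Fin d) ℝ) :
    Tendsto (fun n : ℕ => ∑ k ∈ Finset.Ioc 0 (n ^ 2), K.criticalWeight n k * toC Sig *
      ((K.criticalWeight n k).map (starRingEnd ℂ))ᵀ) atTop (𝓝 (K.XiC Sig)) := by
  refine (K.tendsto_critical_sum Sig).congr fun n => ?_
  refine (sum_Ioc_sq_ite_le _ n).symm.trans (Finset.sum_congr rfl fun k _ => ?_)
  rw [criticalWeight, weightC]
  split_ifs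
  · rfl
  · simp [toC]

theorem tendsto_criticalWeight_sum_pseudo (Sig : Matrix (Fin d) (Fin d) ℝ) :
    Tendsto (fun n : ℕ => ∑ k ∈ Finset.Ioc 0 (n ^ 2), K.criticalWeight n k * toC Sig *
      (K.criticalWeight n k)ᵀ) atTop (𝓝 (K.pseudoXiC Sig)) := by
  refine (K.tendsto_critical_sum_pseudo Sig).congr fun n => ?_
  refine (sum_Ioc_sq_ite_le _ n).symm.trans (Finset.sum_congr rfl fun k _ => ?_)
  rw [criticalWeight, weightC]
  split_ifs
  · rfl
  · simp [toC]

theorem tendsto_jointWeight_sum (hr : HasRates A a b c C) {XiS XiU : Matrix (Fin d) (Fin d) ℝ}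
    (hS : IsLyapunovSolution (projS A) ((1 / 2 : ℝ) • projS A - A * projS A) Sig XiS)
    (hU : IsLyapunovSolution (projU A) (A * projU A - (1 / 2 : ℝ) • projU A) Sig XiU) :
    Tendsto (fun n : ℕ => ∑ k ∈ Finset.Ioc 0 (n ^ 2),
      K.jointWeight n k * toC Sig * (K.jointWeight n k)ᴴ) atTop
      (𝓝 (blockDiag (toC XiS) (K.XiC Sig) (toC XiU))) := by
  obtain ⟨B, hB, h⟩ := K.exists_norm_criticalWeight_le
  simp only [jointWeight, conjTranspose_stackRows, toC_map_conj]
  refine tendsto_stack_sum hr hS hU hB h (fun n k hk hkn hn => ?_)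
    (fun n k => K.criticalWeight_of_lt) (fun n k hkn => ?_) (K.tendsto_criticalWeight_sum Sig)
  · rw [norm_map_conj]
    exact h n k hk hkn hn
  · rw [K.criticalWeight_of_lt hkn]
    ext i j
    simp

theorem tendsto_jointWeight_sum_pseudo (hr : HasRates A a b c C)
    {XiS XiU : Matrix (Fin d) (Fin d) ℝ}
    (hS : IsLyapunovSolution (projS A) ((1 / 2 : ℝ) • projS A - A * projS A) Sig XiS)
    (hU : IsLyapunovSolution (projU A) (A * projU A - (1 / 2 : ℝ) • projU A) Sig XiU) :
    Tendsto (fun n : ℕ => ∑ k ∈ Finset.Ioc 0 (n ^ 2),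
      K.jointWeight n k * toC Sig * (K.jointWeight n k)ᵀ) atTop
      (𝓝 (blockDiag (toC XiS) (K.pseudoXiC Sig) (toC XiU))) := by
  obtain ⟨B, hB, h⟩ := K.exists_norm_criticalWeight_le
  exact tendsto_stack_sum hr hS hU hB h h (fun n k => K.criticalWeight_of_lt)
    (fun n k => K.criticalWeight_of_lt) (K.tendsto_criticalWeight_sum_pseudo Sig)

theorem exists_norm_jointWeight_le (hr : HasRates A a b c C) :
    ∃ δ : ℕ → ℝ, Tendsto δ atTop (𝓝 0) ∧
      ∀ᶠ n : ℕ in atTop, ∀ k ∈ Finset.Ioc 0 (n ^ 2), ‖K.jointWeight n k‖ ≤ δ n := by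
  obtain ⟨B, hB, h⟩ := K.exists_norm_criticalWeight_le
  have hC := hr.C_pos
  have ha := hr.a_pos
  have h1 := (tendsto_natCast_rpow_neg (s := a - 1 / 2) (by linarith [hr.a_lt])).const_mul C
  have h2 := (tendsto_log_rpow_neg (s := -(1 / 2)) (by norm_num)).const_mul B
  have h3 := (tendsto_natCast_rpow_neg (s := -(1 / 2)) (by norm_num)).const_mul C
  have h4 := (h1.add h2).add h3
  simp only [mul_zero, add_zero] at h4
  refine ⟨_, h4, ?_⟩
  filter_upwards [tendsto_log_natCast.eventually_ge_atTop 1, eventually_ge_atTop 1] with n hlog hn k hk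
  have hk1 : 1 ≤ k := (Finset.mem_Ioc.1 hk).1
  have hk1' : (1 : ℝ) ≤ k := by exact_mod_cast hk1
  have hn0 : (0 : ℝ) < n := by exact_mod_cast hn
  have hpow : ∀ s : ℝ, 0 ≤ s → (k : ℝ) ^ (-s) ≤ 1 := fun s hs =>
    Real.rpow_le_one_of_one_le_of_nonpos hk1' (by linarith)
  have hL : 0 ≤ Real.log n ^ (-(1 / 2) : ℝ) := Real.rpow_nonneg (by linarith) _
  refine (norm_stackRows_le _ _ _).trans (add_le_add (add_le_add ?_ ?_) ?_)
  · rw [norm_toC]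
    rcases le_or_gt k n with hkn | hkn
    · refine (norm_weightS_le hr hk1 hkn).trans ?_
      gcongr
      exact mul_le_of_le_one_right (by positivity) (hpow a ha.le)
    · rw [weightS, if_neg (not_le.2 hkn), norm_zero]
      positivity
  · rcases le_or_gt k n with hkn | hkn
    · refine (h n k hk1 hkn hlog).trans ?_
      gcongr
      exact mul_le_of_le_one_left hL (hpow (1 / 2) (by norm_num))
    · rw [K.criticalWeight_of_lt hkn, norm_zero]
      positivity
  · rw [norm_toC]
    exact norm_weightU_le hr hn

/-! ### Real normalizations -/

theorem Dinv_of_lt_two {n : ℕ} (hn : n < 2) : K.Dinv n = 0 := by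
  have hlog : Real.log n = 0 := by interval_cases n <;> simp
  have h1 : (fun a => (((Real.log n ^ K.expo a)⁻¹ : ℝ) : ℂ)) = fun _ => 0 := by
    funext a
    have h2 : K.expo a ≠ 0 := by
      rw [K.expo_eq]
      positivity
    rw [hlog, Real.zero_rpow h2]
    simp
  rw [Dinv, h1]
  simp

theorem Dinv_mul_D {n : ℕ} (hn : 2 ≤ n) : K.Dinv n * K.D n = toC (projC A) := by
  have hlog : 0 < Real.log n := Real.log_pos (by exact_mod_cast hn)
  have h1 : Matrix.diagonal (fun a => (((Real.log n ^ K.expo a)⁻¹ : ℝ) : ℂ)) *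
      Matrix.diagonal (fun a => ((Real.log n ^ K.expo a : ℝ) : ℂ)) = 1 := by
    rw [Matrix.diagonal_mul_diagonal, ← Matrix.diagonal_one]
    congr 1
    funext a
    rw [← Complex.ofReal_mul, inv_mul_cancel₀ (Real.rpow_pos_of_pos hlog _).ne',
      Complex.ofReal_one]
  calc K.Dinv n * K.D n
      = K.Q * (Matrix.diagonal (fun a => (((Real.log n ^ K.expo a)⁻¹ : ℝ) : ℂ)) *
          (K.Qinv * K.Q) *
          Matrix.diagonal (fun a => ((Real.log n ^ K.expo a : ℝ) : ℂ))) * K.Qinv := by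
        simp only [D, Dinv, Matrix.mul_assoc]
    _ = toC (projC A) := by rw [K.Qinv_mul_Q, Matrix.mul_one, h1, Matrix.mul_one, K.Q_mul_Qinv]

theorem Dinv_mul_projC (n : ℕ) : K.Dinv n * toC (projC A) = K.Dinv n := by
  rw [Dinv, Matrix.mul_assoc, Qinv_mul_toC_projC]

theorem projC_mul_Dinv (n : ℕ) : toC (projC A) * K.Dinv n = K.Dinv n := by
  rw [Dinv, ← K.Q_mul_Qinv]
  simp only [Matrix.mul_assoc]
  rw [← Matrix.mul_assoc K.Qinv K.Q, K.Qinv_mul_Q, Matrix.one_mul]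

theorem toC_re_Dinv (h : ∀ n i j, (K.D n i j).im = 0) (n : ℕ) :
    toC ((K.Dinv n).map Complex.re) = K.Dinv n := by
  rcases lt_or_ge n 2 with hn | hn
  · rw [K.Dinv_of_lt_two hn]
    ext i j
    simp [toC]
  · have hD : (K.D n).map (starRingEnd ℂ) = K.D n := by
      ext i j
      exact Complex.conj_eq_iff_im.2 (h n i j)
    have hDinv : (K.Dinv n).map (starRingEnd ℂ) = K.Dinv n := by
      calc (K.Dinv n).map (starRingEnd ℂ)
          = (K.Dinv n * toC (projC A)).map (starRingEnd ℂ) := by rw [K.Dinv_mul_projC]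
        _ = (K.Dinv n).map (starRingEnd ℂ) * toC (projC A) := by
            rw [Matrix.map_mul, toC_map_conj]
        _ = (K.Dinv n).map (starRingEnd ℂ) * (K.D n).map (starRingEnd ℂ) * K.Dinv n := by
            rw [hD, mul_assoc, K.D_mul_Dinv hn]
        _ = (K.Dinv n * K.D n).map (starRingEnd ℂ) * K.Dinv n := by rw [Matrix.map_mul]
        _ = K.Dinv n := by rw [K.Dinv_mul_D hn, toC_map_conj, K.projC_mul_Dinv]
    ext i j
    have h1 : (starRingEnd ℂ) (K.Dinv n i j) = K.Dinv n i j := congrFun (congrFun hDinv i) j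
    exact Complex.conj_eq_iff_re.1 h1

/-- The weight of the innovation `ε_k` in the stacked vector, for a real normalization. -/
noncomputable def realWeight (n k : ℕ) : Matrix (Fin d ⊕ Fin d ⊕ Fin d) (Fin d) ℝ :=
  stackRows (weightS A n k) ((K.Dinv n).map Complex.re * weightC A n k) (weightU A n k)

theorem toC_realWeight (h : ∀ n i j, (K.D n i j).im = 0) (n k : ℕ) :
    toC (K.realWeight n k) = K.jointWeight n k := by
  rw [realWeight, toC_stackRows, toC_mul, K.toC_re_Dinv h]
  rfl

theorem im_XiC_eq_zero (h : ∀ n i j, (K.D n i j).im = 0) (Sig : Matrix (Fin d) (Fin d) ℝ)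
    (i j : Fin d) : (K.XiC Sig i j).im = 0 := by
  have h1 := tendsto_pi_nhds.1 (tendsto_pi_nhds.1 (K.tendsto_criticalWeight_sum Sig) i) j
  have h2 := (Complex.continuous_im.tendsto _).comp h1
  refine tendsto_nhds_unique h2 (tendsto_const_nhds.congr fun n => ?_)
  have e : ∀ k, K.criticalWeight n k = toC ((K.Dinv n).map Complex.re * weightC A n k) := fun k => by
    rw [toC_mul, K.toC_re_Dinv h, criticalWeight]
  simp only [Function.comp, e, toC_map_conj, ← toC_transpose, ← toC_mul, ← toC_sum]
  simp [toC]

theorem tendsto_realWeight_sum (hr : HasRates A a b c C) {XiS XiU : Matrix (Fin d) (Fin d) ℝ}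
    (hS : IsLyapunovSolution (projS A) ((1 / 2 : ℝ) • projS A - A * projS A) Sig XiS)
    (hU : IsLyapunovSolution (projU A) (A * projU A - (1 / 2 : ℝ) • projU A) Sig XiU)
    (h : ∀ n i j, (K.D n i j).im = 0) :
    Tendsto (fun n : ℕ => ∑ k ∈ Finset.Ioc 0 (n ^ 2),
      K.realWeight n k * Sig * (K.realWeight n k)ᵀ) atTop
      (𝓝 (blockDiag XiS ((K.XiC Sig).map Complex.re) XiU)) := by
  have h1 := K.tendsto_jointWeight_sum hr hS hU
  have hcont : Continuous fun M : Matrix (Fin d ⊕ Fin d ⊕ Fin d) (Fin d ⊕ Fin d ⊕ Fin d) ℂ =>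
      M.map Complex.re := continuous_id.matrix_map Complex.continuous_re
  have h2 := (hcont.tendsto _).comp h1
  have e : (blockDiag (toC XiS) (K.XiC Sig) (toC XiU)).map Complex.re =
      blockDiag XiS ((K.XiC Sig).map Complex.re) XiU := by
    ext i j
    rcases i with i | i | i <;> rcases j with j | j | j <;> rfl
  rw [e] at h2
  refine h2.congr fun n => ?_
  have e2 : ∀ k, (K.jointWeight n k)ᴴ = toC (K.realWeight n k)ᵀ := fun k => by
    rw [← K.toC_realWeight h]
    ext i j
    simp [toC]
  simp only [Function.comp, e2]
  simp only [← K.toC_realWeight h, ← toC_mul, ← toC_sum]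
  ext i j
  simp [toC]

end CriticalJordanForm

/-! ### Convergence in distribution -/

section Probability

variable {Ω : Type*} {mΩ : MeasurableSpace Ω} {P : Measure Ω}

/-- Convergence in L¹ implies convergence in measure. Additivity of the integral asks for
measurability of the first two bounds alone, so the unstable remainder may stand last without it. -/
theorem tendstoInMeasure_of_norm_le {E E' : Type*} [NormedAddCommGroup E] [NormedAddCommGroup E']
    {g : ℕ → Ω → E} {fS fC fU : ℕ → Ω → E'} {D uS uU : ℕ → ℝ} {KC : ℝ}
    (hg : ∀ n, AEStronglyMeasurable (g n) P)
    (hfS : ∀ n, AEStronglyMeasurable (fS n) P) (hfC : ∀ n, AEStronglyMeasurable (fC n) P)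
    (hle : ∀ n ω, ‖g n ω‖ ≤ ‖fS n ω‖ + D n * ‖fC n ω‖ + ‖fU n ω‖) (hD0 : ∀ n, 0 ≤ D n)
    (hS : ∀ n, 1 ≤ n → eLpNorm (fS n) 1 P ≤ ENNReal.ofReal (uS n))
    (hC : ∀ n, eLpNorm (fC n) 1 P ≤ ENNReal.ofReal KC)
    (hU : ∀ n, 1 ≤ n → eLpNorm (fU n) 1 P ≤ ENNReal.ofReal (uU n))
    (hS0 : Tendsto uS atTop (𝓝 0)) (hD : Tendsto D atTop (𝓝 0)) (hU0 : Tendsto uU atTop (𝓝 0)) :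
    TendstoInMeasure P g atTop 0 := by
  refine tendstoInMeasure_of_tendsto_eLpNorm (p := 1) one_ne_zero hg aestronglyMeasurable_zero ?_
  have hlim : Tendsto (fun n => ENNReal.ofReal (uS n) + ENNReal.ofReal (D n) * ENNReal.ofReal KC +
      ENNReal.ofReal (uU n)) atTop (𝓝 0) := by
    have h1 := ENNReal.tendsto_ofReal hS0
    have h2 := ENNReal.Tendsto.mul_const (b := ENNReal.ofReal KC) (ENNReal.tendsto_ofReal hD)
      (Or.inr ENNReal.ofReal_ne_top)
    have h3 := ENNReal.tendsto_ofReal hU0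
    simpa using (h1.add h2).add h3
  refine tendsto_of_tendsto_of_tendsto_of_le_of_le' tendsto_const_nhds hlim
    (.of_forall fun _ => zero_le) ?_
  filter_upwards [eventually_ge_atTop 1] with n hn
  rw [sub_zero, eLpNorm_one_eq_lintegral_enorm]
  calc ∫⁻ ω, ‖g n ω‖ₑ ∂P ≤ ∫⁻ ω, (‖fS n ω‖ₑ + ENNReal.ofReal (D n) * ‖fC n ω‖ₑ) + ‖fU n ω‖ₑ ∂P := by
        refine lintegral_mono fun ω => ?_
        have h1 := ENNReal.ofReal_le_ofReal (hle n ω)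
        have h2 := mul_nonneg (hD0 n) (norm_nonneg (fC n ω))
        rw [ENNReal.ofReal_add (by positivity) (norm_nonneg _),
          ENNReal.ofReal_add (norm_nonneg _) h2, ENNReal.ofReal_mul (hD0 n)] at h1
        simpa only [ofReal_norm] using h1
    _ = eLpNorm (fS n) 1 P + ENNReal.ofReal (D n) * eLpNorm (fC n) 1 P + eLpNorm (fU n) 1 P := by
        rw [lintegral_add_left' (f := fun ω => ‖fS n ω‖ₑ + ENNReal.ofReal (D n) * ‖fC n ω‖ₑ)
            ((hfS n).enorm.add ((hfC n).enorm.const_mul _)),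
          lintegral_add_left' (f := fun ω => ‖fS n ω‖ₑ) (hfS n).enorm,
          lintegral_const_mul'' _ (hfC n).enorm]
        simp only [eLpNorm_one_eq_lintegral_enorm]
    _ ≤ _ := by
        gcongr
        · exact hS n hn
        · exact hC n
        · exact hU n hn

variable {X : ℕ → Ω → EuclideanSpace ℝ (Fin d)} {Err : ℕ → Ω → Matrix (Fin d) (Fin d) ℝ}

theorem measurable_sum_act_noise (hX : IsLinearWalk P X A Sig Err)
    (M : ℕ → Matrix (Fin d) (Fin d) ℝ) (n : ℕ) :
    Measurable fun ω => ∑ k ∈ Finset.Ioc 0 n, act (M k) (noise A X k ω) := by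
  refine Finset.measurable_sum _ fun k hk => ?_
  obtain ⟨j, rfl⟩ : ∃ j, k = j + 1 := ⟨k - 1, by have := Finset.mem_Ioc.1 hk; omega⟩
  exact (continuous_act _).measurable.comp
    ((hX.measurable_noise j).mono (hX.pastFiltration.le _) le_rfl)

theorem measurable_remS (hX : IsLinearWalk P X A Sig Err) (n : ℕ) : Measurable (remS A X n) := by
  have h : Measurable fun ω => (Real.sqrt n)⁻¹ • act (projS A) (walk X n ω) :=
    ((continuous_act (projS A)).measurable.comp (hX.measurable_walk n)).const_smul (Real.sqrt n)⁻¹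
  exact h.sub (measurable_sum_act_noise hX (weightS A n) (n ^ 2))

theorem measurable_remC (hX : IsLinearWalk P X A Sig Err) (n : ℕ) : Measurable (remC A X n) :=
  ((continuous_act _).measurable.comp (hX.measurable_walk n)).sub
    (measurable_sum_act_noise hX _ _)

/-- The complex rescaled walk. -/
noncomputable def rescaledC (K : CriticalJordanForm A) (X : ℕ → Ω → EuclideanSpace ℝ (Fin d))
    (W : Ω → EuclideanSpace ℝ (Fin d)) (n : ℕ) (ω : Ω) :
    EuclideanSpace ℂ (Fin d ⊕ Fin d ⊕ Fin d) :=
  stack (vecC ((Real.sqrt n)⁻¹ • act (projS A) (walk X n ω)))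
    (act (K.Dinv n) (vecC (act (natPow n (-(A * projC A)) * projC A) (walk X n ω))))
    (vecC ((Real.sqrt n)⁻¹ • (act (projU A) (walk X n ω) - act (natPow n (A * projU A)) (W ω))))

/-- The real rescaled walk, for a real normalization. -/
noncomputable def rescaledR (K : CriticalJordanForm A) (X : ℕ → Ω → EuclideanSpace ℝ (Fin d))
    (W : Ω → EuclideanSpace ℝ (Fin d)) (n : ℕ) (ω : Ω) :
    EuclideanSpace ℝ (Fin d ⊕ Fin d ⊕ Fin d) :=
  stack ((Real.sqrt n)⁻¹ • act (projS A) (walk X n ω))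
    (act ((K.Dinv n).map Complex.re) (act (natPow n (-(A * projC A)) * projC A) (walk X n ω)))
    ((Real.sqrt n)⁻¹ • (act (projU A) (walk X n ω) - act (natPow n (A * projU A)) (W ω)))

theorem measurable_rescaledC (K : CriticalJordanForm A) (hX : IsLinearWalk P X A Sig Err)
    {W : Ω → EuclideanSpace ℝ (Fin d)} (hW : Measurable W) (n : ℕ) :
    Measurable (rescaledC K X W n) := by
  have h1 : Continuous fun p : EuclideanSpace ℝ (Fin d) × EuclideanSpace ℝ (Fin d) =>
      (Real.sqrt n)⁻¹ • act (projS A) p.1 :=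
    ((continuous_act (projS A)).comp continuous_fst).const_smul (Real.sqrt n)⁻¹
  have h2 : Continuous fun p : EuclideanSpace ℝ (Fin d) × EuclideanSpace ℝ (Fin d) =>
      (Real.sqrt n)⁻¹ • (act (projU A) p.1 - act (natPow n (A * projU A)) p.2) := by
    refine Continuous.const_smul ?_ (Real.sqrt n)⁻¹
    exact ((continuous_act (projU A)).comp continuous_fst).sub
      ((continuous_act (natPow n (A * projU A))).comp continuous_snd)
  have h : Continuous fun p : EuclideanSpace ℝ (Fin d) × EuclideanSpace ℝ (Fin d) =>
      stack (vecC ((Real.sqrt n)⁻¹ • act (projS A) p.1))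
        (act (K.Dinv n) (vecC (act (natPow n (-(A * projC A)) * projC A) p.1)))
        (vecC ((Real.sqrt n)⁻¹ • (act (projU A) p.1 - act (natPow n (A * projU A)) p.2))) := by
    exact continuous_stack (continuous_vecC.comp h1) ((continuous_act _).comp
      (continuous_vecC.comp ((continuous_act _).comp continuous_fst))) (continuous_vecC.comp h2)
  have h' := h.measurable.comp ((hX.measurable_walk n).prodMk hW)
  unfold rescaledC
  simpa only [Function.comp_def] using h'

theorem measurable_rescaledR (K : CriticalJordanForm A) (hX : IsLinearWalk P X A Sig Err)
    {W : Ω → EuclideanSpace ℝ (Fin d)} (hW : Measurable W) (n : ℕ) :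
    Measurable (rescaledR K X W n) := by
  have h1 : Continuous fun p : EuclideanSpace ℝ (Fin d) × EuclideanSpace ℝ (Fin d) =>
      (Real.sqrt n)⁻¹ • act (projS A) p.1 :=
    ((continuous_act (projS A)).comp continuous_fst).const_smul (Real.sqrt n)⁻¹
  have h2 : Continuous fun p : EuclideanSpace ℝ (Fin d) × EuclideanSpace ℝ (Fin d) =>
      (Real.sqrt n)⁻¹ • (act (projU A) p.1 - act (natPow n (A * projU A)) p.2) := by
    refine Continuous.const_smul ?_ (Real.sqrt n)⁻¹
    exact ((continuous_act (projU A)).comp continuous_fst).sub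
      ((continuous_act (natPow n (A * projU A))).comp continuous_snd)
  have h : Continuous fun p : EuclideanSpace ℝ (Fin d) × EuclideanSpace ℝ (Fin d) =>
      stack ((Real.sqrt n)⁻¹ • act (projS A) p.1)
        (act ((K.Dinv n).map Complex.re) (act (natPow n (-(A * projC A)) * projC A) p.1))
        ((Real.sqrt n)⁻¹ • (act (projU A) p.1 - act (natPow n (A * projU A)) p.2)) := by
    exact continuous_stack h1 ((continuous_act _).comp ((continuous_act _).comp continuous_fst)) h2
  have h' := h.measurable.comp ((hX.measurable_walk n).prodMk hW)
  unfold rescaledR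
  simpa only [Function.comp_def] using h'

/-- By linearity, subtracting the weighted noise leaves the three remainders, the critical one still
multiplied by D_n⁻¹. -/
theorem rescaledC_sub (K : CriticalJordanForm A) (X : ℕ → Ω → EuclideanSpace ℝ (Fin d))
    (W : Ω → EuclideanSpace ℝ (Fin d)) (n : ℕ) (ω : Ω) :
    rescaledC K X W n ω -
      ∑ k ∈ Finset.Ioc 0 (n ^ 2), actRect (K.jointWeight n k) (vecC (noise A X k ω)) =
    stack (vecC (remS A X n ω)) (act (K.Dinv n) (vecC (remC A X n ω))) (vecC (remU A X W n ω)) := by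
  simp only [CriticalJordanForm.jointWeight, actRect_stackRows,
    CriticalJordanForm.criticalWeight, mul_act, ← vecC_act]
  rw [stack_sum, ← act_sum, ← vecC_sum, ← vecC_sum, ← vecC_sum, rescaledC, stack_sub, ← vecC_sub,
    ← act_sub, ← vecC_sub, ← vecC_sub]
  rfl

theorem rescaledR_sub (K : CriticalJordanForm A) (X : ℕ → Ω → EuclideanSpace ℝ (Fin d))
    (W : Ω → EuclideanSpace ℝ (Fin d)) (n : ℕ) (ω : Ω) :
    rescaledR K X W n ω -
      ∑ k ∈ Finset.Ioc 0 (n ^ 2), actRect (K.realWeight n k) (noise A X k ω) =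
    stack (remS A X n ω) (act ((K.Dinv n).map Complex.re) (remC A X n ω)) (remU A X W n ω) := by
  simp only [CriticalJordanForm.realWeight, actRect_stackRows, mul_act]
  rw [stack_sum, ← act_sum, rescaledR, stack_sub, ← act_sub]
  rfl

variable [IsProbabilityMeasure P] {XiS XiU : Matrix (Fin d) (Fin d) ℝ} {M V q C' : ℝ} {e : ℕ → ℝ}

theorem tendstoInMeasure_zero_of_norm_le_rem (K : CriticalJordanForm A) (hX : IsLinearWalk P X A Sig Err)
    (hr : HasRates A a b c C) (hD : IsMartingaleDiff P hX.pastFiltration (noise A X) V)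
    (h1 : ∀ n, 1 ≤ n → MemLp (X n) 1 P ∧ lpNorm (X n) 1 P ≤ M)
    {W : Ω → EuclideanSpace ℝ (Fin d)}
    (hW : ∀ᵐ ω ∂P, Tendsto
      (fun n : ℕ => act (projU A * flow A (-Real.log n)) (walk X n ω)) atTop (𝓝 (W ω)))
    {E : Type*} [NormedAddCommGroup E] {g : ℕ → Ω → E} (hg : ∀ n, AEStronglyMeasurable (g n) P)
    (hle : ∀ n ω, ‖g n ω‖ ≤ ‖remS A X n ω‖ + ‖K.Dinv n‖ * ‖remC A X n ω‖ + ‖remU A X W n ω‖) :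
    TendstoInMeasure P g atTop 0 := by
  obtain ⟨KS, hKS⟩ := exists_eLpNorm_remS_le hr h1
  obtain ⟨KC, hKC⟩ := exists_eLpNorm_remC_le hr h1
  obtain ⟨KU, hKU⟩ := exists_eLpNorm_remU_le hr hD h1 hW
  have hS0 := (tendsto_natCast_rpow_neg (s := a - 1 / 2) (by linarith [hr.a_lt])).const_mul KS
  have hU0 := ((tendsto_natCast_rpow_neg (s := -((2 * c - 1) / 4))
    (by linarith [hr.c_gt])).add (tendsto_natCast_rpow_neg (s := -(1 / 4))
    (by norm_num))).const_mul KU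
  rw [mul_zero] at hS0
  rw [add_zero, mul_zero] at hU0
  exact tendstoInMeasure_of_norm_le hg (fun n => (measurable_remS hX n).aestronglyMeasurable)
    (fun n => (measurable_remC hX n).aestronglyMeasurable) hle (fun n => norm_nonneg _) hKS hKC hKU
    hS0 (by simpa using K.tendsto_Dinv.norm) hU0

/-- Slutsky's theorem: the rescaled walk differs from the weighted noise by a vector tending to zero
in measure. -/
theorem exists_tendstoInDistribution_rescaledC (K : CriticalJordanForm A)
    (hX : IsLinearWalk P X A Sig Err) (hSig : Sig.PosDef) (hr : HasRates A a b c C)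
    (hN : IsNoise P hX.pastFiltration (noise A X) Sig q C' e)
    (hD : IsMartingaleDiff P hX.pastFiltration (noise A X) V)
    (h1 : ∀ n, 1 ≤ n → MemLp (X n) 1 P ∧ lpNorm (X n) 1 P ≤ M)
    (hS : IsLyapunovSolution (projS A) ((1 / 2 : ℝ) • projS A - A * projS A) Sig XiS)
    (hU : IsLyapunovSolution (projU A) (A * projU A - (1 / 2 : ℝ) • projU A) Sig XiU)
    {W : Ω → EuclideanSpace ℝ (Fin d)} (hWm : Measurable W)
    (hW : ∀ᵐ ω ∂P, Tendsto
      (fun n : ℕ => act (projU A * flow A (-Real.log n)) (walk X n ω)) atTop (𝓝 (W ω))) :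
    ∃ ν : ProbabilityMeasure (EuclideanSpace ℂ (Fin d ⊕ Fin d ⊕ Fin d)),
      IsCentredComplexGaussian (ν : Measure (EuclideanSpace ℂ (Fin d ⊕ Fin d ⊕ Fin d)))
        (blockDiag (toC XiS) (K.XiC Sig) (toC XiU))
        (blockDiag (toC XiS) (K.pseudoXiC Sig) (toC XiU)) ∧
      TendstoInDistribution (rescaledC K X W) atTop id (fun _ => P)
        (ν : Measure (EuclideanSpace ℂ (Fin d ⊕ Fin d ⊕ Fin d))) := by
  obtain ⟨δ, hδ, hb⟩ := K.exists_norm_jointWeight_le hr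
  obtain ⟨ν, hν, hlim⟩ := hN.exists_tendstoInDistribution_complex hSig
    (fun n k => K.jointWeight n k) (fun n => n ^ 2) hδ hb (K.tendsto_jointWeight_sum hr hS hU)
    (K.tendsto_jointWeight_sum_pseudo hr hS hU)
  refine ⟨ν, hν, ?_⟩
  have hm : ∀ n, AEMeasurable (rescaledC K X W n) P := fun n =>
    (measurable_rescaledC K hX hWm n).aemeasurable
  refine tendstoInDistribution_of_tendstoInMeasure_sub (rescaledC K X W) id hlim ?_ hm
  refine tendstoInMeasure_zero_of_norm_le_rem K hX hr hD h1 hW (fun n =>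
    ((hm n).sub (hlim.forall_aemeasurable n)).aestronglyMeasurable) fun n ω => ?_
  simp only [Pi.sub_apply]
  rw [rescaledC_sub]
  refine (norm_stack_le _ _ _).trans ?_
  rw [norm_vecC, norm_vecC]
  gcongr
  exact (norm_act_le _ _).trans_eq (by rw [norm_vecC])

/-- The same comparison over ℝ: once D_n is real, the joint weights are real matrices and the real
central limit theorem applies. -/
theorem tendstoInDistribution_rescaledR (K : CriticalJordanForm A)
    (hX : IsLinearWalk P X A Sig Err) (hSig : Sig.PosDef) (hr : HasRates A a b c C)
    (hN : IsNoise P hX.pastFiltration (noise A X) Sig q C' e)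
    (hD : IsMartingaleDiff P hX.pastFiltration (noise A X) V)
    (h1 : ∀ n, 1 ≤ n → MemLp (X n) 1 P ∧ lpNorm (X n) 1 P ≤ M)
    (hS : IsLyapunovSolution (projS A) ((1 / 2 : ℝ) • projS A - A * projS A) Sig XiS)
    (hU : IsLyapunovSolution (projU A) (A * projU A - (1 / 2 : ℝ) • projU A) Sig XiU)
    {W : Ω → EuclideanSpace ℝ (Fin d)} (hWm : Measurable W)
    (hW : ∀ᵐ ω ∂P, Tendsto
      (fun n : ℕ => act (projU A * flow A (-Real.log n)) (walk X n ω)) atTop (𝓝 (W ω)))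
    (h : ∀ n i j, (K.D n i j).im = 0) :
    (blockDiag XiS ((K.XiC Sig).map Complex.re) XiU).PosSemidef ∧
      TendstoInDistribution (rescaledR K X W) atTop id (fun _ => P)
        (multivariateGaussian 0 (blockDiag XiS ((K.XiC Sig).map Complex.re) XiU)) := by
  obtain ⟨δ, hδ, hb⟩ := K.exists_norm_jointWeight_le hr
  have hsum := K.tendsto_realWeight_sum hr hS hU h
  refine ⟨posSemidef_of_tendsto_sum hSig (fun n k => K.realWeight n k) (fun n => n ^ 2) hsum, ?_⟩
  have hlim := hN.tendstoInDistribution hSig (fun n k => K.realWeight n k) (fun n => n ^ 2) hδ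
    (hb.mono fun n hn k hk => by
      rw [← norm_toC, K.toC_realWeight h]
      exact hn k hk) hsum
  have hm : ∀ n, AEMeasurable (rescaledR K X W n) P := fun n =>
    (measurable_rescaledR K hX hWm n).aemeasurable
  refine tendstoInDistribution_of_tendstoInMeasure_sub (rescaledR K X W) id hlim ?_ hm
  refine tendstoInMeasure_zero_of_norm_le_rem K hX hr hD h1 hW (fun n =>
    ((hm n).sub (hlim.forall_aemeasurable n)).aestronglyMeasurable) fun n ω => ?_
  simp only [Pi.sub_apply]
  rw [rescaledR_sub]
  refine (norm_stack_le _ _ _).trans ?_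
  gcongr
  exact (norm_act_le _ _).trans_eq (by rw [← norm_toC, K.toC_re_Dinv h])

theorem exists_measurable_limit_unstable (hX : IsLinearWalk P X A Sig Err)
    (hr : HasRates A a b c C) (hD : IsMartingaleDiff P hX.pastFiltration (noise A X) V)
    (h2 : ∀ n, 1 ≤ n → MemLp (X n) 2 P ∧ lpNorm (X n) 2 P ≤ M) :
    ∃ W : Ω → EuclideanSpace ℝ (Fin d), Measurable W ∧ ∀ᵐ ω ∂P, Tendsto
      (fun n : ℕ => act (projU A * flow A (-Real.log n)) (walk X n ω)) atTop (𝓝 (W ω)) :=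
  measurable_limit_of_tendsto_metrizable_ae
    (fun n => ((continuous_act (projU A * flow A (-Real.log n))).measurable.comp
      (hX.measurable_walk n)).aemeasurable)
    (IsLinearWalk.ae_exists_tendsto_unstable hr hD h2)

end Probability

end Assembly

end RWSD

/-! ### The theorem. -/

theorem theorem3 {Ω : Type*} [MeasurableSpace Ω] (P : Measure Ω) [IsProbabilityMeasure P] {d : ℕ}
    (X : ℕ → Ω → EuclideanSpace ℝ (Fin d)) (A Sig : Matrix (Fin d) (Fin d) ℝ)
    (Err : ℕ → Ω → Matrix (Fin d) (Fin d) ℝ)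
    (hA : ∀ z ∈ spectrum ℂ (RWSD.toC A), 0 < z.re ∧ z.re < 1)
    (hSig : Sig.PosDef)
    (hX : RWSD.IsLinearWalk P X A Sig Err) :
    ∃ (W : Ω → EuclideanSpace ℝ (Fin d)) (XiS XiU : Matrix (Fin d) (Fin d) ℝ),
      Measurable W ∧
      (∀ᵐ ω ∂P, Tendsto
        (fun n : ℕ => RWSD.act (RWSD.natPow n (-A) * RWSD.projU A) (RWSD.walk X n ω))
        atTop (𝓝 (W ω))) ∧
      -- the two Lyapunov equations have the unique solutions `XiS` and `XiU`
      (∀ Xi : Matrix (Fin d) (Fin d) ℝ,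
        RWSD.IsLyapunovSolution (RWSD.projS A)
          ((1 / 2 : ℝ) • RWSD.projS A - A * RWSD.projS A) Sig Xi ↔ Xi = XiS) ∧
      (∀ Xi : Matrix (Fin d) (Fin d) ℝ,
        RWSD.IsLyapunovSolution (RWSD.projU A)
          (A * RWSD.projU A - (1 / 2 : ℝ) • RWSD.projU A) Sig Xi ↔ Xi = XiU) ∧
      ∀ K : RWSD.CriticalJordanForm A,
        -- for every Jordan basis, possibly with a complex normalization `D_n`
        (∃ ν : ProbabilityMeasure (EuclideanSpace ℂ (Fin d ⊕ Fin d ⊕ Fin d)),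
          RWSD.IsCentredComplexGaussian (ν : Measure (EuclideanSpace ℂ (Fin d ⊕ Fin d ⊕ Fin d)))
            (RWSD.blockDiag (RWSD.toC XiS) (K.XiC Sig) (RWSD.toC XiU))
            (RWSD.blockDiag (RWSD.toC XiS) (K.pseudoXiC Sig) (RWSD.toC XiU)) ∧
          TendstoInDistribution
            (fun (n : ℕ) ω => RWSD.stack
              (RWSD.vecC ((Real.sqrt n)⁻¹ • RWSD.act (RWSD.projS A) (RWSD.walk X n ω)))
              (RWSD.act (K.Dinv n) (RWSD.vecC
                (RWSD.act (RWSD.natPow n (-(A * RWSD.projC A)) * RWSD.projC A)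
                  (RWSD.walk X n ω))))
              (RWSD.vecC ((Real.sqrt n)⁻¹ • (RWSD.act (RWSD.projU A) (RWSD.walk X n ω)
                - RWSD.act (RWSD.natPow n (A * RWSD.projU A)) (W ω)))))
            atTop id (fun _ => P)
            (ν : Measure (EuclideanSpace ℂ (Fin d ⊕ Fin d ⊕ Fin d)))) ∧
        -- if the normalization `D_n` is real, the limit is the real Gaussian law
        ((∀ n i j, (K.D n i j).im = 0) →
          (∀ i j, (K.XiC Sig i j).im = 0) ∧
          (RWSD.blockDiag XiS ((K.XiC Sig).map Complex.re) XiU).PosSemidef ∧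
          TendstoInDistribution
            (fun (n : ℕ) ω => RWSD.stack
              ((Real.sqrt n)⁻¹ • RWSD.act (RWSD.projS A) (RWSD.walk X n ω))
              (RWSD.act ((K.Dinv n).map Complex.re)
                (RWSD.act (RWSD.natPow n (-(A * RWSD.projC A)) * RWSD.projC A)
                  (RWSD.walk X n ω)))
              ((Real.sqrt n)⁻¹ • (RWSD.act (RWSD.projU A) (RWSD.walk X n ω)
                - RWSD.act (RWSD.natPow n (A * RWSD.projU A)) (W ω))))
            atTop id (fun _ => P)
            (multivariateGaussian 0
              (RWSD.blockDiag XiS ((K.XiC Sig).map Complex.re) XiU))) := by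
  obtain ⟨a, b, c, C, hr⟩ := RWSD.exists_hasRates A hA
  obtain ⟨XiS, hXS⟩ := RWSD.exists_lyapunov_stable hr Sig
  obtain ⟨XiU, hXU⟩ := RWSD.exists_lyapunov_unstable hr Sig
  obtain ⟨q, C', M, V, e, -, hN, hD, h2⟩ := hX.exists_isNoise hr
  have h1 : ∀ n, 1 ≤ n → MemLp (X n) 1 P ∧ lpNorm (X n) 1 P ≤ M := fun n hn =>
    ⟨(h2 n hn).1.mono_exponent (by norm_num),
      (RWSD.lpNorm_mono_exponent (by norm_num) (h2 n hn).1).trans (h2 n hn).2⟩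
  obtain ⟨W, hWm, hW⟩ := RWSD.exists_measurable_limit_unstable hX hr hD h2
  have hS := (hXS XiS).2 rfl
  have hU := (hXU XiU).2 rfl
  refine ⟨W, XiS, XiU, hWm, ?_, hXS, hXU, fun K => ⟨?_, fun h => ⟨K.im_XiC_eq_zero h Sig, ?_⟩⟩⟩
  · filter_upwards [hW] with ω hω
    -- The projection commutes with the flow, so its position beside n^{-A} does not matter.
    simpa only [RWSD.natPow_neg, RWSD.flow_mul_comm (RWSD.mul_projU A)] using hω
  · exact RWSD.exists_tendstoInDistribution_rescaledC K hX hSig hr hN hD h1 hS hU hWm hW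
  · exact RWSD.tendstoInDistribution_rescaledR K hX hSig hr hN hD h1 hS hU hWm hW h
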